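/- **Setting.** Let $m,n\ge 1$, $\phi=m/n$, and fix $\mu_\ast,\mu^{(0)}\in\mathbb R^n$ and $\xi\in\mathbb R^m$. Put $\sigma_{\mu_\ast}^2=\|\mu_\ast\|^2/n$ and $\mathrm{sign}(x)=2\cdot 1_{x\ge 0}-1$. Let $\mathsf L:\mathbb R^2\to\mathbb R$ be a loss function, $\eta>0$ a step size, and $\mathsf P_{t;\ell}:\mathbb R\to\mathbb R$ ($t\ge1$, $\ell\in[n]$) the coordinate maps of row-separable operators $\mathsf P_t:\mathbb R^n\to\mathbb R^n$ (for instance $\mathsf P_t=\mathrm{prox}_{\eta\mathsf f}$). These belong to generalized logistic regression $Y_i=\mathrm{sign}(\langle A_i,\mu_\ast\rangle+\xi_i)$, $i\in[m]$, with the proximal gradient descent $\mu^{(t)}=\mathsf P_t(\mu^{(t-1)}-\eta A^\top\partial_1\mathsf L(A\mu^{(t-1)},Y))$. Write $\pi_m,\pi_n$ for uniform random indices in $[m]=\{1,\dots,m\}$ and $[n]=\{1,\dots,n\}$, independent of everything else; $\mathbb E$ denotes expectation with $\mu_\ast,\mu^{(0)},\xi$ held fixed. **State evolution.** Let $\Omega_{-1}=\mu_\ast$,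 $\Omega_0=\mu^{(0)}$, $\mathfrak Z^{(0)}\sim\mathcal N(0,\sigma_{\mu_\ast}^2)$. For $t=1,2,\dots$ define successively, for $k\in[m]$ and $\ell\in[n]$: - $\Upsilon_{t;k}(z_{[0:t]})=-\eta\,\partial_1\mathsf L\big(z_t+\sum_{s=1}^{t-1}\rho_{t-1,s}\Upsilon_{s;k}(z_{[0:s]}),\ \mathrm{sign}(z_0+\xi_k)\big)$; - the centered Gaussian vector $\mathfrak Z^{([0:t])}$ by $\mathrm{Cov}(\mathfrak Z^{(t)},\mathfrak Z^{(s)})=\mathbb E\,\Omega_{s-1;\pi_n}(\mathfrak W^{([1:s-1])})\,\Omega_{t-1;\pi_n}(\mathfrak W^{([1:t-1])})$, $0\le s\le t$; - $\tau_{t,s}=\phi\,\mathbb E\,\partial_{z_s}\Upsilon_{t;\pi_m}(\mathfrak Z^{([0:t])})$, $1\le s\le t$, and, when $\mu_\ast\ne0$, the information parameter $$\delta_t=\frac{\phi}{\sigma_{\mu_\ast}^2}\Big(\mathbb E\,\mathfrak Z^{(0)}\Upsilon_{t;\pi_m}(\mathfrak Z^{([0:t])})-\phi^{-1}\sum_{s=1}^t\tau_{t,s}\,\mathrm{Cov}(\mathfrak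 Z^{(0)},\mathfrak Z^{(s)})\Big);$$ - the centered Gaussian vector $\mathfrak W^{([1:t])}$ by $\mathrm{Cov}(\mathfrak W^{(t)},\mathfrak W^{(s)})=\phi\,\mathbb E\,\Upsilon_{s;\pi_m}(\mathfrak Z^{([0:s])})\Upsilon_{t;\pi_m}(\mathfrak Z^{([0:t])})$, $1\le s\le t$; - $\Omega_{t;\ell}(w_{[1:t]})=\mathsf P_{t;\ell}\big(w_t+\sum_{s=1}^t(\tau_{t,s}+1_{t=s})\Omega_{s-1;\ell}(w_{[1:s-1]})+\delta_t\mu_{\ast,\ell}\big)$ and $\rho_{t,s}=\mathbb E\,\partial_{w_s}\Omega_{t;\pi_n}(\mathfrak W^{([1:t])})$ for $s\in[1:t]$. (For $\mu_\ast=0$ nothing is claimed below.) Let $\mathfrak O_t(\boldsymbol\rho^{[t-1]})\in\mathbb R^{t\times t}$ be the strictly lower triangular matrix with entries $\rho_{r-1,s}$ for $1\le s<r\le t$ and $0$ elsewhere. Let $$\Theta^\circ_t(z_{[0:t]})=z_t-\sum_{s=1}^{t-1}\eta\,\rho_{t-1,s}\,\partial_1\mathsf L\big(\Theta^\circ_s(z_{[0:s]}),z_0\big),\qquad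 t\ge 1,$$ and, for $v>0$, let $\mathfrak g_v$ be the Lebesgue density of $\mathcal N(0,v^2)$. **Lemma.** Fix $t\ge1$ and $K,\Lambda\ge2$. Suppose that $\phi\in[1/K,K]$; that $0<\eta\le\Lambda$; that for all $s\in[1:t]$, $\ell\in[n]$ the map $\mathsf P_{s;\ell}$ is differentiable with $|\mathsf P_{s;\ell}(0)|\le\Lambda$ and $\mathsf P_{s;\ell},\mathsf P_{s;\ell}'$ both $\Lambda$-Lipschitz; and that $\mathsf L\in C^3(\mathbb R^2)$ with $$|\partial_1\mathsf L(0,0)|+\sup_{x\in\mathbb R,\,y\in[-1,1]}\ \max_{|\alpha|\in\{2,3\}}|\partial_\alpha\mathsf L(x,y)|\le\Lambda .$$ 1. Let $\mathfrak v_t\ge0$ be defined by $\mathfrak v_t^2=\mathbb E\,\mathrm{Var}(\mathfrak Z^{(0)}\mid\mathfrak Z^{([1:t])})$. If $\mathfrak v_t>0$, then $$\delta_t=-2\phi\eta\cdot\mathbb E\Big\{\mathfrak g_{\mathfrak v_t}(\xi_{\pi_m}+\mathsf Z_0)\cdot e_t^\top\big(I_t+\eta\,\mathfrak L_1(U,\mathsf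 Z_{[1:t]})\,\mathfrak O_t(\boldsymbol\rho^{[t-1]})\big)^{-1}\mathfrak l_2(U,\mathsf Z_{[1:t]})\Big\},$$ where the random variable in braces is integrable, $(\mathsf Z_0,\mathsf Z_{[1:t]})\sim\mathcal N\big(0,\mathrm{Var}(\mathbb E[\mathfrak Z^{([0:t])}\mid\mathfrak Z^{([1:t])}])\big)$, $U\sim\mathrm{Unif}[-1,1]$ is independent of all other variables, $\mathfrak L_1(U,\mathsf Z_{[1:t]})=\mathrm{diag}\big(\{\partial_{11}\mathsf L(\Theta^\circ_s(U,\mathsf Z_{[1:s]}),U)\}_{s\in[t]}\big)\in\mathbb R^{t\times t}$ and $\mathfrak l_2(U,\mathsf Z_{[1:t]})=\big(\partial_{12}\mathsf L(\Theta^\circ_s(U,\mathsf Z_{[1:s]}),U)\big)_{s\in[t]}\in\mathbb R^t$. 2. If $\mathsf L(x,y)=(x-y)^2/2$ and $\mu_\ast\ne0$, then $$\delta_t=-2\,\mathbb E\,\mathfrak g_{\sigma_{\mu_\ast}}(\xi_{\pi_m})\cdot\sum_{s\in[1:t]}\tau_{t,s}.$$ -/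

import Mathlib

open MeasureTheory ProbabilityTheory

namespace GenLogistic

/-! ### Elementary notation -/

/-- The mixed partial derivative `∂₁^a ∂₂^b L` of a function `L (x, y)` of two real variables. -/
noncomputable def pd (a b : ℕ) (L : ℝ → ℝ → ℝ) (x y : ℝ) : ℝ :=
  iteratedDeriv a (fun u => iteratedDeriv b (fun v => L u v) y) x

/-- `sign x = 2 · 1_{x ≥ 0} - 1`. -/
noncomputable def sgn (x : ℝ) : ℝ := if 0 ≤ x then 1 else -1

/-- The Lebesgue density of `N(0, v²)`, for `v > 0`. -/
noncomputable def gaussDensity (v x : ℝ) : ℝ := gaussianPDFReal 0 (Real.toNNReal (v ^ 2)) x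

/-- Expectation over a uniformly distributed index in `{1, …, N}`. -/
noncomputable def avg {N : ℕ} (f : Fin N → ℝ) : ℝ := (N : ℝ)⁻¹ * ∑ i, f i

/-- The partial derivative of `f` in the coordinate `s`, at `z`. -/
noncomputable def partialAt (s : ℕ) (f : (ℕ → ℝ) → ℝ) (z : ℕ → ℝ) : ℝ :=
  deriv (fun u => f (Function.update z s u)) (z s)

/-- Vectors indexed by a finite set `I` of times are represented by sequences that vanish
outside `I`. -/
noncomputable def extend (I : Finset ℕ) (x : EuclideanSpace ℝ I) : ℕ → ℝ :=
  fun i => if h : i ∈ I then x ⟨i, h⟩ else 0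

/-- The centered Gaussian law on `ℝ^I` with covariance `(C i j)_{i, j ∈ I}`. -/
noncomputable def gaussianLaw (I : Finset ℕ) (C : ℕ → ℕ → ℝ) : Measure (ℕ → ℝ) :=
  (multivariateGaussian 0 (Matrix.of fun i j : I => C i j)).map (extend I)

/-- The symmetric table with the lower triangle of `C`. -/
def symTable (C : ℕ → ℕ → ℝ) (i j : ℕ) : ℝ := C (max i j) (min i j)

/-! ### The model and its state evolution -/

/-- The data of generalized logistic regression `Y_i = sign (⟨A_i, μ_*⟩ + ξ_i)`, `i = 1, …, m`,
and of the algorithm `μ^(t) = P_t (μ^(t-1) - η Aᵀ ∂₁L (A μ^(t-1), Y))` started at `μ^(0)`, where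
`P_t` acts on the coordinate `ℓ` through `P t ℓ`. The signal `μ_*`, the initialization `μ^(0)`
and the noise `ξ` are fixed. -/
structure Model (m n : ℕ) where
  /-- the loss function `L (x, y)` -/
  L : ℝ → ℝ → ℝ
  /-- the step size -/
  η : ℝ
  /-- the (proximal) operators -/
  P : ℕ → Fin n → ℝ → ℝ
  /-- the signal `μ_*` -/
  μstar : Fin n → ℝ
  /-- the initialization `μ^(0)` -/
  μinit : Fin n → ℝ
  /-- the noise -/
  ξ : Fin m → ℝ

/-- The parameters of the state evolution. Only the following entries are meaningful:
`rho t s` and `tau t s` for `1 ≤ s ≤ t` (and `0` for `1 ≤ t < s`), `delta t` for `1 ≤ t`,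
`covZ t s = Cov (Z^(t), Z^(s))` for `0 ≤ s ≤ t`, `covW t s = Cov (W^(t), W^(s))` for
`1 ≤ s ≤ t`. -/
structure SEParams where
  rho : ℕ → ℕ → ℝ
  tau : ℕ → ℕ → ℝ
  delta : ℕ → ℝ
  covZ : ℕ → ℕ → ℝ
  covW : ℕ → ℕ → ℝ

namespace Model

variable {m n : ℕ} (D : Model m n)

/-- The aspect ratio `φ = m / n`. -/
noncomputable def φ (_D : Model m n) : ℝ := (m : ℝ) / (n : ℝ)

/-- The signal strength squared, `σ² = ‖μ_*‖² / n`. -/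
noncomputable def sigmaSq : ℝ := (∑ i, D.μstar i ^ 2) / (n : ℝ)

/-- The function `Υ_{t;k} (z^(0), …, z^(t))`, `t ≥ 1`. -/
noncomputable def upsilon (rho : ℕ → ℕ → ℝ) (k : Fin m) (z : ℕ → ℝ) (t : ℕ) : ℝ :=
  -D.η * pd 1 0 D.L
    (z t + ∑ s ∈ (Finset.Icc 1 (t - 1)).attach, rho (t - 1) s.1 * upsilon rho k z s.1)
    (sgn (z 0 + D.ξ k))
termination_by t
decreasing_by
  have := Finset.mem_Icc.1 s.2
  omega

/-- The function `Ω_{t;ℓ} (w^(1), …, w^(t))`, `t ≥ 0`, with `Ω_0 = μ^(0)`. -/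
noncomputable def omega (tau : ℕ → ℕ → ℝ) (delta : ℕ → ℝ) (l : Fin n) (w : ℕ → ℝ) (t : ℕ) : ℝ :=
  if t = 0 then D.μinit l
  else
    D.P t l (w t
      + ∑ s ∈ (Finset.Icc 1 t).attach,
          (tau t s.1 + if t = s.1 then 1 else 0) * omega tau delta l w (s.1 - 1)
      + delta t * D.μstar l)
termination_by t
decreasing_by
  have := Finset.mem_Icc.1 s.2
  omega

/-- The function `Ω_{t-1;ℓ}`, `t ≥ 0`, with the convention `Ω_{-1} = μ_*`. -/
noncomputable def omegaPred (tau : ℕ → ℕ → ℝ) (delta : ℕ → ℝ) (l : Fin n) (w : ℕ → ℝ)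
    (t : ℕ) : ℝ :=
  if t = 0 then D.μstar l else D.omega tau delta l w (t - 1)

/-- The law of `(Z^(0), …, Z^(t))`. -/
noncomputable def lawZ (covZ : ℕ → ℕ → ℝ) (t : ℕ) : Measure (ℕ → ℝ) :=
  gaussianLaw (Finset.Icc 0 t) (symTable covZ)

/-- The law of `(W^(1), …, W^(t))`. -/
noncomputable def lawW (covW : ℕ → ℕ → ℝ) (t : ℕ) : Measure (ℕ → ℝ) :=
  gaussianLaw (Finset.Icc 1 t) (symTable covW)

/-- `Cov (Z^(t), Z^(s)) = E Ω_{s-1;π_n} Ω_{t-1;π_n}`. -/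
noncomputable def covZEntry (tau : ℕ → ℕ → ℝ) (delta : ℕ → ℝ) (covW : ℕ → ℕ → ℝ) (t s : ℕ) : ℝ :=
  avg fun l : Fin n =>
    ∫ w, D.omegaPred tau delta l w s * D.omegaPred tau delta l w t ∂(lawW covW (t - 1))

/-- `τ_{t,s} = φ · E ∂_{Z^(s)} Υ_{t;π_m} (Z^([0:t]))`. -/
noncomputable def tauEntry (rho covZ : ℕ → ℕ → ℝ) (t s : ℕ) : ℝ :=
  D.φ * avg fun k : Fin m =>
    ∫ z, partialAt s (fun z' => D.upsilon rho k z' t) z ∂(lawZ covZ t)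

/-- The information parameter `δ_t`. As `Υ_t` is not differentiable in `z^(0)`, it is defined by
the Gaussian integration-by-parts formula
`δ_t = φ / σ² · (E Z^(0) Υ_{t;π_m} (Z^([0:t])) - φ⁻¹ ∑_{s ∈ [1:t]} τ_{t,s} Cov (Z^(0), Z^(s)))`,
which is meaningful for `μ_* ≠ 0`. -/
noncomputable def deltaEntry (rho tau covZ : ℕ → ℕ → ℝ) (t : ℕ) : ℝ :=
  D.φ / D.sigmaSq *
    ((avg fun k : Fin m => ∫ z, z 0 * D.upsilon rho k z t ∂(lawZ covZ t))
      - D.φ⁻¹ * ∑ s ∈ Finset.Icc 1 t, tau t s * covZ s 0)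

/-- `Cov (W^(t), W^(s)) = φ · E Υ_{s;π_m} Υ_{t;π_m}`. -/
noncomputable def covWEntry (rho covZ : ℕ → ℕ → ℝ) (t s : ℕ) : ℝ :=
  D.φ * avg fun k : Fin m => ∫ z, D.upsilon rho k z s * D.upsilon rho k z t ∂(lawZ covZ t)

/-- `ρ_{t,s} = E ∂_{W^(s)} Ω_{t;π_n} (W^([1:t]))`. -/
noncomputable def rhoEntry (tau : ℕ → ℕ → ℝ) (delta : ℕ → ℝ) (covW : ℕ → ℕ → ℝ) (t s : ℕ) : ℝ :=
  avg fun l : Fin n =>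
    ∫ w, partialAt s (fun w' => D.omega tau delta l w' t) w ∂(lawW covW t)

/-- The initialization of the state evolution: `Z^(0) ∼ N(0, σ²)`. -/
noncomputable def seInit : SEParams where
  rho := 0
  tau := 0
  delta := 0
  covZ := Function.update 0 0 fun _ => D.sigmaSq
  covW := 0

/-- Iteration `t` of the state evolution: the parameters of the iterations before `t` are kept,
and those of iteration `t` are computed from them, in the order `Cov (Z^(t), ·)`, `τ_{t,·}`, `δ_t`,
`Cov (W^(t), ·)`, `ρ_{t,·}`. -/
noncomputable def seStep (t : ℕ) (p : SEParams) : SEParams :=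
  let covZ := Function.update p.covZ t (D.covZEntry p.tau p.delta p.covW t)
  let tau := Function.update p.tau t (D.tauEntry p.rho covZ t)
  let delta := Function.update p.delta t (D.deltaEntry p.rho tau covZ t)
  let covW := Function.update p.covW t (D.covWEntry p.rho covZ t)
  let rho := Function.update p.rho t (D.rhoEntry tau delta covW t)
  { rho := rho, tau := tau, delta := delta, covZ := covZ, covW := covW }

/-- The state evolution parameters after `t` iterations. -/
noncomputable def se : ℕ → SEParams
  | 0 => D.seInit
  | t + 1 => D.seStep (t + 1) (se t)

/-- The Onsager coefficients `ρ_{t,s}`. -/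
noncomputable def rho (t s : ℕ) : ℝ := (D.se t).rho t s

/-- The Onsager coefficients `τ_{t,s}`. -/
noncomputable def tau (t s : ℕ) : ℝ := (D.se t).tau t s

/-- The information parameter `δ_t`. -/
noncomputable def delta (t : ℕ) : ℝ := (D.se t).delta t

/-- The covariances of the Gaussian vector `Z^([0:∞))`. -/
noncomputable def covZ (t s : ℕ) : ℝ := (D.se t).covZ t s

/-- The law of the Gaussian vector `Z^([0:t])`. -/
noncomputable def gaussZ (t : ℕ) : Measure (ℕ → ℝ) := lawZ D.covZ t

/-! ### The objects in the formula for `δ_t` -/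

/-- The σ-algebra generated by `Z^([1:t])`. -/
@[reducible] def sigmaZ (t : ℕ) : MeasurableSpace (ℕ → ℝ) :=
  MeasurableSpace.comap (fun (z : ℕ → ℝ) (s : Finset.Icc 1 t) => z s) MeasurableSpace.pi

/-- The conditional standard deviation `𝔳_t`, where `𝔳_t² = E Var (Z^(0) | Z^([1:t]))`. -/
noncomputable def condSd (t : ℕ) : ℝ :=
  Real.sqrt (∫ z, condVar (sigmaZ t) (fun z' : ℕ → ℝ => z' 0) (D.gaussZ t) z ∂(D.gaussZ t))

/-- The covariance matrix `Var (E [Z^([0:t]) | Z^([1:t])])`. -/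
noncomputable def condMeanCov (t r s : ℕ) : ℝ :=
  covariance (condExp (sigmaZ t) (D.gaussZ t) fun z => z r)
    (condExp (sigmaZ t) (D.gaussZ t) fun z => z s) (D.gaussZ t)

/-- The centered Gaussian law of `(𝖹_0, 𝖹_[1:t])`, with covariance
`Var (E [Z^([0:t]) | Z^([1:t])])`. -/
noncomputable def condMeanLaw (t : ℕ) : Measure (ℕ → ℝ) :=
  gaussianLaw (Finset.Icc 0 t) (D.condMeanCov t)

/-- The function `Θ°_t (u, z_1, …, z_t)`, `t ≥ 1`. -/
noncomputable def thetaCirc (u : ℝ) (z : ℕ → ℝ) (t : ℕ) : ℝ :=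
  z t - ∑ s ∈ (Finset.Icc 1 (t - 1)).attach,
    D.η * D.rho (t - 1) s.1 * pd 1 0 D.L (thetaCirc u z s.1) u
termination_by t
decreasing_by
  have := Finset.mem_Icc.1 s.2
  omega

/-- The `t × t` matrix `𝔒_t (ρ^[t-1])`: the matrix `ρ^[t-1] = (ρ_{r,s})_{r,s ∈ [1:t-1]}` moved down
by one row, with first row and last column equal to zero. -/
noncomputable def onsagerMat (t : ℕ) : Matrix (Finset.Icc 1 t) (Finset.Icc 1 t) ℝ :=
  Matrix.of fun r s => if r.1 = 1 ∨ s.1 = t then 0 else D.rho (r.1 - 1) s.1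

/-- The diagonal matrix with entries `∂₁₁ L (Θ°_s (U, 𝖹_[1:s]), U)`, `s ∈ [1:t]`. -/
noncomputable def hessDiag (t : ℕ) (u : ℝ) (z : ℕ → ℝ) :
    Matrix (Finset.Icc 1 t) (Finset.Icc 1 t) ℝ :=
  Matrix.diagonal fun s => pd 2 0 D.L (D.thetaCirc u z s.1) u

/-- The vector with entries `∂₁₂ L (Θ°_s (U, 𝖹_[1:s]), U)`, `s ∈ [1:t]`. -/
noncomputable def crossVec (t : ℕ) (u : ℝ) (z : ℕ → ℝ) : Finset.Icc 1 t → ℝ :=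
  fun s => pd 1 1 D.L (D.thetaCirc u z s.1) u

/-- The `s`-th entry of `(I_t + η 𝔏₁ 𝔒_t (ρ^[t-1]))⁻¹ 𝔩₂`. -/
noncomputable def response (t : ℕ) (u : ℝ) (z : ℕ → ℝ) (s : Finset.Icc 1 t) : ℝ :=
  ((1 + D.η • (D.hessDiag t u z * D.onsagerMat t))⁻¹).mulVec (D.crossVec t u z) s

end Model

/-- The uniform distribution on `[-1, 1]`. -/
noncomputable def unifLaw : Measure ℝ := cond volume (Set.Icc (-1 : ℝ) 1)

end GenLogistic

/-! The variable `Z^(0)` enters `Υ_t` only through the response `y = sgn (Z^(0) + ξ_k)`. With `y`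
frozen, `Υ_t = F (y, Z^([1:t]))`, where `F (y, z) = -η ∂₁L (θ_t (y, z), y)` is smooth
(`upsilon_eq_theta`). If `F` were smooth in `Z^(0)` as well, `δ_t` would be the mean of `∂_{z_0}
Υ_t`, by Gaussian integration by parts. The sign replaces this derivative by a jump term, and the
proof computes that term.

Regress `Z^(0)` on `Z^([1:t])`: `Z^(0) = V + M`, where `M` is linear in the regressors and `V ∼ N(0,
v)` is independent of them, with `v = 𝔳_t²`. Averaging over `V` first smooths the sign. The `V` part
of `E Z^(0) Υ_t` is `v` times the mean of `𝔤_{𝔳_t} (ξ + M) (F 1 - F (-1))`. For the `M` part,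
averaging over `V` leaves a smooth function of `(M, Z^([1:t]))`, to which integration by parts
applies even though this Gaussian vector is degenerate. It produces the terms `Cov (Z^(0), Z^(s)) E
∂_s Υ_t` and the same jump term with weight `Var M`. Since `v + Var M = σ²`, the jump term has total
weight `σ²` (`integral_zero_mul_sgn`). The definition of `δ_t` subtracts the smooth terms and
divides by `σ²` (`delta_eq_integral`).

Finally `F 1 - F (-1)` is the integral over `[-1, 1]` of the derivative of `F` in `y`, which is
where the uniform variable `U` comes from. Differentiating the recursion for `θ` in `y` gives a unit
lower triangular linear system, solved by `(I + η 𝔏₁ 𝔒)⁻¹ 𝔩₂` (`response_eq`).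

All this uses that the tables of the state evolution are genuine covariances, which holds because
they are Gram matrices (`isCovTable_covZ_of_le`). For the quadratic loss `Υ_t` is linear in the
differences `Z^(s) - y`, and a direct computation replaces the conditioning (`delta_of_quadratic`).
-/

namespace GenLogistic

/-! ### Partial derivatives of the loss -/

section Loss

variable {L : ℝ → ℝ → ℝ}

theorem hasFDerivAt_left {f : ℝ × ℝ → ℝ} {f' : ℝ × ℝ →L[ℝ] ℝ} {x y : ℝ}
    (h : HasFDerivAt f f' (x, y)) : HasDerivAt (fun u => f (u, y)) (f' (1, 0)) x :=
  h.comp_hasDerivAt x ((hasDerivAt_id x).prodMk (hasDerivAt_const x y))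

theorem hasFDerivAt_right {f : ℝ × ℝ → ℝ} {f' : ℝ × ℝ →L[ℝ] ℝ} {x y : ℝ}
    (h : HasFDerivAt f f' (x, y)) : HasDerivAt (fun v => f (x, v)) (f' (0, 1)) y :=
  h.comp_hasDerivAt y ((hasDerivAt_const y x).prodMk (hasDerivAt_id y))

theorem pd_one_zero_eq (hL : ContDiff ℝ 3 fun q : ℝ × ℝ => L q.1 q.2) (x y : ℝ) :
    pd 1 0 L x y = fderiv ℝ (fun q : ℝ × ℝ => L q.1 q.2) (x, y) (1, 0) := by
  have h := (hL.differentiable (by norm_num) (x, y)).hasFDerivAt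
  simpa [pd] using (hasFDerivAt_left h).deriv

theorem contDiff_pd_one_zero (hL : ContDiff ℝ 3 fun q : ℝ × ℝ => L q.1 q.2) :
    ContDiff ℝ 2 fun q : ℝ × ℝ => pd 1 0 L q.1 q.2 := by
  have : (fun q : ℝ × ℝ => pd 1 0 L q.1 q.2)
      = fun q => fderiv ℝ (fun q : ℝ × ℝ => L q.1 q.2) q (1, 0) := by
    ext q; exact pd_one_zero_eq hL q.1 q.2
  rw [this]
  exact (hL.fderiv_right (m := 2) (by norm_num)).clm_apply contDiff_const

theorem pd_two_zero_eq (hL : ContDiff ℝ 3 fun q : ℝ × ℝ => L q.1 q.2) (x y : ℝ) :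
    pd 2 0 L x y = fderiv ℝ (fun q : ℝ × ℝ => pd 1 0 L q.1 q.2) (x, y) (1, 0) := by
  have h := ((contDiff_pd_one_zero hL).differentiable (by norm_num) (x, y)).hasFDerivAt
  rw [← (hasFDerivAt_left h).deriv]
  simp [pd, iteratedDeriv_succ]

/-- `pd 1 1` differentiates in `y` first and in `x` second. Symmetry of the second derivative turns
it into the `y`-derivative of `∂₁L`, the form in which the chain rule produces it. -/
theorem pd_one_one_eq (hL : ContDiff ℝ 3 fun q : ℝ × ℝ => L q.1 q.2) (x y : ℝ) :
    pd 1 1 L x y = fderiv ℝ (fun q : ℝ × ℝ => pd 1 0 L q.1 q.2) (x, y) (0, 1) := by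
  set f : ℝ × ℝ → ℝ := fun q => L q.1 q.2 with hf
  have hd : Differentiable ℝ (fderiv ℝ f) :=
    (hL.fderiv_right (m := 2) (by norm_num)).differentiable (by norm_num)
  have h1 : (fun q : ℝ × ℝ => pd 1 0 L q.1 q.2) = fun q => fderiv ℝ f q (1, 0) := by
    ext q; exact pd_one_zero_eq hL q.1 q.2
  have hdir (v w : ℝ × ℝ) :
      fderiv ℝ (fun q => fderiv ℝ f q v) (x, y) w = fderiv ℝ (fderiv ℝ f) (x, y) w v := by
    rw [((hd (x, y)).hasFDerivAt.clm_apply (hasFDerivAt_const v (x, y))).fderiv]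
    simp
  have h2 : (fun u => deriv (fun v => L u v) y) = fun u => fderiv ℝ f (u, y) (0, 1) := by
    ext u
    exact (hasFDerivAt_right (hL.differentiable (by norm_num) (u, y)).hasFDerivAt).deriv
  have h3 : HasFDerivAt (fun q => fderiv ℝ f q (0, 1))
      (fderiv ℝ (fun q => fderiv ℝ f q (0, 1)) (x, y)) (x, y) :=
    ((hd (x, y)).clm_apply (differentiableAt_const _)).hasFDerivAt
  have hs : IsSymmSndFDerivAt ℝ f (x, y) :=
    hL.contDiffAt.isSymmSndFDerivAt (by simp; norm_num)
  rw [h1, hdir, hs.eq, ← hdir, ← (hasFDerivAt_left h3).deriv, ← h2]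
  simp [pd]

theorem continuous_pd_one_zero (hL : ContDiff ℝ 3 fun q : ℝ × ℝ => L q.1 q.2) :
    Continuous fun q : ℝ × ℝ => pd 1 0 L q.1 q.2 :=
  (contDiff_pd_one_zero hL).continuous

theorem continuous_pd_two_zero (hL : ContDiff ℝ 3 fun q : ℝ × ℝ => L q.1 q.2) :
    Continuous fun q : ℝ × ℝ => pd 2 0 L q.1 q.2 := by
  simp_rw [pd_two_zero_eq hL]
  exact ((contDiff_pd_one_zero hL).continuous_fderiv (by norm_num)).clm_apply continuous_const

theorem continuous_pd_one_one (hL : ContDiff ℝ 3 fun q : ℝ × ℝ => L q.1 q.2) :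
    Continuous fun q : ℝ × ℝ => pd 1 1 L q.1 q.2 := by
  simp_rw [pd_one_one_eq hL]
  exact ((contDiff_pd_one_zero hL).continuous_fderiv (by norm_num)).clm_apply continuous_const

theorem continuous_comp_pd_one_zero {α : Type*} [TopologicalSpace α] {a b : α → ℝ}
    (ha : Continuous a) (hb : Continuous b) (hL : ContDiff ℝ 3 fun q : ℝ × ℝ => L q.1 q.2) :
    Continuous fun x => pd 1 0 L (a x) (b x) := by
  have h := continuous_pd_one_zero hL
  generalize pd 1 0 L = f at *
  exact h.comp (ha.prodMk hb)

theorem continuous_comp_pd_two_zero {α : Type*} [TopologicalSpace α] {a b : α → ℝ}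
    (ha : Continuous a) (hb : Continuous b) (hL : ContDiff ℝ 3 fun q : ℝ × ℝ => L q.1 q.2) :
    Continuous fun x => pd 2 0 L (a x) (b x) := by
  have h := continuous_pd_two_zero hL
  generalize pd 2 0 L = f at *
  exact h.comp (ha.prodMk hb)

theorem continuous_comp_pd_one_one {α : Type*} [TopologicalSpace α] {a b : α → ℝ}
    (ha : Continuous a) (hb : Continuous b) (hL : ContDiff ℝ 3 fun q : ℝ × ℝ => L q.1 q.2) :
    Continuous fun x => pd 1 1 L (a x) (b x) := by
  have h := continuous_pd_one_one hL
  generalize pd 1 1 L = f at *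
  exact h.comp (ha.prodMk hb)

theorem hasDerivAt_pd_one_zero (hL : ContDiff ℝ 3 fun q : ℝ × ℝ => L q.1 q.2)
    {a b : ℝ → ℝ} {a' b' m : ℝ} (ha : HasDerivAt a a' m) (hb : HasDerivAt b b' m) :
    HasDerivAt (fun r => pd 1 0 L (a r) (b r))
      (pd 2 0 L (a m) (b m) * a' + pd 1 1 L (a m) (b m) * b') m := by
  have h := ((contDiff_pd_one_zero hL).differentiable (by norm_num) (a m, b m)).hasFDerivAt
  refine (h.comp_hasDerivAt m (ha.prodMk hb)).congr_deriv ?_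
  rw [pd_two_zero_eq hL, pd_one_one_eq hL]
  have : (a', b') = a' • ((1 : ℝ), (0 : ℝ)) + b' • ((0 : ℝ), (1 : ℝ)) := by simp
  rw [this, map_add, map_smul, map_smul, smul_eq_mul, smul_eq_mul, mul_comm, mul_comm b']

theorem abs_le_of_hasDerivAt_of_bound {f f' : ℝ → ℝ} {B : ℝ}
    (hf : ∀ x, HasDerivAt f (f' x) x) (hB : ∀ x, |f' x| ≤ B) (x : ℝ) :
    |f x| ≤ |f 0| + B * |x| := by
  have := convex_univ.norm_image_sub_le_of_norm_hasDerivWithin_le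
    (fun r _ => (hf r).hasDerivWithinAt) (fun r _ => hB r) (Set.mem_univ 0) (Set.mem_univ x)
  simp only [Real.norm_eq_abs, sub_zero] at this
  calc |f x| = |f 0 + (f x - f 0)| := by ring_nf
    _ ≤ _ := (abs_add_le _ _).trans (by gcongr)

/-- Linear growth of `∂₁ L` for responses in `[-1, 1]`. -/
theorem exists_abs_pd_one_zero_le (hL : ContDiff ℝ 3 fun q : ℝ × ℝ => L q.1 q.2) {Λ : ℝ}
    (h20 : ∀ x : ℝ, ∀ y ∈ Set.Icc (-1 : ℝ) 1, |pd 2 0 L x y| ≤ Λ) :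
    ∃ B, ∀ x : ℝ, ∀ y ∈ Set.Icc (-1 : ℝ) 1, |pd 1 0 L x y| ≤ B + Λ * |x| := by
  -- The value at `x = 0` is bounded by compactness of `[-1, 1]`; `Λ` only controls the slope in
  -- `x`.
  obtain ⟨B, hB⟩ := (isCompact_Icc (a := (-1 : ℝ)) (b := 1)).exists_bound_of_continuousOn
    ((continuous_pd_one_zero hL).comp (Continuous.prodMk_right (0 : ℝ))).continuousOn
  refine ⟨B, fun x y hy => ?_⟩
  have hd (r : ℝ) : HasDerivAt (fun r => pd 1 0 L r y) (pd 2 0 L r y) r := by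
    simpa using hasDerivAt_pd_one_zero hL (hasDerivAt_id r) (hasDerivAt_const r y)
  exact (abs_le_of_hasDerivAt_of_bound hd (fun r => h20 r y hy) x).trans
    (add_le_add_left (hB y hy) _)

end Loss

/-! ### One-dimensional Gaussian integrals -/

section RealGaussian

open Filter Topology
open scoped NNReal

theorem hasDerivAt_gaussianPDFReal {v : ℝ≥0} (hv : v ≠ 0) (x : ℝ) :
    HasDerivAt (gaussianPDFReal 0 v) (-(x / v) * gaussianPDFReal 0 v x) x := by
  have hv' : (v : ℝ) ≠ 0 := by exact_mod_cast hv
  have h : HasDerivAt (fun x : ℝ => -(x - 0) ^ 2 / (2 * (v : ℝ))) (-(x / v)) x := by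
    refine ((((hasDerivAt_id x).sub_const 0).pow 2).neg.div_const _).congr_deriv ?_
    simp; field_simp
  refine ((h.exp).const_mul _).congr_deriv ?_
  simp only [gaussianPDFReal]; ring

theorem integral_gaussianReal {v : ℝ≥0} (hv : v ≠ 0) (f : ℝ → ℝ) :
    ∫ x, f x ∂(gaussianReal 0 v) = ∫ x, gaussianPDFReal 0 v x * f x := by
  simpa using integral_gaussianReal_eq_integral_smul (μ := 0) (f := f) hv

theorem integrable_gaussianReal {v : ℝ≥0} (hv : v ≠ 0) {f : ℝ → ℝ} :
    Integrable f (gaussianReal 0 v) ↔ Integrable fun x => gaussianPDFReal 0 v x * f x := by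
  rw [gaussianReal_of_var_ne_zero _ hv,
    integrable_withDensity_iff_integrable_smul₀' (by fun_prop)
      (ae_of_all _ fun _ => gaussianPDF_lt_top)]
  simp [toReal_gaussianPDF]

theorem memLp_id_gaussianReal_two (v : ℝ≥0) : MemLp (fun x : ℝ => x) 2 (gaussianReal 0 v) :=
  memLp_id_gaussianReal 2

theorem memLp_two_of_hasDerivAt_of_bound {v : ℝ≥0} {f f' : ℝ → ℝ} {B : ℝ}
    (hf : ∀ x, HasDerivAt f (f' x) x) (hB : ∀ x, |f' x| ≤ B) :
    MemLp f 2 (gaussianReal 0 v) := by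
  have hc : Continuous f := continuous_iff_continuousAt.2 fun x => (hf x).continuousAt
  refine ((memLp_const |f 0|).add ((memLp_id_gaussianReal_two v).abs.const_mul B)).mono
    hc.aestronglyMeasurable (ae_of_all _ fun x => ?_)
  exact (abs_le_of_hasDerivAt_of_bound hf hB x).trans (le_abs_self _)

/-- Gaussian integration by parts. -/
theorem integral_id_mul_gaussianReal (v : ℝ≥0) {f f' : ℝ → ℝ} {B : ℝ}
    (hf : ∀ x, HasDerivAt f (f' x) x) (hB : ∀ x, |f' x| ≤ B) :
    ∫ x, x * f x ∂(gaussianReal 0 v) = v * ∫ x, f' x ∂(gaussianReal 0 v) := by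
  rcases eq_or_ne v 0 with rfl | hv
  -- For `v = 0` the law is the Dirac mass at `0`, and both sides vanish.
  · simp
  have hv' : (v : ℝ) ≠ 0 := by exact_mod_cast hv
  have hf2 : MemLp f 2 (gaussianReal 0 v) := memLp_two_of_hasDerivAt_of_bound hf hB
  have hm' : Measurable f' := by
    rw [show f' = deriv f from funext fun x => (hf x).deriv.symm]
    exact measurable_deriv f
  have i1 : Integrable (fun x => x * f x) (gaussianReal 0 v) :=
    (memLp_id_gaussianReal_two v).integrable_mul hf2
  have i2 : Integrable f' (gaussianReal 0 v) :=
    (memLp_top_of_bound hm'.aestronglyMeasurable B (ae_of_all _ hB)).integrable (by simp)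
  have i3 := hf2.integrable one_le_two
  rw [integrable_gaussianReal hv] at i1 i2 i3
  -- The density satisfies `g' = -(x / v) g`. Integrability of the three products makes the boundary
  -- terms vanish.
  have key := integral_mul_deriv_eq_deriv_mul_of_integrable (u := f) (u' := f')
    (v := gaussianPDFReal 0 v) (fun x _ => hf x) (fun x _ => hasDerivAt_gaussianPDFReal hv x)
    ((i1.const_mul (-(v : ℝ)⁻¹)).congr (ae_of_all _ fun x => by simp; ring))
    (i2.congr (ae_of_all _ fun x => by simp; ring))
    (i3.congr (ae_of_all _ fun x => by simp; ring))
  rw [integral_gaussianReal hv, integral_gaussianReal hv]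
  have e1 : ∫ x, gaussianPDFReal 0 v x * (x * f x)
      = -(v : ℝ) * ∫ x, f x * (-(x / v) * gaussianPDFReal 0 v x) := by
    rw [← integral_const_mul]
    congr 1; ext x; field_simp
  rw [e1, key, neg_mul_neg]
  congr 2; ext x; ring

theorem tendsto_gaussianPDFReal_atTop {v : ℝ≥0} (hv : v ≠ 0) :
    Tendsto (gaussianPDFReal 0 v) atTop (𝓝 0) := by
  have hv' : (0 : ℝ) < v := by positivity
  have h : Tendsto (fun x : ℝ => -(x - 0) ^ 2 / (2 * (v : ℝ))) atTop atBot := by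
    have : (fun x : ℝ => -(x - 0) ^ 2 / (2 * (v : ℝ))) = fun x : ℝ => -(x ^ 2 / (2 * (v : ℝ))) := by
      ext x; simp; ring
    rw [this]
    exact tendsto_neg_atTop_atBot.comp ((tendsto_pow_atTop two_ne_zero).atTop_div_const (by positivity))
  have h2 := (Real.tendsto_exp_atBot.comp h).const_mul (√(2 * Real.pi * v))⁻¹
  rw [mul_zero] at h2
  exact h2

theorem gaussianPDFReal_zero_neg (v : ℝ≥0) (x : ℝ) :
    gaussianPDFReal 0 v (-x) = gaussianPDFReal 0 v x := by
  simp [gaussianPDFReal]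

theorem measurableSet_nonneg_add (c : ℝ) : MeasurableSet {x : ℝ | 0 ≤ x + c} :=
  measurableSet_le measurable_const (by fun_prop)

/-- The first moment of a centered Gaussian variable on a half-line. -/
theorem integral_id_mul_indicator_gaussianReal {v : ℝ≥0} (hv : v ≠ 0) (c : ℝ) :
    ∫ x, x * (if 0 ≤ x + c then 1 else 0) ∂(gaussianReal 0 v) = v * gaussianPDFReal 0 v c := by
  have hv' : (v : ℝ) ≠ 0 := by exact_mod_cast hv
  have i1 : Integrable (fun x => gaussianPDFReal 0 v x * x) :=
    (integrable_gaussianReal hv).1 ((memLp_id_gaussianReal_two v).integrable one_le_two)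
  have hset : {x : ℝ | 0 ≤ x + c} = Set.Ici (-c) := by ext x; simp [neg_le_iff_add_nonneg]
  rw [integral_gaussianReal hv]
  have e1 : (fun x : ℝ => gaussianPDFReal 0 v x * (x * if 0 ≤ x + c then 1 else 0))
      = Set.indicator (Set.Ici (-c)) fun x => gaussianPDFReal 0 v x * x := by
    ext x
    rw [← hset, Set.indicator_apply]
    simp only [Set.mem_ofPred_eq]
    split_ifs <;> simp
  rw [e1, integral_indicator measurableSet_Ici, integral_Ici_eq_integral_Ioi]
  -- `-v g` is a primitive of `x g(x)` that vanishes at infinity, so only its value at `-c` remains.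
  have := integral_Ioi_of_hasDerivAt_of_tendsto' (a := -c) (m := 0)
    (f := fun x => -(v : ℝ) * gaussianPDFReal 0 v x)
    (f' := fun x => gaussianPDFReal 0 v x * x)
    (fun x _ => ((hasDerivAt_gaussianPDFReal hv x).const_mul _).congr_deriv (by field_simp))
    i1.integrableOn (by simpa using (tendsto_gaussianPDFReal_atTop hv).const_mul (-(v : ℝ)))
  rw [this, gaussianPDFReal_zero_neg]; ring

/-- The probability that `X + c ≥ 0`, where `X ∼ N(0, v)`. -/
noncomputable def upperProb (v : ℝ≥0) (c : ℝ) : ℝ :=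
  ∫ x, (if 0 ≤ x + c then 1 else 0) ∂(gaussianReal 0 v)

theorem integrable_ite_nonneg (v : ℝ≥0) (c : ℝ) :
    Integrable (fun x : ℝ => if 0 ≤ x + c then (1 : ℝ) else 0) (gaussianReal 0 v) := by
  refine (memLp_top_of_bound (Measurable.ite (measurableSet_nonneg_add c) measurable_const
    measurable_const).aestronglyMeasurable 1 (ae_of_all _ fun x => ?_)).integrable (by simp)
  split_ifs <;> simp

theorem abs_upperProb_le (v : ℝ≥0) (c : ℝ) : |upperProb v c| ≤ 1 := by
  have h : ∀ᵐ x ∂gaussianReal 0 v, ‖if 0 ≤ x + c then (1 : ℝ) else 0‖ ≤ 1 :=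
    ae_of_all _ fun x => by split_ifs <;> simp
  simpa [upperProb] using norm_integral_le_of_norm_le_const h

/-- The probability is the integral of the density over `[-c, ∞)`, and the density is even. This is
the smoothing effect of an independent Gaussian variable: the indicator becomes differentiable, with
the density as its derivative. -/
theorem hasDerivAt_upperProb {v : ℝ≥0} (hv : v ≠ 0) (c : ℝ) :
    HasDerivAt (upperProb v) (gaussianPDFReal 0 v c) c := by
  have hcont : Continuous (gaussianPDFReal 0 v) :=
    continuous_iff_continuousAt.2 fun x => (hasDerivAt_gaussianPDFReal hv x).continuousAt
  have hi := integrable_gaussianPDFReal 0 v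
  have e : upperProb v = fun c => (∫ x in Set.Ioi 0, gaussianPDFReal 0 v x)
      - ∫ x in (0 : ℝ)..(-c), gaussianPDFReal 0 v x := by
    ext c
    have hset : {x : ℝ | 0 ≤ x + c} = Set.Ici (-c) := by ext x; simp [neg_le_iff_add_nonneg]
    have e1 : (fun x : ℝ => gaussianPDFReal 0 v x * if 0 ≤ x + c then 1 else 0)
        = Set.indicator (Set.Ici (-c)) fun x => gaussianPDFReal 0 v x := by
      ext x
      rw [← hset, Set.indicator_apply]
      simp only [Set.mem_ofPred_eq]
      split_ifs <;> simp
    rw [upperProb, integral_gaussianReal hv, e1, integral_indicator measurableSet_Ici,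
      integral_Ici_eq_integral_Ioi,
      ← intervalIntegral.integral_interval_add_Ioi (a := 0) (b := -c) hi.integrableOn
        hi.integrableOn]
    ring
  rw [e]
  have h := intervalIntegral.integral_hasDerivAt_right (a := 0) (b := -c)
    (hcont.intervalIntegrable _ _) (hcont.stronglyMeasurableAtFilter _ _) hcont.continuousAt
  have h2 := (h.comp c (hasDerivAt_neg c)).const_sub (∫ x in Set.Ioi 0, gaussianPDFReal 0 v x)
  refine h2.congr_deriv ?_
  rw [gaussianPDFReal_zero_neg]; ring

end RealGaussian

/-! ### Centered Gaussian laws on sequences -/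

section GaussianLaw

open WithLp
open scoped NNReal

variable {I : Finset ℕ} {C : ℕ → ℕ → ℝ}

theorem extend_of_mem (x : EuclideanSpace ℝ I) {i : ℕ} (hi : i ∈ I) : extend I x i = x ⟨i, hi⟩ := by
  simp [extend, hi]

theorem extend_of_notMem (x : EuclideanSpace ℝ I) {i : ℕ} (hi : i ∉ I) : extend I x i = 0 := by
  simp [extend, hi]

@[fun_prop]
theorem measurable_extend (I : Finset ℕ) : Measurable (extend I) := by
  refine measurable_pi_iff.2 fun i => ?_
  by_cases hi : i ∈ I
  · simp_rw [extend_of_mem _ hi]; fun_prop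
  · simp_rw [extend_of_notMem _ hi]; fun_prop

instance isProbabilityMeasure_gaussianLaw (I : Finset ℕ) (C : ℕ → ℕ → ℝ) :
    IsProbabilityMeasure (gaussianLaw I C) :=
  Measure.isProbabilityMeasure_map (measurable_extend I).aemeasurable

theorem gaussianLaw_congr {C' : ℕ → ℕ → ℝ} (h : ∀ i ∈ I, ∀ j ∈ I, C i j = C' i j) :
    gaussianLaw I C = gaussianLaw I C' := by
  have : (Matrix.of fun i j : I => C i j) = Matrix.of fun i j : I => C' i j := by
    ext i j; exact h i i.2 j j.2
  rw [gaussianLaw, this, gaussianLaw]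

theorem ae_gaussianLaw_eq_zero (I : Finset ℕ) (C : ℕ → ℕ → ℝ) :
    ∀ᵐ z ∂gaussianLaw I C, ∀ i, i ∉ I → z i = 0 := by
  refine (ae_all_iff.2 fun i => ?_)
  have hm : MeasurableSet {z : ℕ → ℝ | i ∉ I → z i = 0} := by
    by_cases hi : i ∈ I
    · simp [hi]
    · simpa [hi] using measurableSet_eq_fun (measurable_pi_apply i) measurable_const
  exact (ae_map_iff (measurable_extend I).aemeasurable hm).2
    (ae_of_all _ fun x hi => extend_of_notMem x hi)

/-- The coordinates in `I` are jointly Gaussian under `gaussianLaw I C`. -/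
theorem hasGaussianLaw_gaussianLaw (I : Finset ℕ) (C : ℕ → ℕ → ℝ) :
    HasGaussianLaw (fun (z : ℕ → ℝ) (i : I) => z i) (gaussianLaw I C) where
  isGaussian_map := by
    rw [gaussianLaw, Measure.map_map (by fun_prop) (by fun_prop)]
    have : (fun (z : ℕ → ℝ) (i : I) => z i) ∘ extend I
        = fun x => PiLp.continuousLinearEquiv 2 ℝ (fun _ : I => ℝ) x := by
      ext x i
      simp [extend]
    rw [this]
    exact (IsGaussian.hasGaussianLaw_id.map_equiv_fun _).isGaussian_map

theorem hasGaussianLaw_apply_gaussianLaw {i : ℕ} (hi : i ∈ I) :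
    HasGaussianLaw (fun z : ℕ → ℝ => z i) (gaussianLaw I C) :=
  (hasGaussianLaw_gaussianLaw I C).eval (⟨i, hi⟩ : I)

theorem memLp_apply_gaussianLaw (i : ℕ) :
    MemLp (fun z : ℕ → ℝ => z i) 2 (gaussianLaw I C) := by
  by_cases hi : i ∈ I
  · exact (hasGaussianLaw_apply_gaussianLaw hi).memLp_two
  · refine (memLp_const 0).ae_eq ?_
    filter_upwards [ae_gaussianLaw_eq_zero I C] with z hz
    exact (hz i hi).symm

theorem integral_apply_gaussianLaw (i : ℕ) : ∫ z, z i ∂gaussianLaw I C = 0 := by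
  by_cases hi : i ∈ I
  · rw [gaussianLaw, integral_map (f := fun z : ℕ → ℝ => z i) (measurable_extend I).aemeasurable
      (measurable_pi_apply i).aestronglyMeasurable]
    simp_rw [extend_of_mem _ hi]
    have := (EuclideanSpace.proj (𝕜 := ℝ) (⟨i, hi⟩ : I)).integral_comp_id_comm
      (IsGaussian.integrable_id (μ := multivariateGaussian 0 (Matrix.of fun i j : I => C i j)))
    simpa using this
  · refine integral_eq_zero_of_ae ?_
    filter_upwards [ae_gaussianLaw_eq_zero I C] with z hz
    exact hz i hi

theorem integrable_mul_of_memLp_two {Ω : Type*} [MeasurableSpace Ω] {P : Measure Ω}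
    {f g : Ω → ℝ} (hf : MemLp f 2 P) (hg : MemLp g 2 P) : Integrable (fun ω => f ω * g ω) P :=
  hf.integrable_mul hg

theorem integrable_mul_gaussianLaw (i j : ℕ) :
    Integrable (fun z : ℕ → ℝ => z i * z j) (gaussianLaw I C) :=
  (memLp_apply_gaussianLaw i).integrable_mul (memLp_apply_gaussianLaw j)

/-- Without `hC`, the table `C` need not be the covariance of any law. This is why the tables of the
state evolution must be shown to be positive semidefinite. -/
theorem integral_mul_gaussianLaw (hC : (Matrix.of fun i j : I => C i j).PosSemidef) {i j : ℕ}
    (hi : i ∈ I) (hj : j ∈ I) : ∫ z, z i * z j ∂gaussianLaw I C = C i j := by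
  have hcov := covariance_eval_multivariateGaussian (μ := 0) hC ⟨i, hi⟩ ⟨j, hj⟩
  have e : cov[fun z : ℕ → ℝ => z i, fun z => z j; gaussianLaw I C] = C i j := by
    rw [gaussianLaw, covariance_map (measurable_pi_apply i).aestronglyMeasurable
      (measurable_pi_apply j).aestronglyMeasurable (by fun_prop)]
    simpa [Function.comp_def, extend_of_mem _ hi, extend_of_mem _ hj] using hcov
  rw [← e, covariance_eq_sub (memLp_apply_gaussianLaw i) (memLp_apply_gaussianLaw j),
    integral_apply_gaussianLaw]
  simp

/-- A Gram matrix: its quadratic form at `x` is the integral of `(∑ x_i f_i)²`. -/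
theorem posSemidef_integral_mul {ι Ω : Type*} [Fintype ι] [MeasurableSpace Ω] {P : Measure Ω}
    {f : ι → Ω → ℝ} (hf : ∀ i, MemLp (f i) 2 P) :
    (Matrix.of fun i j => ∫ ω, f i ω * f j ω ∂P).PosSemidef := by
  refine .of_dotProduct_mulVec_nonneg ?_ fun x => ?_
  · ext i j
    simp only [Matrix.conjTranspose_apply, Matrix.of_apply, star_trivial, mul_comm]
  · have hint (i j : ι) : Integrable (fun ω => x i * f i ω * (x j * f j ω)) P :=
      ((hf i).const_mul (x i)).integrable_mul ((hf j).const_mul (x j))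
    have hs : ∫ ω, (∑ i, x i * f i ω) * (∑ j, x j * f j ω) ∂P
        = star x ⬝ᵥ (Matrix.of fun i j => ∫ ω, f i ω * f j ω ∂P).mulVec x := by
      simp_rw [Finset.sum_mul_sum]
      rw [integral_finsetSum _ fun i _ => integrable_finsetSum _ fun j _ => hint i j]
      simp only [dotProduct, Matrix.mulVec, Matrix.of_apply, Finset.mul_sum, star_trivial]
      refine Finset.sum_congr rfl fun i _ => ?_
      rw [integral_finsetSum _ fun j _ => hint i j]
      refine Finset.sum_congr rfl fun j _ => ?_
      rw [← integral_mul_const, ← integral_const_mul]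
      congr 1; ext ω; ring
    rw [← hs]
    exact integral_nonneg fun ω => mul_self_nonneg _

/-- A centered jointly Gaussian sequence is determined by its covariances. -/
theorem map_eq_gaussianLaw {Ω : Type*} [MeasurableSpace Ω] {P : Measure Ω} {X : Ω → ℕ → ℝ}
    (hXm : Measurable X) (hX : HasGaussianLaw (fun ω (i : I) => X ω i) P)
    (h0 : ∀ᵐ ω ∂P, ∀ i, i ∉ I → X ω i = 0) (hmean : ∀ i ∈ I, ∫ ω, X ω i ∂P = 0)
    (hcov : ∀ i ∈ I, ∀ j ∈ I, ∫ ω, X ω i * X ω j ∂P = C i j) :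
    P.map X = gaussianLaw I C := by
  have hP := hX.isProbabilityMeasure
  have hmem (i : I) : MemLp (fun ω => X ω i) 2 P := (hX.eval i).memLp_two
  have hcov' (i j : I) : cov[fun ω => X ω i, fun ω => X ω j; P] = C i j := by
    rw [covariance_eq_sub (hmem i) (hmem j), hmean i i.2, ← hcov i i.2 j j.2]
    simp
  -- The table need not be assumed positive semidefinite: by `hcov` it is a Gram matrix.
  have hC : (Matrix.of fun i j : I => C i j).PosSemidef := by
    have e : (Matrix.of fun i j : I => C i j) = Matrix.of fun i j : I => ∫ ω, X ω i * X ω j ∂P := by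
      ext i j; exact (hcov i i.2 j j.2).symm
    exact e ▸ posSemidef_integral_mul hmem
  have hY : HasGaussianLaw (fun ω => toLp 2 fun i : I => X ω i) P := hX.toLp_pi 2
  have hYm : Measurable fun ω => toLp 2 fun i : I => X ω i := by fun_prop
  have hext : (fun ω => extend I (toLp 2 fun i : I => X ω i)) =ᵐ[P] X := by
    filter_upwards [h0] with ω hω
    ext i
    by_cases hi : i ∈ I
    · rw [extend_of_mem _ hi]
    · rw [extend_of_notMem _ hi, hω i hi]
  -- Gaussian measures agree once their means and covariance forms do; the latter are compared on
  -- the standard basis.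
  have key : P.map (fun ω => toLp 2 fun i : I => X ω i)
      = multivariateGaussian 0 (Matrix.of fun i j : I => C i j) := by
    have := hY.isGaussian_map
    apply IsGaussian.ext
    · simp only [id_eq, integral_id_multivariateGaussian]
      rw [integral_map hYm.aemeasurable (by fun_prop)]
      ext i
      have := (EuclideanSpace.proj (𝕜 := ℝ) i).integral_comp_comm (hY.integrable)
      exact this.symm.trans (hmean i i.2)
    · rw [← ContinuousLinearMap.toBilinForm_inj]
      refine LinearMap.BilinForm.ext_basis (EuclideanSpace.basisFun I ℝ).toBasis fun i j => ?_
      rw [ContinuousLinearMap.toBilinForm_apply, ContinuousLinearMap.toBilinForm_apply,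
        covarianceBilin_apply_eq_cov IsGaussian.memLp_two_id, covariance_map (by fun_prop)
        (by fun_prop) hYm.aemeasurable, covarianceBilin_multivariateGaussian hC]
      have (i : I) : (fun u => inner ℝ ((EuclideanSpace.basisFun I ℝ).toBasis i) u) ∘
          (fun ω => toLp 2 fun i : I => X ω i) = fun ω => X ω i := by
        ext ω; simp [PiLp.inner_apply]
      rw [this, this, hcov']
      simp
  rw [gaussianLaw, ← key, Measure.map_map (by fun_prop) hYm]
  exact (Measure.map_congr hext).symm

/-- Marginals of centered Gaussian laws. -/
theorem gaussianLaw_map_restrict {J : Finset ℕ} (hJ : J ⊆ I)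
    (hC : (Matrix.of fun i j : I => C i j).PosSemidef) :
    (gaussianLaw I C).map (fun z i => if i ∈ J then z i else 0) = gaussianLaw J C := by
  refine map_eq_gaussianLaw ?_ ?_ (ae_of_all _ fun z i hi => by simp [hi]) ?_ ?_
  · refine measurable_pi_iff.2 fun i => ?_
    split_ifs <;> fun_prop
  · have := (hasGaussianLaw_gaussianLaw I C).map_fun
      (ContinuousLinearMap.pi fun j : J => ContinuousLinearMap.proj (⟨j, hJ j.2⟩ : I))
    exact this.congr (ae_of_all _ fun z => by ext j; simp)
  · intro i hi
    simpa [hi] using integral_apply_gaussianLaw i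
  · intro i hi j hj
    simpa [hi, hj] using integral_mul_gaussianLaw hC (hJ hi) (hJ hj)

/-- Integrals of functions of the coordinates in `J` against a Gaussian law on `I ⊇ J`. -/
theorem integral_gaussianLaw_of_subset {J : Finset ℕ} (hJ : J ⊆ I)
    (hC : (Matrix.of fun i j : I => C i j).PosSemidef) {f : (ℕ → ℝ) → ℝ} (hf : Measurable f)
    (hloc : ∀ z, f (fun i => if i ∈ J then z i else 0) = f z) :
    ∫ z, f z ∂gaussianLaw J C = ∫ z, f z ∂gaussianLaw I C := by
  have hm : Measurable fun (z : ℕ → ℝ) (i : ℕ) => if i ∈ J then z i else 0 := by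
    refine measurable_pi_iff.2 fun i => ?_
    split_ifs <;> fun_prop
  rw [← gaussianLaw_map_restrict hJ hC, integral_map hm.aemeasurable hf.aestronglyMeasurable]
  simp_rw [hloc]

theorem map_apply_gaussianLaw (hC : (Matrix.of fun i j : I => C i j).PosSemidef) {i : ℕ}
    (hi : i ∈ I) : (gaussianLaw I C).map (fun z => z i) = gaussianReal 0 (C i i).toNNReal := by
  rw [(hasGaussianLaw_apply_gaussianLaw hi).map_eq_gaussianReal, integral_apply_gaussianLaw,
    variance_of_integral_eq_zero (measurable_pi_apply i).aemeasurable (integral_apply_gaussianLaw i)]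
  congr
  simpa [pow_two] using integral_mul_gaussianLaw hC hi hi

/-- Independence of a linear form and a family of linear forms, under a Gaussian law. -/
theorem indepFun_gaussianLaw {κ : Type*} [Finite κ] (a : ℕ → ℝ) (b : κ → ℕ → ℝ)
    (h : ∀ k, ∫ z, (∑ i ∈ I, a i * z i) * (∑ i ∈ I, b k i * z i) ∂gaussianLaw I C = 0) :
    IndepFun (fun z : ℕ → ℝ => ∑ i ∈ I, a i * z i) (fun z k => ∑ i ∈ I, b k i * z i)
      (gaussianLaw I C) := by
  have hmem (c : ℕ → ℝ) : MemLp (fun z : ℕ → ℝ => ∑ i ∈ I, c i * z i) 2 (gaussianLaw I C) :=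
    memLp_finsetSum _ fun i _ => (memLp_apply_gaussianLaw i).const_mul _
  have hint (c : ℕ → ℝ) : ∫ z, ∑ i ∈ I, c i * z i ∂gaussianLaw I C = 0 := by
    rw [integral_finsetSum _ fun i _ =>
      ((memLp_apply_gaussianLaw i).const_mul _).integrable one_le_two]
    exact Finset.sum_eq_zero fun i _ => by
      rw [integral_const_mul, integral_apply_gaussianLaw, mul_zero]
  -- Both members are linear images of the same Gaussian vector, hence jointly Gaussian, so that
  -- zero covariance gives independence. The single form is regarded as a family over `Unit`.
  have hG : HasGaussianLaw (fun z : ℕ → ℝ => ((fun _ : Unit => ∑ i ∈ I, a i * z i),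
      fun k => ∑ i ∈ I, b k i * z i)) (gaussianLaw I C) := by
    have := Fintype.ofFinite κ
    have := (hasGaussianLaw_gaussianLaw I C).map_fun
      ((ContinuousLinearMap.pi fun _ : Unit =>
          ∑ i : I, a i • ContinuousLinearMap.proj (R := ℝ) (φ := fun _ : I => ℝ) i).prod
        (ContinuousLinearMap.pi fun k : κ =>
          ∑ i : I, b k i • ContinuousLinearMap.proj (R := ℝ) (φ := fun _ : I => ℝ) i))
    refine this.congr (ae_of_all _ fun z => ?_)
    ext <;> simp [← Finset.sum_coe_sort I]
  have := hG.indepFun_of_covariance_eval (X := fun (_ : Unit) (z : ℕ → ℝ) => ∑ i ∈ I, a i * z i)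
    (Y := fun k (z : ℕ → ℝ) => ∑ i ∈ I, b k i * z i) fun _ k => by
      rw [covariance_eq_sub (hmem a) (hmem (b k)), hint]
      simpa using h k
  exact this.comp (φ := fun x : Unit → ℝ => x ()) (ψ := id) (by fun_prop) measurable_id

end GaussianLaw

/-! ### Gaussian integration by parts for possibly degenerate covariances -/

section GaussianStein

open scoped NNReal

variable {I : Finset ℕ} {C : ℕ → ℕ → ℝ}

theorem nonneg_of_posSemidef (hC : (Matrix.of fun i j : I => C i j).PosSemidef) {i : ℕ}
    (hi : i ∈ I) : 0 ≤ C i i := by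
  rw [← integral_mul_gaussianLaw hC hi hi]
  exact integral_nonneg fun z => mul_self_nonneg _

theorem ae_apply_eq_zero_of_var_eq_zero (hC : (Matrix.of fun i j : I => C i j).PosSemidef)
    {i : ℕ} (hi : i ∈ I) (h : C i i = 0) : ∀ᵐ z ∂gaussianLaw I C, z i = 0 := by
  have h1 := integral_mul_gaussianLaw hC hi hi
  rw [h, integral_eq_zero_iff_of_nonneg (fun z => mul_self_nonneg _)
    (integrable_mul_gaussianLaw i i)] at h1
  filter_upwards [h1] with z hz
  exact mul_self_eq_zero.1 hz

/-- Gaussian integration by parts, along the coordinate `i₀` of a centered Gaussian sequence. -/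
theorem integral_apply_mul_gaussianLaw (hC : (Matrix.of fun i j : I => C i j).PosSemidef)
    {i₀ : ℕ} (hi₀ : i₀ ∈ I) {A A' : (ℕ → ℝ) → ℝ} {h : ℕ → ℝ} {B : ℝ}
    (hh : ∀ i ∈ I, h i = C i i₀) (hh' : ∀ i, i ∉ I → h i = 0)
    (hA : ∀ z, HasDerivAt (fun m : ℝ => A (z + m • h)) (A' z) 0)
    (hAm : Measurable A) (hA'm : Measurable A') (hB : ∀ z, |A' z| ≤ B)
    (hA2 : MemLp A 2 (gaussianLaw I C)) :
    ∫ z, z i₀ * A z ∂gaussianLaw I C = ∫ z, A' z ∂gaussianLaw I C := by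
  set γ := gaussianLaw I C with hγ
  have hw := nonneg_of_posSemidef hC hi₀
  rcases hw.eq_or_lt' with hw0 | hw0
  -- If `z i₀` has zero variance it vanishes almost surely. Its covariances with all coordinates are
  -- then zero, so the direction `h` is zero and so is the derivative `A'`.
  · have hz := ae_apply_eq_zero_of_var_eq_zero hC hi₀ hw0
    have hh0 : h = 0 := by
      ext i
      by_cases hi : i ∈ I
      · rw [hh i hi, ← integral_mul_gaussianLaw hC hi hi₀]
        refine integral_eq_zero_of_ae ?_
        filter_upwards [hz] with z hz
        simp [hz]
      · exact hh' i hi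
    have hA0 : A' = 0 := by
      ext z
      refine (hA z).unique ?_
      simpa [hh0] using hasDerivAt_const (0 : ℝ) (A z)
    rw [hA0, integral_eq_zero_of_ae]
    · simp
    · filter_upwards [hz] with z hz
      simp [hz]
  · set w : ℝ := C i₀ i₀ with hwdef
    -- `R z` is the residual of the whole sequence after regression on `z i₀`, so that `z = R z + z
    -- i₀ • (h / w)` with `R` independent of `z i₀`. The identity reduces to the one-dimensional one
    -- along `h / w`, without inverting the covariance matrix.
    set R : (ℕ → ℝ) → ℕ → ℝ := fun z i => if i ∈ I then z i - C i i₀ / w * z i₀ else 0 with hR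
    have hRm : Measurable R := by
      refine measurable_pi_iff.2 fun i => ?_
      by_cases hi : i ∈ I
      · simp only [hR, hi, if_true]; fun_prop
      · simp only [hR, hi, if_false]; fun_prop
    have hrec : ∀ᵐ z ∂γ, R z + z i₀ • (w⁻¹ • h) = z := by
      filter_upwards [ae_gaussianLaw_eq_zero I C] with z hz
      ext i
      by_cases hi : i ∈ I
      · simp [hR, hi, hh i hi]; ring
      · simp [hR, hi, hh' i hi, hz i hi]
    have hind : IndepFun (fun z : ℕ → ℝ => z i₀) R γ := by
      have h1 (z : ℕ → ℝ) : ∑ i ∈ I, (if i = i₀ then 1 else 0) * z i = z i₀ := by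
        simp [hi₀]
      have h2 (z : ℕ → ℝ) (k : I) :
          ∑ i ∈ I, ((if i = k then 1 else 0) - (if i = i₀ then C k i₀ / w else 0)) * z i
            = z k - C k i₀ / w * z i₀ := by
        simp [sub_mul, Finset.sum_sub_distrib, hi₀]
      have := indepFun_gaussianLaw (I := I) (C := C) (fun i => if i = i₀ then 1 else 0)
        (fun (k : I) i => (if i = k then 1 else 0) - (if i = i₀ then C k i₀ / w else 0)) (by
          intro k
          simp_rw [h1, h2]
          have e : (fun z : ℕ → ℝ => z i₀ * (z k - C k i₀ / w * z i₀))
              = fun z => z k * z i₀ - C k i₀ / w * (z i₀ * z i₀) := by ext z; ring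
          rw [e, integral_sub (integrable_mul_gaussianLaw _ _)
            ((integrable_mul_gaussianLaw _ _).const_mul _), integral_const_mul,
            integral_mul_gaussianLaw hC k.2 hi₀, integral_mul_gaussianLaw hC hi₀ hi₀]
          rw [← hwdef, div_mul_cancel₀ _ hw0.ne', sub_self])
      simp_rw [h1, h2] at this
      have h3 : Measurable fun (x : I → ℝ) (i : ℕ) => if hi : i ∈ I then x ⟨i, hi⟩ else 0 := by
        refine measurable_pi_iff.2 fun i => ?_
        split_ifs <;> fun_prop
      have h4 := this.comp measurable_id h3
      refine h4.congr (ae_of_all _ fun z => rfl) (ae_of_all _ fun z => ?_)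
      ext i
      simp [hR]
    have hpair := (indepFun_iff_map_prod_eq_prod_map_map (measurable_pi_apply i₀).aemeasurable hRm.aemeasurable).1 hind
    rw [hγ, map_apply_gaussianLaw hC hi₀, ← hγ] at hpair
    set v : ℝ≥0 := (C i₀ i₀).toNNReal with hv
    have hvw : (v : ℝ) = w := Real.coe_toNNReal _ hw
    have hpm : Measurable fun z : ℕ → ℝ => (z i₀, R z) := by fun_prop
    have hprob : IsProbabilityMeasure (γ.map R) := Measure.isProbabilityMeasure_map hRm.aemeasurable
    have hcm : Measurable fun q : ℝ × (ℕ → ℝ) => q.2 + q.1 • (w⁻¹ • h) := by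
      refine measurable_pi_iff.2 fun i => ?_
      simp only [Pi.add_apply, Pi.smul_apply]
      fun_prop
    -- Fubini for the product law of the pair `(z i₀, R z)`.
    have htrans {f : ℝ × (ℕ → ℝ) → ℝ} (hf : Measurable f) (hfi : Integrable (fun z =>
        f (z i₀, R z)) γ) : ∫ z, f (z i₀, R z) ∂γ
          = ∫ r, ∫ x, f (x, r) ∂gaussianReal 0 v ∂(γ.map R) := by
      rw [← integral_prod_symm, ← hpair, integral_map hpm.aemeasurable hf.aestronglyMeasurable]
      rw [← hpair]
      exact (integrable_map_measure hf.aestronglyMeasurable hpm.aemeasurable).2 hfi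
    -- The hypothesis gives the derivative at parameter `0` of every line; translating the base
    -- point gives it at every `x`. The factor `w⁻¹` cancels the variance of `z i₀` in the
    -- one-dimensional identity.
    have hder (r : ℕ → ℝ) (x : ℝ) : HasDerivAt (fun x : ℝ => A (r + x • (w⁻¹ • h)))
        (w⁻¹ * A' (r + x • (w⁻¹ • h))) x := by
      have h1 := hA (r + x • (w⁻¹ • h))
      have h2 : HasDerivAt (fun y : ℝ => (y - x) * w⁻¹) w⁻¹ x := by
        simpa using ((hasDerivAt_id x).sub_const x).mul_const w⁻¹
      have h3 := HasDerivAt.comp_of_eq x h1 h2 (by simp)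
      refine (h3.congr_deriv (mul_comm _ _)).congr_of_eventuallyEq (.of_forall fun y => ?_)
      simp only [Function.comp_apply, smul_smul, add_assoc, ← add_smul]
      congr 3; ring
    calc ∫ z, z i₀ * A z ∂γ
        = ∫ z, z i₀ * A (R z + z i₀ • (w⁻¹ • h)) ∂γ := by
          refine integral_congr_ae ?_
          filter_upwards [hrec] with z hz
          simp only [hz]
      _ = ∫ r, ∫ x, x * A (r + x • (w⁻¹ • h)) ∂gaussianReal 0 v ∂(γ.map R) := by
          refine htrans (f := fun q => q.1 * A (q.2 + q.1 • (w⁻¹ • h)))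
            (measurable_fst.mul (hAm.comp hcm)) ?_
          refine ((memLp_apply_gaussianLaw i₀).integrable_mul hA2).congr ?_
          filter_upwards [hrec] with z hz
          simp only [hz, Pi.mul_apply]
      _ = ∫ r, ∫ x, A' (r + x • (w⁻¹ • h)) ∂gaussianReal 0 v ∂(γ.map R) := by
          congr 1; ext r
          rw [integral_id_mul_gaussianReal v (hder r) (B := w⁻¹ * B), hvw, integral_const_mul,
            mul_inv_cancel_left₀ hw0.ne']
          intro x
          rw [abs_mul, abs_of_pos (inv_pos.2 hw0)]
          exact mul_le_mul_of_nonneg_left (hB _) (inv_pos.2 hw0).le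
      _ = ∫ z, A' (R z + z i₀ • (w⁻¹ • h)) ∂γ := by
          refine (htrans (f := fun q => A' (q.2 + q.1 • (w⁻¹ • h))) (hA'm.comp hcm) ?_).symm
          exact (memLp_top_of_bound ((hA'm.comp hcm).comp hpm).aestronglyMeasurable B
            (ae_of_all _ fun z => hB _)).integrable (by simp)
      _ = ∫ z, A' z ∂γ := by
          refine integral_congr_ae ?_
          filter_upwards [hrec] with z hz
          simp only [hz]

end GaussianStein

namespace Model

variable {m n : ℕ} (D : Model m n)

/-! ### The recursions for `Υ`, `Θ°` and their derivatives -/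

/-- The argument of `∂₁ L` in `Υ_t`, as a function of the response `y` and of `z^(1), …, z^(t)`. -/
noncomputable def theta (rho : ℕ → ℕ → ℝ) (y : ℝ) (z : ℕ → ℝ) (t : ℕ) : ℝ :=
  z t - ∑ s ∈ (Finset.Icc 1 (t - 1)).attach,
    D.η * rho (t - 1) s.1 * pd 1 0 D.L (theta rho y z s.1) y
termination_by t
decreasing_by
  have := Finset.mem_Icc.1 s.2
  omega

/-- The derivative of `theta` in `z`, along `h`. -/
noncomputable def dtheta (rho : ℕ → ℕ → ℝ) (y : ℝ) (z h : ℕ → ℝ) (t : ℕ) : ℝ :=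
  h t - ∑ s ∈ (Finset.Icc 1 (t - 1)).attach,
    D.η * rho (t - 1) s.1 * (pd 2 0 D.L (D.theta rho y z s.1) y * dtheta rho y z h s.1)
termination_by t
decreasing_by
  have := Finset.mem_Icc.1 s.2
  omega

/-- The derivative in `y` of `∂₁ L (theta, y)`. -/
noncomputable def crossResponse (rho : ℕ → ℕ → ℝ) (y : ℝ) (z : ℕ → ℝ) (t : ℕ) : ℝ :=
  pd 1 1 D.L (D.theta rho y z t) y - pd 2 0 D.L (D.theta rho y z t) y *
    ∑ s ∈ (Finset.Icc 1 (t - 1)).attach, D.η * rho (t - 1) s.1 * crossResponse rho y z s.1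
termination_by t
decreasing_by
  have := Finset.mem_Icc.1 s.2
  omega

variable (rho : ℕ → ℕ → ℝ) (y : ℝ) (z h : ℕ → ℝ) (t : ℕ)

theorem theta_eq : D.theta rho y z t = z t - ∑ s ∈ Finset.Icc 1 (t - 1),
    D.η * rho (t - 1) s * pd 1 0 D.L (D.theta rho y z s) y := by
  rw [theta, Finset.sum_attach (Finset.Icc 1 (t - 1))
    fun s => D.η * rho (t - 1) s * pd 1 0 D.L (D.theta rho y z s) y]

theorem dtheta_eq : D.dtheta rho y z h t = h t - ∑ s ∈ Finset.Icc 1 (t - 1),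
    D.η * rho (t - 1) s * (pd 2 0 D.L (D.theta rho y z s) y * D.dtheta rho y z h s) := by
  rw [dtheta, Finset.sum_attach (Finset.Icc 1 (t - 1)) fun s =>
    D.η * rho (t - 1) s * (pd 2 0 D.L (D.theta rho y z s) y * D.dtheta rho y z h s)]

theorem crossResponse_eq : D.crossResponse rho y z t = pd 1 1 D.L (D.theta rho y z t) y
    - pd 2 0 D.L (D.theta rho y z t) y *
      ∑ s ∈ Finset.Icc 1 (t - 1), D.η * rho (t - 1) s * D.crossResponse rho y z s := by
  rw [crossResponse, Finset.sum_attach (Finset.Icc 1 (t - 1))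
    fun s => D.η * rho (t - 1) s * D.crossResponse rho y z s]

/-- Separates the discontinuous dependence on `z 0`, which goes through the response only, from the
smooth dependence on `z 1, …, z t`. The minus sign in `theta` comes from substituting `Υ_s = -η ∂₁L`
into the argument of `Υ_t`. -/
theorem upsilon_eq_theta (k : Fin m) : D.upsilon rho k z t
    = -D.η * pd 1 0 D.L (D.theta rho (sgn (z 0 + D.ξ k)) z t) (sgn (z 0 + D.ξ k)) := by
  induction t using Nat.strong_induction_on with
  | _ t ih =>
    rw [upsilon, theta, sub_eq_add_neg, ← Finset.sum_neg_distrib]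
    congr 3
    refine Finset.sum_congr rfl fun s _ => ?_
    have := Finset.mem_Icc.1 s.2
    rw [ih s (by omega)]; ring

theorem thetaCirc_eq_theta : D.thetaCirc y z t = D.theta D.rho y z t := by
  induction t using Nat.strong_induction_on with
  | _ t ih =>
    rw [thetaCirc, theta]
    congr 1
    refine Finset.sum_congr rfl fun s _ => ?_
    have := Finset.mem_Icc.1 s.2
    rw [ih s (by omega)]

-- Time `t` only sees the rows of `rho` before `t`, and never the coordinate `0`; the latter fails
-- at `t = 0`, hence `1 ≤ t`.
variable {rho z h t} in
theorem theta_congr {rho' : ℕ → ℕ → ℝ} {z' : ℕ → ℝ} (ht : 1 ≤ t)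
    (hr : ∀ r, r < t → ∀ s, rho r s = rho' r s) (hz : ∀ s ∈ Finset.Icc 1 t, z s = z' s) :
    D.theta rho y z t = D.theta rho' y z' t := by
  induction t using Nat.strong_induction_on with
  | _ t ih =>
    rw [theta_eq, theta_eq, hz t (Finset.mem_Icc.2 ⟨ht, le_rfl⟩)]
    congr 1
    refine Finset.sum_congr rfl fun s hs => ?_
    rw [Finset.mem_Icc] at hs
    rw [hr (t - 1) (by omega), ih s (by omega) hs.1 (fun r h => hr r (by omega))
      fun r hr => hz r (by rw [Finset.mem_Icc] at hr ⊢; omega)]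

/-- Linearity of `dtheta` in the direction. -/
theorem dtheta_eq_sum {T : ℕ} (ht : 1 ≤ t) (htT : t ≤ T) : D.dtheta rho y z h t
    = ∑ r ∈ Finset.Icc 1 T, h r * D.dtheta rho y z (Pi.single r 1) t := by
  -- The upper limit `T` stays fixed, so that the expansions at all earlier times run over the same
  -- directions.
  induction t using Nat.strong_induction_on with
  | _ t ih =>
    have e (s : ℕ) (hs : s ∈ Finset.Icc 1 (t - 1)) :
        D.η * rho (t - 1) s * (pd 2 0 D.L (D.theta rho y z s) y * D.dtheta rho y z h s)
          = ∑ r ∈ Finset.Icc 1 T, h r * (D.η * rho (t - 1) s *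
            (pd 2 0 D.L (D.theta rho y z s) y * D.dtheta rho y z (Pi.single r 1) s)) := by
      rw [Finset.mem_Icc] at hs
      rw [ih s (by omega) hs.1 (by omega), Finset.mul_sum, Finset.mul_sum]
      exact Finset.sum_congr rfl fun r _ => by ring
    rw [dtheta_eq, Finset.sum_congr rfl e, Finset.sum_comm]
    simp_rw [D.dtheta_eq rho y z (Pi.single _ 1) t, mul_sub, Finset.sum_sub_distrib,
      Finset.mul_sum]
    congr 1
    simp only [Pi.single_apply, mul_ite, mul_one, mul_zero]
    rw [Finset.sum_ite_eq, if_pos (Finset.mem_Icc.2 ⟨ht, htT⟩)]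

section Smooth

variable {D}

theorem hasDerivAt_theta_line (hL : ContDiff ℝ 3 fun q : ℝ × ℝ => D.L q.1 q.2) (r : ℝ) :
    HasDerivAt (fun r : ℝ => D.theta rho y (z + r • h) t) (D.dtheta rho y (z + r • h) h t) r := by
  induction t using Nat.strong_induction_on with
  | _ t ih =>
    simp_rw [D.theta_eq rho y _ t]
    rw [D.dtheta_eq]
    refine HasDerivAt.sub ?_ (HasDerivAt.fun_sum fun s hs => ?_)
    · simpa using ((hasDerivAt_id r).mul_const (h t)).const_add (z t)
    · rw [Finset.mem_Icc] at hs
      simpa using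
        (hasDerivAt_pd_one_zero hL (ih s (by omega)) (hasDerivAt_const r y)).const_mul
          (D.η * rho (t - 1) s)

theorem hasDerivAt_pd_theta_line (hL : ContDiff ℝ 3 fun q : ℝ × ℝ => D.L q.1 q.2) (r : ℝ) :
    HasDerivAt (fun r : ℝ => pd 1 0 D.L (D.theta rho y (z + r • h) t) y)
      (pd 2 0 D.L (D.theta rho y (z + r • h) t) y * D.dtheta rho y (z + r • h) h t) r := by
  simpa using hasDerivAt_pd_one_zero hL (hasDerivAt_theta_line rho y z h t hL r)
    (hasDerivAt_const r y)

/-- The response `y` enters directly, through `∂₁₂L`, and through the earlier iterates inside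
`theta`, through `∂₁₁L`; the chain rule is the recursion of `crossResponse`. -/
theorem hasDerivAt_pd_theta_response (hL : ContDiff ℝ 3 fun q : ℝ × ℝ => D.L q.1 q.2) :
    HasDerivAt (fun y : ℝ => pd 1 0 D.L (D.theta rho y z t) y) (D.crossResponse rho y z t) y := by
  induction t using Nat.strong_induction_on with
  | _ t ih =>
    have hθ : HasDerivAt (fun y : ℝ => D.theta rho y z t) (0 - ∑ s ∈ Finset.Icc 1 (t - 1),
        D.η * rho (t - 1) s * D.crossResponse rho y z s) y := by
      simp_rw [D.theta_eq rho _ _ t]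
      refine HasDerivAt.sub (hasDerivAt_const _ _) (HasDerivAt.fun_sum fun s hs => ?_)
      rw [Finset.mem_Icc] at hs
      exact (ih s (by omega)).const_mul _
    refine (hasDerivAt_pd_one_zero hL hθ (hasDerivAt_id y)).congr_deriv ?_
    rw [D.crossResponse_eq, id_eq]; ring

theorem continuous_theta (hL : ContDiff ℝ 3 fun q : ℝ × ℝ => D.L q.1 q.2) :
    Continuous fun q : ℝ × (ℕ → ℝ) => D.theta rho q.1 q.2 t := by
  induction t using Nat.strong_induction_on with
  | _ t ih =>
    simp_rw [D.theta_eq rho _ _ t]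
    refine Continuous.sub (by fun_prop) (continuous_finsetSum _ fun s hs => ?_)
    rw [Finset.mem_Icc] at hs
    exact continuous_const.mul (continuous_comp_pd_one_zero (ih s (by omega)) continuous_fst hL)

theorem continuous_pd_theta (hL : ContDiff ℝ 3 fun q : ℝ × ℝ => D.L q.1 q.2) :
    Continuous fun q : ℝ × (ℕ → ℝ) => pd 1 0 D.L (D.theta rho q.1 q.2 t) q.1 :=
  continuous_comp_pd_one_zero (continuous_theta rho t hL) continuous_fst hL

theorem continuous_dtheta (hL : ContDiff ℝ 3 fun q : ℝ × ℝ => D.L q.1 q.2) :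
    Continuous fun q : ℝ × (ℕ → ℝ) => D.dtheta rho q.1 q.2 h t := by
  induction t using Nat.strong_induction_on with
  | _ t ih =>
    simp_rw [D.dtheta_eq rho _ _ h t]
    refine Continuous.sub (by fun_prop) (continuous_finsetSum _ fun s hs => ?_)
    rw [Finset.mem_Icc] at hs
    exact continuous_const.mul ((continuous_comp_pd_two_zero (continuous_theta rho s hL)
      continuous_fst hL).mul (ih s (by omega)))

theorem continuous_crossResponse (hL : ContDiff ℝ 3 fun q : ℝ × ℝ => D.L q.1 q.2) :
    Continuous fun q : ℝ × (ℕ → ℝ) => D.crossResponse rho q.1 q.2 t := by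
  induction t using Nat.strong_induction_on with
  | _ t ih =>
    simp_rw [D.crossResponse_eq rho _ _ t]
    have hθ := continuous_theta rho t hL
    refine (continuous_comp_pd_one_one hθ continuous_fst hL).sub
      ((continuous_comp_pd_two_zero hθ continuous_fst hL).mul
        (continuous_finsetSum _ fun s hs => ?_))
    rw [Finset.mem_Icc] at hs
    exact continuous_const.mul (ih s (by omega))

theorem exists_bound_dtheta {Λ : ℝ}
    (h20 : ∀ x : ℝ, ∀ y ∈ Set.Icc (-1 : ℝ) 1, |pd 2 0 D.L x y| ≤ Λ) :
    ∃ B, ∀ y ∈ Set.Icc (-1 : ℝ) 1, ∀ z, |D.dtheta rho y z h t| ≤ B := by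
  induction t using Nat.strong_induction_on with
  | _ t ih =>
    -- Outside the range of the sum the bound is irrelevant and set to `0`, so that the bounds can
    -- be chosen as a function of all `s`.
    have hex (s : ℕ) : ∃ B, s ∈ Finset.Icc 1 (t - 1) →
        ∀ y ∈ Set.Icc (-1 : ℝ) 1, ∀ z, |D.dtheta rho y z h s| ≤ B := by
      by_cases hs : s ∈ Finset.Icc 1 (t - 1)
      · obtain ⟨B, hB⟩ := ih s (by rw [Finset.mem_Icc] at hs; omega)
        exact ⟨B, fun _ => hB⟩
      · exact ⟨0, fun h => absurd h hs⟩
    choose B hB using hex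
    refine ⟨|h t| + ∑ s ∈ Finset.Icc 1 (t - 1), |D.η * rho (t - 1) s| * (Λ * B s),
      fun y hy z => ?_⟩
    rw [D.dtheta_eq]
    refine (abs_sub _ _).trans (add_le_add_right ((Finset.abs_sum_le_sum_abs _ _).trans
      (Finset.sum_le_sum fun s hs => ?_)) _)
    rw [abs_mul, abs_mul (pd 2 0 _ _ _)]
    have h1 := h20 (D.theta rho y z s) y hy
    have h2 := hB s hs y hy z
    have := (abs_nonneg _).trans h1
    gcongr

theorem exists_bound_crossResponse {Λ : ℝ}
    (h20 : ∀ x : ℝ, ∀ y ∈ Set.Icc (-1 : ℝ) 1, |pd 2 0 D.L x y| ≤ Λ)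
    (h11 : ∀ x : ℝ, ∀ y ∈ Set.Icc (-1 : ℝ) 1, |pd 1 1 D.L x y| ≤ Λ) :
    ∃ B, ∀ y ∈ Set.Icc (-1 : ℝ) 1, ∀ z, |D.crossResponse rho y z t| ≤ B := by
  induction t using Nat.strong_induction_on with
  | _ t ih =>
    have hex (s : ℕ) : ∃ B, s ∈ Finset.Icc 1 (t - 1) →
        ∀ y ∈ Set.Icc (-1 : ℝ) 1, ∀ z, |D.crossResponse rho y z s| ≤ B := by
      by_cases hs : s ∈ Finset.Icc 1 (t - 1)
      · obtain ⟨B, hB⟩ := ih s (by rw [Finset.mem_Icc] at hs; omega)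
        exact ⟨B, fun _ => hB⟩
      · exact ⟨0, fun h => absurd h hs⟩
    choose B hB using hex
    refine ⟨Λ + Λ * ∑ s ∈ Finset.Icc 1 (t - 1), |D.η * rho (t - 1) s| * B s, fun y hy z => ?_⟩
    rw [D.crossResponse_eq]
    have h1 := h20 (D.theta rho y z t) y hy
    have := (abs_nonneg _).trans h1
    refine (abs_sub _ _).trans (add_le_add (h11 _ y hy) ?_)
    rw [abs_mul]
    refine mul_le_mul h1 ((Finset.abs_sum_le_sum_abs _ _).trans
      (Finset.sum_le_sum fun s hs => ?_)) (abs_nonneg _) this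
    rw [abs_mul]
    exact mul_le_mul_of_nonneg_left (hB s hs y hy z) (abs_nonneg _)

section MemLp

variable {Ω : Type*} [MeasurableSpace Ω] {P : Measure Ω} [IsProbabilityMeasure P]
  {X Y : Ω → ℝ} {Z : Ω → ℕ → ℝ} {Λ : ℝ}

theorem memLp_pd_one_zero (hL : ContDiff ℝ 3 fun q : ℝ × ℝ => D.L q.1 q.2)
    (h20 : ∀ x : ℝ, ∀ y ∈ Set.Icc (-1 : ℝ) 1, |pd 2 0 D.L x y| ≤ Λ)
    (hX : MemLp X 2 P) (hYm : Measurable Y) (hY : ∀ ω, Y ω ∈ Set.Icc (-1 : ℝ) 1) :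
    MemLp (fun ω => pd 1 0 D.L (X ω) (Y ω)) 2 P := by
  obtain ⟨B, hB⟩ := exists_abs_pd_one_zero_le hL h20
  have hc := continuous_pd_one_zero hL
  generalize pd 1 0 D.L = f at *
  refine ((memLp_const B).add (hX.abs.const_mul Λ)).mono
    (hc.comp_aestronglyMeasurable (hX.1.prodMk hYm.aestronglyMeasurable)) (ae_of_all _ fun ω => ?_)
  exact (hB _ _ (hY ω)).trans (le_abs_self _)

theorem memLp_theta (hL : ContDiff ℝ 3 fun q : ℝ × ℝ => D.L q.1 q.2)
    (h20 : ∀ x : ℝ, ∀ y ∈ Set.Icc (-1 : ℝ) 1, |pd 2 0 D.L x y| ≤ Λ)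
    (hZ : ∀ s, MemLp (fun ω => Z ω s) 2 P) (hYm : Measurable Y)
    (hY : ∀ ω, Y ω ∈ Set.Icc (-1 : ℝ) 1) :
    MemLp (fun ω => D.theta rho (Y ω) (Z ω) t) 2 P := by
  induction t using Nat.strong_induction_on with
  | _ t ih =>
    simp_rw [D.theta_eq rho _ _ t]
    refine (hZ t).sub (memLp_finsetSum _ fun s hs => ?_)
    rw [Finset.mem_Icc] at hs
    exact (memLp_pd_one_zero hL h20 (ih s (by omega)) hYm hY).const_mul _

theorem memLp_pd_theta (hL : ContDiff ℝ 3 fun q : ℝ × ℝ => D.L q.1 q.2)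
    (h20 : ∀ x : ℝ, ∀ y ∈ Set.Icc (-1 : ℝ) 1, |pd 2 0 D.L x y| ≤ Λ)
    (hZ : ∀ s, MemLp (fun ω => Z ω s) 2 P) (hYm : Measurable Y)
    (hY : ∀ ω, Y ω ∈ Set.Icc (-1 : ℝ) 1) :
    MemLp (fun ω => pd 1 0 D.L (D.theta rho (Y ω) (Z ω) t) (Y ω)) 2 P :=
  memLp_pd_one_zero hL h20 (memLp_theta rho t hL h20 hZ hYm hY) hYm hY

end MemLp

end Smooth

end Model

/-! ### Measurability, moments and partial derivatives of `Υ_t` -/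

theorem sgn_mem_Icc (x : ℝ) : sgn x ∈ Set.Icc (-1 : ℝ) 1 := by
  unfold sgn; split_ifs <;> simp

theorem measurable_sgn : Measurable sgn :=
  Measurable.ite measurableSet_Ici measurable_const measurable_const

namespace Model

variable {m n : ℕ} {D : Model m n} (rho : ℕ → ℕ → ℝ) (k : Fin m)

theorem measurable_upsilon (hL : ContDiff ℝ 3 fun q : ℝ × ℝ => D.L q.1 q.2) (t : ℕ) :
    Measurable fun z : ℕ → ℝ => D.upsilon rho k z t := by
  simp_rw [upsilon_eq_theta]
  have hs : Measurable fun z : ℕ → ℝ => sgn (z 0 + D.ξ k) := measurable_sgn.comp (by fun_prop)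
  exact (Measurable.comp
    (g := fun q : ℝ × (ℕ → ℝ) => pd 1 0 D.L (D.theta rho q.1 q.2 t) q.1)
    (continuous_pd_theta rho t hL).measurable (hs.prodMk measurable_id)).const_mul _

theorem memLp_upsilon {P : Measure (ℕ → ℝ)} [IsProbabilityMeasure P] {Λ : ℝ}
    (hL : ContDiff ℝ 3 fun q : ℝ × ℝ => D.L q.1 q.2)
    (h20 : ∀ x : ℝ, ∀ y ∈ Set.Icc (-1 : ℝ) 1, |pd 2 0 D.L x y| ≤ Λ)
    (hZ : ∀ s, MemLp (fun z : ℕ → ℝ => z s) 2 P) (t : ℕ) :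
    MemLp (fun z => D.upsilon rho k z t) 2 P := by
  simp_rw [upsilon_eq_theta]
  exact (memLp_pd_theta rho t hL h20 hZ (measurable_sgn.comp (by fun_prop))
    fun _ => sgn_mem_Icc _).const_mul _

/-- The partial derivatives of `Υ_t` in `z^(1), …, z^(t)`. -/
theorem partialAt_upsilon (hL : ContDiff ℝ 3 fun q : ℝ × ℝ => D.L q.1 q.2) {s : ℕ} (hs : 1 ≤ s)
    (z : ℕ → ℝ) (t : ℕ) : partialAt s (fun z' => D.upsilon rho k z' t) z
      = -D.η * (pd 2 0 D.L (D.theta rho (sgn (z 0 + D.ξ k)) z t) (sgn (z 0 + D.ξ k)) *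
        D.dtheta rho (sgn (z 0 + D.ξ k)) z (Pi.single s 1) t) := by
  set y := sgn (z 0 + D.ξ k) with hy
  have hup (u : ℝ) : Function.update z s u = z + (u - z s) • Pi.single s (1 : ℝ) := by
    ext i
    by_cases hi : i = s
    · subst hi; simp
    · simp [hi]
  have h1 : HasDerivAt (fun r : ℝ => pd 1 0 D.L (D.theta rho y (z + r • Pi.single s (1 : ℝ)) t) y)
      (pd 2 0 D.L (D.theta rho y z t) y * D.dtheta rho y z (Pi.single s 1) t) 0 := by
    simpa using hasDerivAt_pd_theta_line rho y z (Pi.single s 1) t hL 0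
  have h2 := (HasDerivAt.comp_of_eq (z s) h1 ((hasDerivAt_id (z s)).sub_const (z s))
    (by simp)).const_mul (-D.η)
  rw [partialAt]
  refine (congrArg (deriv · (z s)) ?_).trans (h2.deriv.trans (by rw [mul_one]))
  ext u
  -- As `1 ≤ s`, moving the coordinate `s` leaves `z 0` and hence the response unchanged, so the
  -- discontinuity is never met.
  rw [upsilon_eq_theta, Function.update_of_ne (by omega), ← hy, hup]
  rfl

end Model
theorem posSemidef_avg_integral_mul {N : ℕ} {ι Ω : Type*} [Fintype ι] [MeasurableSpace Ω]
    {P : Measure Ω} {f : Fin N → ι → Ω → ℝ} (hf : ∀ l i, MemLp (f l i) 2 P) {c : ℝ}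
    (hc : 0 ≤ c) :
    (Matrix.of fun i j => c * avg fun l => ∫ ω, f l i ω * f l j ω ∂P).PosSemidef := by
  have e : (Matrix.of fun i j => c * avg fun l => ∫ ω, f l i ω * f l j ω ∂P)
      = (c * (N : ℝ)⁻¹) • ∑ l, Matrix.of fun i j => ∫ ω, f l i ω * f l j ω ∂P := by
    ext i j
    simp [avg, Matrix.sum_apply, mul_assoc]
  rw [e]
  exact (Matrix.posSemidef_sum _ fun l _ => posSemidef_integral_mul (hf l)).smul (by positivity)

theorem avg_congr {N : ℕ} {f g : Fin N → ℝ} (h : ∀ l, f l = g l) : avg f = avg g := by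
  rw [funext h]

namespace Model

variable {m n : ℕ} (D : Model m n)

/-! ### Unfolding the state evolution -/

/-- The covariances of the Gaussian vector `W^([1:∞))`. -/
noncomputable def covW (t s : ℕ) : ℝ := (D.se t).covW t s

variable {T r : ℕ}

/-- An iteration overwrites its own row only, so row `r` is final from iteration `r` on. The same
holds for the other four tables. -/
theorem se_rho_apply (h : r ≤ T) : (D.se T).rho r = D.rho r := by
  induction T, h using Nat.le_induction with
  | base => rfl
  | succ T h ih => rw [← ih]; exact Function.update_of_ne (by omega) _ _

theorem se_tau_apply (h : r ≤ T) : (D.se T).tau r = D.tau r := by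
  induction T, h using Nat.le_induction with
  | base => rfl
  | succ T h ih => rw [← ih]; exact Function.update_of_ne (by omega) _ _

theorem se_delta_apply (h : r ≤ T) : (D.se T).delta r = D.delta r := by
  induction T, h using Nat.le_induction with
  | base => rfl
  | succ T h ih => rw [← ih]; exact Function.update_of_ne (by omega) _ _

theorem se_covZ_apply (h : r ≤ T) : (D.se T).covZ r = D.covZ r := by
  induction T, h using Nat.le_induction with
  | base => rfl
  | succ T h ih => rw [← ih]; exact Function.update_of_ne (by omega) _ _

theorem se_covW_apply (h : r ≤ T) : (D.se T).covW r = D.covW r := by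
  induction T, h using Nat.le_induction with
  | base => rfl
  | succ T h ih => rw [← ih]; exact Function.update_of_ne (by omega) _ _

theorem lawZ_se (h : r ≤ T) : lawZ (D.se T).covZ r = lawZ D.covZ r := by
  refine gaussianLaw_congr fun i hi j hj => ?_
  rw [Finset.mem_Icc] at hi hj
  rw [symTable, symTable, D.se_covZ_apply (by omega)]

theorem lawW_se (h : r ≤ T) : lawW (D.se T).covW r = lawW D.covW r := by
  refine gaussianLaw_congr fun i hi j hj => ?_
  rw [Finset.mem_Icc] at hi hj
  rw [symTable, symTable, D.se_covW_apply (by omega)]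

/-- `Υ_r` uses the rows of `rho` up to `r - 1` only, so the parameters after `T` iterations already
determine `Υ_{T+1}`. -/
theorem upsilon_se (k : Fin m) (z : ℕ → ℝ) (hr : 1 ≤ r) (h : r ≤ T + 1) :
    D.upsilon (D.se T).rho k z r = D.upsilon D.rho k z r := by
  rw [upsilon_eq_theta, upsilon_eq_theta,
    D.theta_congr _ hr (fun q hq s => by rw [D.se_rho_apply (by omega)]) fun _ _ => rfl]

theorem omega_zero (tau : ℕ → ℕ → ℝ) (delta : ℕ → ℝ) (l : Fin n) (w : ℕ → ℝ) :
    D.omega tau delta l w 0 = D.μinit l := by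
  rw [omega, if_pos rfl]

theorem omega_eq (tau : ℕ → ℕ → ℝ) (delta : ℕ → ℝ) (l : Fin n) (w : ℕ → ℝ) {t : ℕ}
    (ht : 1 ≤ t) : D.omega tau delta l w t = D.P t l (w t
      + ∑ s ∈ Finset.Icc 1 t, (tau t s + if t = s then 1 else 0) * D.omega tau delta l w (s - 1)
      + delta t * D.μstar l) := by
  rw [omega, if_neg (by omega), Finset.sum_attach (Finset.Icc 1 t)
    fun s => (tau t s + if t = s then 1 else 0) * D.omega tau delta l w (s - 1)]

theorem omega_congr {tau tau' : ℕ → ℕ → ℝ} {delta delta' : ℕ → ℝ} (l : Fin n) {w w' : ℕ → ℝ}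
    {t : ℕ} (hτ : ∀ r ≤ t, tau r = tau' r) (hδ : ∀ r ≤ t, delta r = delta' r)
    (hw : ∀ s ∈ Finset.Icc 1 t, w s = w' s) :
    D.omega tau delta l w t = D.omega tau' delta' l w' t := by
  induction t using Nat.strong_induction_on with
  | _ t ih =>
    rcases Nat.eq_zero_or_pos t with rfl | ht
    · rw [omega_zero, omega_zero]
    · rw [D.omega_eq _ _ _ _ ht, D.omega_eq _ _ _ _ ht, hτ t le_rfl, hδ t le_rfl,
        hw t (Finset.mem_Icc.2 ⟨ht, le_rfl⟩)]
      congr 3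
      refine Finset.sum_congr rfl fun s hs => ?_
      rw [Finset.mem_Icc] at hs
      rw [ih (s - 1) (by omega) (fun r hr => hτ r (by omega)) (fun r hr => hδ r (by omega))
        fun r hr => hw r (by rw [Finset.mem_Icc] at hr ⊢; omega)]

theorem omegaPred_congr {tau tau' : ℕ → ℕ → ℝ} {delta delta' : ℕ → ℝ} (l : Fin n) {w w' : ℕ → ℝ}
    {t : ℕ} (hτ : ∀ r < t, tau r = tau' r) (hδ : ∀ r < t, delta r = delta' r)
    (hw : ∀ s ∈ Finset.Icc 1 (t - 1), w s = w' s) :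
    D.omegaPred tau delta l w t = D.omegaPred tau' delta' l w' t := by
  rw [omegaPred, omegaPred]
  split_ifs with h
  · rfl
  · exact D.omega_congr l (fun r hr => hτ r (by omega)) (fun r hr => hδ r (by omega)) hw

/-- With its companions for `delta`, `covW` and `covZ`, this replaces the iterative construction by
the defining equations between the final tables, in which no iteration count appears. -/
theorem tau_eq {t : ℕ} (ht : 1 ≤ t) (s : ℕ) : D.tau t s = D.tauEntry D.rho D.covZ t s := by
  obtain ⟨t, rfl⟩ : ∃ r, t = r + 1 := ⟨t - 1, by omega⟩
  have h : (D.se (t + 1)).tau (t + 1) = D.tauEntry (D.se t).rho (D.se (t + 1)).covZ (t + 1) :=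
      Function.update_self (t + 1) _ _
  rw [tau, h, tauEntry, tauEntry, lawZ_se _ le_rfl]
  simp_rw [D.upsilon_se _ _ (by omega : 1 ≤ t + 1) le_rfl]

theorem delta_eq {t : ℕ} (ht : 1 ≤ t) : D.delta t = D.deltaEntry D.rho D.tau D.covZ t := by
  obtain ⟨t, rfl⟩ : ∃ r, t = r + 1 := ⟨t - 1, by omega⟩
  have h : D.delta (t + 1)
      = D.deltaEntry (D.se t).rho (D.se (t + 1)).tau (D.se (t + 1)).covZ (t + 1) :=
    Function.update_self (t + 1) _ _
  rw [h, deltaEntry, deltaEntry, lawZ_se _ le_rfl, D.se_tau_apply le_rfl]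
  simp_rw [D.upsilon_se _ _ (by omega : 1 ≤ t + 1) le_rfl]
  congr 3
  refine Finset.sum_congr rfl fun s hs => ?_
  rw [D.se_covZ_apply (Finset.mem_Icc.1 hs).2]

theorem covW_eq {t s : ℕ} (hs : 1 ≤ s) (hst : s ≤ t) :
    D.covW t s = D.covWEntry D.rho D.covZ t s := by
  obtain ⟨t, rfl⟩ : ∃ r, t = r + 1 := ⟨t - 1, by omega⟩
  have h : (D.se (t + 1)).covW (t + 1) = D.covWEntry (D.se t).rho (D.se (t + 1)).covZ (t + 1) :=
      Function.update_self (t + 1) _ _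
  rw [covW, h, covWEntry, covWEntry, lawZ_se _ le_rfl]
  simp_rw [D.upsilon_se _ _ (by omega : 1 ≤ t + 1) le_rfl, D.upsilon_se _ _ hs hst]

theorem covZ_zero : D.covZ 0 0 = D.sigmaSq := by
  simp [covZ, se, seInit]

theorem covZ_eq {t s : ℕ} (hst : s ≤ t) : D.covZ t s = D.covZEntry D.tau D.delta D.covW t s := by
  rcases Nat.eq_zero_or_pos t with rfl | ht
  · obtain rfl : s = 0 := by omega
    -- The initial value `σ²` obeys the general formula because `Ω_{-1} = μ_*` is constant and
    -- `lawW` is a probability measure, also at the truncated index `0 - 1 = 0`.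
    rw [covZ_zero, sigmaSq, covZEntry, avg]
    simp only [omegaPred, if_true]
    have : IsProbabilityMeasure (lawW D.covW (0 - 1)) := isProbabilityMeasure_gaussianLaw _ _
    simp [pow_two, div_eq_inv_mul]
  · obtain ⟨t, rfl⟩ : ∃ r, t = r + 1 := ⟨t - 1, by omega⟩
    have h : (D.se (t + 1)).covZ (t + 1)
        = D.covZEntry (D.se t).tau (D.se t).delta (D.se t).covW (t + 1) :=
      Function.update_self (t + 1) _ _
    rw [covZ, h, covZEntry, covZEntry, Nat.add_sub_cancel, lawW_se _ le_rfl]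
    refine avg_congr fun l => ?_
    congr 1; ext w
    rw [D.omegaPred_congr l (t := s) (fun r hr => D.se_tau_apply (by omega))
      (fun r hr => D.se_delta_apply (by omega)) fun _ _ => rfl,
      D.omegaPred_congr l (t := t + 1) (fun r hr => D.se_tau_apply (by omega))
      (fun r hr => D.se_delta_apply (by omega)) fun _ _ => rfl]

/-- `Ω_t` does not depend on `w^(s)` for `s > t`. This makes the Onsager matrix strictly lower
triangular. -/
theorem rho_eq_zero {t s : ℕ} (ht : 1 ≤ t) (hts : t < s) : D.rho t s = 0 := by
  obtain ⟨t, rfl⟩ : ∃ r, t = r + 1 := ⟨t - 1, by omega⟩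
  have h : (D.se (t + 1)).rho (t + 1) = D.rhoEntry (D.se (t + 1)).tau (D.se (t + 1)).delta
      (D.se (t + 1)).covW (t + 1) :=
      Function.update_self (t + 1) _ _
  have h0 (l : Fin n) (w : ℕ → ℝ) :
      partialAt s (fun w' => D.omega (D.se (t + 1)).tau (D.se (t + 1)).delta l w' (t + 1)) w = 0 := by
    rw [partialAt]
    have : (fun u => D.omega (D.se (t + 1)).tau (D.se (t + 1)).delta l (Function.update w s u) (t + 1))
        = fun _ => D.omega (D.se (t + 1)).tau (D.se (t + 1)).delta l w (t + 1) := by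
      ext u
      refine D.omega_congr l (fun _ _ => rfl) (fun _ _ => rfl) fun r hr => ?_
      rw [Function.update_of_ne (by rw [Finset.mem_Icc] at hr; omega)]
    rw [this, deriv_const]
  rw [rho, h, rhoEntry]
  simp_rw [h0]
  simp [avg]

/-! ### The covariance tables are positive semidefinite -/

section PosSemidef

variable {D} {t : ℕ} {Λ : ℝ}

theorem measurable_omega (hPc : ∀ s ∈ Finset.Icc 1 t, ∀ l, Continuous (D.P s l))
    (tau : ℕ → ℕ → ℝ) (delta : ℕ → ℝ) (l : Fin n) :
    Measurable fun w : ℕ → ℝ => D.omega tau delta l w t := by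
  induction t using Nat.strong_induction_on with
  | _ t ih =>
    rcases Nat.eq_zero_or_pos t with rfl | ht
    · simp_rw [omega_zero]; fun_prop
    · simp_rw [D.omega_eq _ _ _ _ ht]
      refine (hPc t (Finset.mem_Icc.2 ⟨ht, le_rfl⟩) l).measurable.comp
        (((measurable_pi_apply t).add (Finset.measurable_sum _ fun s hs => ?_)).add_const _)
      rw [Finset.mem_Icc] at hs
      exact (ih (s - 1) (by omega) fun r hr => hPc r
        (by rw [Finset.mem_Icc] at hr ⊢; omega)).const_mul _

theorem memLp_omega {P : Measure (ℕ → ℝ)} [IsProbabilityMeasure P]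
    (hZ : ∀ s, MemLp (fun w : ℕ → ℝ => w s) 2 P)
    (hP : ∀ s ∈ Finset.Icc 1 t, ∀ l, LipschitzWith Λ.toNNReal (D.P s l))
    (tau : ℕ → ℕ → ℝ) (delta : ℕ → ℝ) (l : Fin n) :
    MemLp (fun w => D.omega tau delta l w t) 2 P := by
  induction t using Nat.strong_induction_on with
  | _ t ih =>
    rcases Nat.eq_zero_or_pos t with rfl | ht
    · simp_rw [omega_zero]; exact memLp_const _
    · simp_rw [D.omega_eq _ _ _ _ ht]
      have hX : MemLp (fun w : ℕ → ℝ => w t + ∑ s ∈ Finset.Icc 1 t,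
          (tau t s + if t = s then 1 else 0) * D.omega tau delta l w (s - 1)
          + delta t * D.μstar l) 2 P := by
        refine ((hZ t).add (memLp_finsetSum _ fun s hs => ?_)).add (memLp_const _)
        rw [Finset.mem_Icc] at hs
        exact (ih (s - 1) (by omega) fun r hr => hP r
          (by rw [Finset.mem_Icc] at hr ⊢; omega)).const_mul _
      have hPt := hP t (Finset.mem_Icc.2 ⟨ht, le_rfl⟩) l
      refine ((memLp_const |D.P t l 0|).add (hX.abs.const_mul (Λ.toNNReal : ℝ))).mono
        (hPt.continuous.comp_aestronglyMeasurable hX.1) (ae_of_all _ fun w => ?_)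
      refine le_trans ?_ (le_abs_self _)
      set x := w t + ∑ s ∈ Finset.Icc 1 t,
          (tau t s + if t = s then 1 else 0) * D.omega tau delta l w (s - 1) + delta t * D.μstar l
      have := hPt.dist_le_mul x 0
      rw [Real.dist_eq, Real.dist_eq, sub_zero] at this
      calc |D.P t l x| = |D.P t l 0 + (D.P t l x - D.P t l 0)| := by ring_nf
        _ ≤ _ := (abs_add_le _ _).trans (add_le_add_right this _)

/-- The table `(symTable C i j)_{i, j ∈ I}` is positive semidefinite. -/
def IsCovTable (I : Finset ℕ) (C : ℕ → ℕ → ℝ) : Prop :=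
  (Matrix.of fun i j : I => symTable C i j).PosSemidef

/-- The entries in row `i` are integrals under the law of `W^([1:i-1])`. By consistency of
marginals, which needs `hW`, all of them can be computed under the law of `W^([1:T-1])`; the table
is then an average of Gram matrices. -/
theorem isCovTable_covZ (hP : ∀ s ∈ Finset.Icc 1 t, ∀ l, LipschitzWith Λ.toNNReal (D.P s l))
    {T : ℕ} (hT : T ≤ t + 1) (hW : IsCovTable (Finset.Icc 1 (T - 1)) D.covW) :
    IsCovTable (Finset.Icc 0 T) D.covZ := by
  have hZ (s : ℕ) : MemLp (fun w : ℕ → ℝ => w s) 2 (lawW D.covW (T - 1)) :=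
    memLp_apply_gaussianLaw s
  have : IsProbabilityMeasure (lawW D.covW (T - 1)) := isProbabilityMeasure_gaussianLaw _ _
  have hsub {i : ℕ} (hi : i ≤ T) : ∀ s ∈ Finset.Icc 1 (i - 1), s ∈ Finset.Icc 1 t := by
    intro s hs
    rw [Finset.mem_Icc] at hs ⊢; omega
  have hmem (l : Fin n) (i : Finset.Icc 0 T) :
      MemLp (fun w => D.omegaPred D.tau D.delta l w i) 2 (lawW D.covW (T - 1)) := by
    unfold omegaPred
    split_ifs with h
    · exact memLp_const _
    · exact memLp_omega hZ (fun s hs => hP s (hsub (Finset.mem_Icc.1 i.2).2 s hs)) _ _ l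
  have hmeas {i : ℕ} (hi : i ≤ T) (l : Fin n) :
      Measurable fun w => D.omegaPred D.tau D.delta l w i := by
    unfold omegaPred
    split_ifs with h
    · exact measurable_const
    · exact measurable_omega (fun s hs l => (hP s (hsub hi s hs) l).continuous) _ _ l
  have hent {i j : ℕ} (hj : j ≤ i) (hi : i ≤ T) : D.covZ i j = avg fun l : Fin n =>
      ∫ w, D.omegaPred D.tau D.delta l w j * D.omegaPred D.tau D.delta l w i
        ∂lawW D.covW (T - 1) := by
    rw [D.covZ_eq hj, covZEntry]
    refine avg_congr fun l => ?_
    refine integral_gaussianLaw_of_subset (Finset.Icc_subset_Icc le_rfl (by omega)) hW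
      ((hmeas (by omega) l).mul (hmeas hi l)) fun w => ?_
    congr 1
    · refine D.omegaPred_congr l (fun _ _ => rfl) (fun _ _ => rfl) fun s hs => if_pos ?_
      rw [Finset.mem_Icc] at hs ⊢; omega
    · exact D.omegaPred_congr l (fun _ _ => rfl) (fun _ _ => rfl) fun s hs => if_pos hs
  have hpsd := posSemidef_avg_integral_mul hmem zero_le_one
  have e : (Matrix.of fun i j : Finset.Icc 0 T => symTable D.covZ i j)
      = Matrix.of fun i j : Finset.Icc 0 T => 1 * avg fun l : Fin n =>
        ∫ w, D.omegaPred D.tau D.delta l w i * D.omegaPred D.tau D.delta l w j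
          ∂lawW D.covW (T - 1) := by
    ext i j
    simp only [Matrix.of_apply, one_mul]
    have hi := (Finset.mem_Icc.1 i.2).2
    have hj := (Finset.mem_Icc.1 j.2).2
    rcases le_total i.1 j.1 with h | h
    · rw [symTable, max_eq_right h, min_eq_left h, hent h hj]
    · rw [symTable, max_eq_left h, min_eq_right h, hent h hi]
      simp_rw [mul_comm]
  rw [IsCovTable, e]
  exact hpsd

/-- The same argument as for `covZ`, with `Υ` in place of `Ω`. The table of `W` up to `T` needs that
of `Z` up to `T`, which needs that of `W` up to `T - 1`; this closes the induction below. -/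
theorem isCovTable_covW (hL : ContDiff ℝ 3 fun q : ℝ × ℝ => D.L q.1 q.2)
    (h20 : ∀ x : ℝ, ∀ y ∈ Set.Icc (-1 : ℝ) 1, |pd 2 0 D.L x y| ≤ Λ)
    {T : ℕ} (hZ : IsCovTable (Finset.Icc 0 T) D.covZ) :
    IsCovTable (Finset.Icc 1 T) D.covW := by
  have : IsProbabilityMeasure (lawZ D.covZ T) := isProbabilityMeasure_gaussianLaw _ _
  have hmem (k : Fin m) (i : Finset.Icc 1 T) :
      MemLp (fun z => D.upsilon D.rho k z i) 2 (lawZ D.covZ T) :=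
    memLp_upsilon D.rho k hL h20 (fun s => memLp_apply_gaussianLaw s) i
  have hloc {i T' : ℕ} (h1 : 1 ≤ i) (hi : i ≤ T') (k : Fin m) (z : ℕ → ℝ) :
      D.upsilon D.rho k (fun j => if j ∈ Finset.Icc 0 T' then z j else 0) i
        = D.upsilon D.rho k z i := by
    rw [upsilon_eq_theta, upsilon_eq_theta, if_pos (by simp),
      D.theta_congr _ h1 (fun _ _ _ => rfl) fun s hs => if_pos ?_]
    rw [Finset.mem_Icc] at hs ⊢; omega
  have hent {i j : ℕ} (h1 : 1 ≤ j) (hj : j ≤ i) (hi : i ≤ T) : D.covW i j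
      = D.φ * avg fun k : Fin m => ∫ z, D.upsilon D.rho k z j * D.upsilon D.rho k z i
        ∂lawZ D.covZ T := by
    rw [D.covW_eq h1 hj, covWEntry]
    congr 1
    refine avg_congr fun k => ?_
    refine integral_gaussianLaw_of_subset (Finset.Icc_subset_Icc le_rfl hi) hZ
      ((measurable_upsilon _ k hL j).mul (measurable_upsilon _ k hL i)) fun z => ?_
    rw [hloc h1 hj, hloc (h1.trans hj) le_rfl]
  have hpsd := posSemidef_avg_integral_mul hmem (show 0 ≤ D.φ by unfold φ; positivity)
  have e : (Matrix.of fun i j : Finset.Icc 1 T => symTable D.covW i j)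
      = Matrix.of fun i j : Finset.Icc 1 T => D.φ * avg fun k : Fin m =>
        ∫ z, D.upsilon D.rho k z i * D.upsilon D.rho k z j ∂lawZ D.covZ T := by
    ext i j
    simp only [Matrix.of_apply]
    have hi := Finset.mem_Icc.1 i.2
    have hj := Finset.mem_Icc.1 j.2
    rcases le_total i.1 j.1 with h | h
    · rw [symTable, max_eq_right h, min_eq_left h, hent hi.1 h hj.2]
    · rw [symTable, max_eq_left h, min_eq_right h, hent hj.1 h hi.2]
      simp_rw [mul_comm]
  rw [IsCovTable, e]
  exact hpsd

/-- The covariances of `Z^([0:T])` produced by the state evolution are consistent. -/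
theorem isCovTable_covZ_of_le (hL : ContDiff ℝ 3 fun q : ℝ × ℝ => D.L q.1 q.2)
    (h20 : ∀ x : ℝ, ∀ y ∈ Set.Icc (-1 : ℝ) 1, |pd 2 0 D.L x y| ≤ Λ)
    (hP : ∀ s ∈ Finset.Icc 1 t, ∀ l, LipschitzWith Λ.toNNReal (D.P s l)) {T : ℕ} (hT : T ≤ t) :
    IsCovTable (Finset.Icc 0 T) D.covZ := by
  induction T with
  | zero =>
    refine isCovTable_covZ hP (by omega) ?_
    -- The induction starts from the empty table of `W`.
    have : IsEmpty (Finset.Icc 1 (0 - 1)) :=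
      ⟨fun i => by have := Finset.mem_Icc.1 i.2; omega⟩
    rw [IsCovTable, Subsingleton.elim (Matrix.of _) 0]
    exact Matrix.PosSemidef.zero
  | succ T ih => exact isCovTable_covZ hP (by omega) (isCovTable_covW hL h20 (ih (by omega)))

end PosSemidef

end Model
/-! ### Conditioning `Z^(0)` on `Z^([1:t])` -/

section Conditioning

open scoped NNReal MatrixOrder

/-- Coefficients of the linear regression of the coordinate `0` on the coordinates `1, …, t`. -/
theorem exists_regression {t : ℕ} {C : ℕ → ℕ → ℝ}
    (hC : (Matrix.of fun i j : Finset.Icc 0 t => C i j).PosSemidef) :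
    ∃ c : ℕ → ℝ, ∀ s ∈ Finset.Icc 1 t, ∑ r ∈ Finset.Icc 1 t, c r * C r s = C 0 s := by
  -- Writing `C = BᵀB` realizes `C` as the Gram matrix of the columns of `B`. Projecting column `0`
  -- orthogonally onto the span of the others gives the coefficients, even if the covariance of the
  -- regressors is singular.
  obtain ⟨B, hB⟩ := CStarAlgebra.nonneg_iff_eq_star_mul_self.1
    (Matrix.nonneg_iff_posSemidef.2 hC)
  have hmem {s : ℕ} (hs : s ∈ Finset.Icc 1 t) : s ∈ Finset.Icc 0 t :=
    Finset.Icc_subset_Icc (by omega) le_rfl hs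
  set b : Finset.Icc 0 t → EuclideanSpace ℝ (Finset.Icc 0 t) := fun i => WithLp.toLp 2 fun k => B k i
  have hinner (i j : Finset.Icc 0 t) : inner ℝ (b i) (b j) = C i j := by
    have := congrFun (congrFun hB i) j
    simp only [Matrix.of_apply, Matrix.star_eq_conjTranspose, Matrix.mul_apply,
      Matrix.conjTranspose_apply, star_trivial] at this
    rw [this]
    simp [b, PiLp.inner_apply, mul_comm]
  let bJ : Finset.Icc 1 t → EuclideanSpace ℝ (Finset.Icc 0 t) := fun s => b ⟨s, hmem s.2⟩
  have h0 : 0 ∈ Finset.Icc 0 t := by simp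
  obtain ⟨p, hp, q, hq, h⟩ :=
    (Submodule.span ℝ (Set.range bJ)).exists_add_mem_mem_orthogonal (b ⟨0, h0⟩)
  obtain ⟨c, rfl⟩ := (Submodule.mem_span_range_iff_exists_fun ℝ).1 hp
  refine ⟨fun r => if hr : r ∈ Finset.Icc 1 t then c ⟨r, hr⟩ else 0, fun s hs => ?_⟩
  have hq0 : inner ℝ q (bJ ⟨s, hs⟩) = 0 :=
    (Submodule.mem_orthogonal' _ _).1 hq _ (Submodule.subset_span ⟨_, rfl⟩)
  have := congrArg (fun x => inner ℝ x (bJ ⟨s, hs⟩)) h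
  simp only [inner_add_left, hq0, add_zero, sum_inner, inner_smul_left, bJ, hinner] at this
  rw [this, ← Finset.sum_coe_sort (Finset.Icc 1 t)]
  simp

/-- The linear form `∑_{s ∈ [1:t]} c_s z_s`. -/
noncomputable def linForm (c : ℕ → ℝ) (t : ℕ) (z : ℕ → ℝ) : ℝ := ∑ s ∈ Finset.Icc 1 t, c s * z s

/-- The sequence `z^([0:t])` with `z^(0)` replaced by a linear form in `z^([1:t])`. -/
noncomputable def condSeq (c : ℕ → ℝ) (t : ℕ) (z : ℕ → ℝ) (i : ℕ) : ℝ :=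
  if i = 0 then linForm c t z else if i ∈ Finset.Icc 1 t then z i else 0

variable {t : ℕ} {C : ℕ → ℕ → ℝ} {c : ℕ → ℝ}

theorem condSeq_zero (z : ℕ → ℝ) : condSeq c t z 0 = linForm c t z := if_pos rfl

theorem condSeq_of_mem {s : ℕ} (hs : s ∈ Finset.Icc 1 t) (z : ℕ → ℝ) : condSeq c t z s = z s := by
  rw [condSeq, if_neg (by rw [Finset.mem_Icc] at hs; omega), if_pos hs]

theorem condSeq_of_notMem {s : ℕ} (hs : s ∉ Finset.Icc 0 t) (z : ℕ → ℝ) : condSeq c t z s = 0 := by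
  rw [Finset.mem_Icc] at hs
  rw [condSeq, if_neg (by omega), if_neg (by rw [Finset.mem_Icc]; omega)]

theorem measurable_linForm : Measurable (linForm c t) := by
  unfold linForm
  fun_prop

theorem measurable_condSeq : Measurable (condSeq c t) := by
  refine measurable_pi_iff.2 fun i => ?_
  unfold condSeq
  split_ifs
  · exact measurable_linForm
  · fun_prop
  · fun_prop

theorem memLp_linForm : MemLp (linForm c t) 2 (gaussianLaw (Finset.Icc 0 t) C) :=
  memLp_finsetSum _ fun s _ => (memLp_apply_gaussianLaw s).const_mul _

theorem memLp_condSeq (i : ℕ) :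
    MemLp (fun z => condSeq c t z i) 2 (gaussianLaw (Finset.Icc 0 t) C) := by
  unfold condSeq
  split_ifs
  · exact memLp_linForm
  · exact memLp_apply_gaussianLaw i
  · exact memLp_const _

theorem integral_linForm : ∫ z, linForm c t z ∂gaussianLaw (Finset.Icc 0 t) C = 0 := by
  unfold linForm
  rw [integral_finsetSum _ fun i _ =>
    ((memLp_apply_gaussianLaw i).const_mul _).integrable one_le_two]
  exact Finset.sum_eq_zero fun i _ => by
    rw [integral_const_mul, integral_apply_gaussianLaw, mul_zero]

theorem integral_condSeq (i : ℕ) : ∫ z, condSeq c t z i ∂gaussianLaw (Finset.Icc 0 t) C = 0 := by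
  unfold condSeq
  split_ifs
  · exact integral_linForm
  · exact integral_apply_gaussianLaw i
  · simp

theorem integral_linForm_mul (hC : (Matrix.of fun i j : Finset.Icc 0 t => C i j).PosSemidef)
    (hc : ∀ s ∈ Finset.Icc 1 t, ∑ r ∈ Finset.Icc 1 t, c r * C r s = C 0 s) {s : ℕ}
    (hs : s ∈ Finset.Icc 1 t) :
    ∫ z, linForm c t z * z s ∂gaussianLaw (Finset.Icc 0 t) C = C 0 s := by
  have hsub := Finset.Icc_subset_Icc (Nat.zero_le 1) (le_refl t)
  simp_rw [linForm, Finset.sum_mul, mul_assoc]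
  rw [integral_finsetSum _ fun i _ => (integrable_mul_gaussianLaw _ _).const_mul _, ← hc s hs]
  refine Finset.sum_congr rfl fun r hr => ?_
  rw [integral_const_mul, integral_mul_gaussianLaw hC (hsub hr) (hsub hs)]

theorem integral_residual_mul (hC : (Matrix.of fun i j : Finset.Icc 0 t => C i j).PosSemidef)
    (hc : ∀ s ∈ Finset.Icc 1 t, ∑ r ∈ Finset.Icc 1 t, c r * C r s = C 0 s) {s : ℕ}
    (hs : s ∈ Finset.Icc 1 t) :
    ∫ z, (z 0 - linForm c t z) * z s ∂gaussianLaw (Finset.Icc 0 t) C = 0 := by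
  have hsub := Finset.Icc_subset_Icc (Nat.zero_le 1) (le_refl t)
  simp_rw [sub_mul]
  rw [integral_sub (integrable_mul_gaussianLaw _ _)
    (integrable_mul_of_memLp_two memLp_linForm (memLp_apply_gaussianLaw s)),
    integral_mul_gaussianLaw hC (by simp) (hsub hs), integral_linForm_mul hC hc hs, sub_self]

theorem residual_eq_sum (z : ℕ → ℝ) : z 0 - linForm c t z
    = ∑ i ∈ Finset.Icc 0 t, (if i = 0 then 1 else -c i) * z i := by
  rw [← Finset.add_sum_Ioc_eq_sum_Icc (Nat.zero_le t), linForm, sub_eq_add_neg,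
    ← Finset.sum_neg_distrib, if_pos rfl, one_mul]
  congr 1
  refine Finset.sum_congr rfl fun s hs => ?_
  rw [if_neg (by have := Finset.mem_Ioc.1 hs; omega), neg_mul]

/-- The residual of the regression is independent of the regressors. -/
theorem indepFun_residual (hC : (Matrix.of fun i j : Finset.Icc 0 t => C i j).PosSemidef)
    (hc : ∀ s ∈ Finset.Icc 1 t, ∑ r ∈ Finset.Icc 1 t, c r * C r s = C 0 s) :
    IndepFun (fun z : ℕ → ℝ => z 0 - linForm c t z) (fun z (s : Finset.Icc 1 t) => z s)
      (gaussianLaw (Finset.Icc 0 t) C) := by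
  have hsub := Finset.Icc_subset_Icc (Nat.zero_le 1) (le_refl t)
  have hk (z : ℕ → ℝ) (k : Finset.Icc 1 t) :
      ∑ i ∈ Finset.Icc 0 t, (if i = k.1 then 1 else 0) * z i = z k := by
    simpa using fun h : t < k.1 => absurd (Finset.mem_Icc.1 k.2).2 (by omega)
  have := indepFun_gaussianLaw (I := Finset.Icc 0 t) (C := C) (fun i => if i = 0 then 1 else -c i)
    (fun (k : Finset.Icc 1 t) i => if i = k.1 then 1 else 0) fun k => by
      simp_rw [hk, ← residual_eq_sum]
      exact integral_residual_mul hC hc k.2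
  simp_rw [hk, ← residual_eq_sum] at this
  exact this

theorem indepFun_residual_condSeq
    (hC : (Matrix.of fun i j : Finset.Icc 0 t => C i j).PosSemidef)
    (hc : ∀ s ∈ Finset.Icc 1 t, ∑ r ∈ Finset.Icc 1 t, c r * C r s = C 0 s) :
    IndepFun (fun z : ℕ → ℝ => z 0 - linForm c t z) (condSeq c t)
      (gaussianLaw (Finset.Icc 0 t) C) := by
  have hm : Measurable fun (x : Finset.Icc 1 t → ℝ) (i : ℕ) => if i = 0 then
      ∑ s : Finset.Icc 1 t, c s * x s else if hi : i ∈ Finset.Icc 1 t then x ⟨i, hi⟩ else 0 := by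
    refine measurable_pi_iff.2 fun i => ?_
    split_ifs <;> fun_prop
  refine ((indepFun_residual hC hc).comp measurable_id hm).congr (ae_of_all _ fun z => rfl)
    (ae_of_all _ fun z => ?_)
  ext i
  simp only [Function.comp_apply, condSeq, linForm, ← Finset.sum_coe_sort (Finset.Icc 1 t)]
  split_ifs <;> rfl

/-- The conditional variance of the coordinate `0` given the coordinates `1, …, t`. -/
noncomputable def residualVar (c : ℕ → ℝ) (t : ℕ) (C : ℕ → ℕ → ℝ) : ℝ≥0 :=
  (∫ z, (z 0 - linForm c t z) ^ 2 ∂gaussianLaw (Finset.Icc 0 t) C).toNNReal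

theorem coe_residualVar : (residualVar c t C : ℝ)
    = ∫ z, (z 0 - linForm c t z) ^ 2 ∂gaussianLaw (Finset.Icc 0 t) C :=
  Real.coe_toNNReal _ (integral_nonneg fun _ => sq_nonneg _)

theorem integral_residual :
    ∫ z, (z 0 - linForm c t z) ∂gaussianLaw (Finset.Icc 0 t) C = 0 := by
  rw [integral_sub ((memLp_apply_gaussianLaw 0).integrable one_le_two)
    (memLp_linForm.integrable one_le_two), integral_linForm, integral_apply_gaussianLaw, sub_self]

theorem map_residual : (gaussianLaw (Finset.Icc 0 t) C).map (fun z => z 0 - linForm c t z)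
    = gaussianReal 0 (residualVar c t C) := by
  have hG : HasGaussianLaw (fun z : ℕ → ℝ => z 0 - linForm c t z)
      (gaussianLaw (Finset.Icc 0 t) C) := by
    have := (hasGaussianLaw_gaussianLaw (Finset.Icc 0 t) C).map_fun
      (∑ i : Finset.Icc 0 t, (if i.1 = 0 then 1 else -c i) •
        ContinuousLinearMap.proj (R := ℝ) (φ := fun _ : Finset.Icc 0 t => ℝ) i)
    refine this.congr (ae_of_all _ fun z => ?_)
    simp only [residual_eq_sum, ← Finset.sum_coe_sort (Finset.Icc 0 t),
      sum_apply, smul_apply, ContinuousLinearMap.proj_apply,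
      smul_eq_mul]
  rw [hG.map_eq_gaussianReal, integral_residual,
    variance_of_integral_eq_zero hG.aemeasurable integral_residual, residualVar]

theorem integral_residual_mul_linForm
    (hC : (Matrix.of fun i j : Finset.Icc 0 t => C i j).PosSemidef)
    (hc : ∀ s ∈ Finset.Icc 1 t, ∑ r ∈ Finset.Icc 1 t, c r * C r s = C 0 s) :
    ∫ z, (z 0 - linForm c t z) * linForm c t z ∂gaussianLaw (Finset.Icc 0 t) C = 0 := by
  have hmem : MemLp (fun z : ℕ → ℝ => z 0 - linForm c t z) 2 (gaussianLaw (Finset.Icc 0 t) C) :=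
    (memLp_apply_gaussianLaw 0).sub memLp_linForm
  have e : (fun z : ℕ → ℝ => (z 0 - linForm c t z) * linForm c t z)
      = fun z => ∑ s ∈ Finset.Icc 1 t, c s * ((z 0 - linForm c t z) * z s) := by
    ext z
    rw [mul_comm]
    generalize z 0 - linForm c t z = x
    rw [linForm, Finset.sum_mul]
    exact Finset.sum_congr rfl fun s _ => by ring
  rw [e, integral_finsetSum _ fun s _ =>
    (integrable_mul_of_memLp_two hmem (memLp_apply_gaussianLaw s)).const_mul _]
  exact Finset.sum_eq_zero fun s hs => by
    rw [integral_const_mul, integral_residual_mul hC hc hs, mul_zero]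

/-- Pythagoras: the residual is orthogonal to the conditional mean. This identity later merges the
two jump contributions into one with weight `σ²`. -/
theorem var_eq_add (hC : (Matrix.of fun i j : Finset.Icc 0 t => C i j).PosSemidef)
    (hc : ∀ s ∈ Finset.Icc 1 t, ∑ r ∈ Finset.Icc 1 t, c r * C r s = C 0 s) :
    C 0 0 = residualVar c t C
      + ∫ z, linForm c t z * linForm c t z ∂gaussianLaw (Finset.Icc 0 t) C := by
  have hmem : MemLp (fun z : ℕ → ℝ => z 0 - linForm c t z) 2 (gaussianLaw (Finset.Icc 0 t) C) :=
    (memLp_apply_gaussianLaw 0).sub memLp_linForm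
  have h := integral_mul_gaussianLaw hC (i := 0) (j := 0) (by simp) (by simp)
  have e : (fun z : ℕ → ℝ => z 0 * z 0) = fun z => ((z 0 - linForm c t z) ^ 2
      + linForm c t z * linForm c t z) + 2 * ((z 0 - linForm c t z) * linForm c t z) := by
    ext z; ring
  have i1 := hmem.integrable_sq
  have hlin := memLp_linForm (c := c) (t := t) (C := C)
  have i2 := integrable_mul_of_memLp_two hlin hlin
  have i3 := integrable_mul_of_memLp_two hmem hlin
  have i4 : Integrable (fun z => (z 0 - linForm c t z) ^ 2 + linForm c t z * linForm c t z)
      (gaussianLaw (Finset.Icc 0 t) C) := i1.add i2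
  rw [← h, e, integral_add i4 (i3.const_mul 2), integral_add i1 i2, integral_const_mul,
    integral_residual_mul_linForm hC hc, coe_residualVar]
  simp

/-- The covariances of `condSeq`. -/
noncomputable def condSeqCov (c : ℕ → ℝ) (t : ℕ) (C : ℕ → ℕ → ℝ) (i j : ℕ) : ℝ :=
  ∫ z, condSeq c t z i * condSeq c t z j ∂gaussianLaw (Finset.Icc 0 t) C

theorem posSemidef_condSeqCov :
    (Matrix.of fun i j : Finset.Icc 0 t => condSeqCov c t C i j).PosSemidef :=
  posSemidef_integral_mul fun i : Finset.Icc 0 t => memLp_condSeq i.1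

theorem map_condSeq : (gaussianLaw (Finset.Icc 0 t) C).map (condSeq c t)
    = gaussianLaw (Finset.Icc 0 t) (condSeqCov c t C) := by
  refine map_eq_gaussianLaw measurable_condSeq ?_
    (ae_of_all _ fun z i hi => condSeq_of_notMem hi z) (fun i _ => integral_condSeq i)
    fun _ _ _ _ => rfl
  have hsub := Finset.Icc_subset_Icc (Nat.zero_le 1) (le_refl t)
  have := (hasGaussianLaw_gaussianLaw (Finset.Icc 0 t) C).map_fun
    (ContinuousLinearMap.pi fun i : Finset.Icc 0 t => if i.1 = 0 then
      ∑ s : Finset.Icc 1 t, c s • ContinuousLinearMap.proj (R := ℝ)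
        (φ := fun _ : Finset.Icc 0 t => ℝ) ⟨s, hsub s.2⟩
      else ContinuousLinearMap.proj i)
  refine this.congr (ae_of_all _ fun z => ?_)
  ext i
  have hi := Finset.mem_Icc.1 i.2
  simp only [ContinuousLinearMap.coe_pi', condSeq, linForm]
  split_ifs with h1 h2
  · simp [← Finset.sum_coe_sort (Finset.Icc 1 t)]
  · simp
  · exact absurd (Finset.mem_Icc.2 ⟨by omega, hi.2⟩) h2

/-- Integrals of functions of the residual and of the regressors. -/
theorem integral_residual_condSeq
    (hC : (Matrix.of fun i j : Finset.Icc 0 t => C i j).PosSemidef)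
    (hc : ∀ s ∈ Finset.Icc 1 t, ∑ r ∈ Finset.Icc 1 t, c r * C r s = C 0 s)
    {f : ℝ → (ℕ → ℝ) → ℝ} (hf : Measurable fun q : ℝ × (ℕ → ℝ) => f q.1 q.2)
    (hfi : Integrable (fun z => f (z 0 - linForm c t z) (condSeq c t z))
      (gaussianLaw (Finset.Icc 0 t) C)) :
    ∫ z, f (z 0 - linForm c t z) (condSeq c t z) ∂gaussianLaw (Finset.Icc 0 t) C
      = ∫ r, ∫ x, f x r ∂gaussianReal 0 (residualVar c t C)
        ∂gaussianLaw (Finset.Icc 0 t) (condSeqCov c t C) := by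
  have hV : Measurable fun z : ℕ → ℝ => z 0 - linForm c t z :=
    (measurable_pi_apply 0).sub measurable_linForm
  have hpair := (indepFun_iff_map_prod_eq_prod_map_map hV.aemeasurable
    measurable_condSeq.aemeasurable).1 (indepFun_residual_condSeq hC hc)
  rw [map_residual, map_condSeq] at hpair
  have hpm : Measurable fun z : ℕ → ℝ => (z 0 - linForm c t z, condSeq c t z) :=
    hV.prodMk measurable_condSeq
  have hint := (integrable_map_measure (g := fun q : ℝ × (ℕ → ℝ) => f q.1 q.2)
    hf.aestronglyMeasurable hpm.aemeasurable).2 hfi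
  have h := integral_map (μ := gaussianLaw (Finset.Icc 0 t) C)
    (f := fun q : ℝ × (ℕ → ℝ) => f q.1 q.2) hpm.aemeasurable
    hf.aestronglyMeasurable
  rw [hpair] at h hint
  rw [← h, integral_prod_symm _ hint]

end Conditioning

/-! ### Conditional expectation and variance given `Z^([1:t])` -/

section ConditionalLaw

open scoped NNReal

variable {t : ℕ} {C : ℕ → ℕ → ℝ} {c : ℕ → ℝ}

theorem sigmaZ_le : Model.sigmaZ t ≤ MeasurableSpace.pi :=
  Measurable.comap_le (measurable_pi_iff.2 fun s => measurable_pi_apply s.1)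

theorem measurable_apply_sigmaZ {s : ℕ} (hs : s ∈ Finset.Icc 1 t) :
    Measurable[Model.sigmaZ t] fun z : ℕ → ℝ => z s :=
  (measurable_pi_apply (⟨s, hs⟩ : Finset.Icc 1 t)).comp
    (comap_measurable fun (z : ℕ → ℝ) (s : Finset.Icc 1 t) => z s)

theorem measurable_linForm_sigmaZ : Measurable[Model.sigmaZ t] (linForm c t) :=
  Finset.measurable_sum _ fun _ hs => (measurable_apply_sigmaZ hs).const_mul _

theorem condExp_apply_sigmaZ {s : ℕ} (hs : s ∈ Finset.Icc 1 t) :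
    condExp (Model.sigmaZ t) (gaussianLaw (Finset.Icc 0 t) C) (fun z => z s) = fun z => z s :=
  condExp_of_stronglyMeasurable sigmaZ_le (measurable_apply_sigmaZ hs).stronglyMeasurable
    ((memLp_apply_gaussianLaw s).integrable one_le_two)

/-- The residual is independent of the regressors, so its conditional expectation is its mean, zero;
the linear form is measurable with respect to them. -/
theorem condExp_zero_sigmaZ (hC : (Matrix.of fun i j : Finset.Icc 0 t => C i j).PosSemidef)
    (hc : ∀ s ∈ Finset.Icc 1 t, ∑ r ∈ Finset.Icc 1 t, c r * C r s = C 0 s) :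
    condExp (Model.sigmaZ t) (gaussianLaw (Finset.Icc 0 t) C) (fun z => z 0)
      =ᵐ[gaussianLaw (Finset.Icc 0 t) C] linForm c t := by
  set γ := gaussianLaw (Finset.Icc 0 t) C
  have hV : Measurable fun z : ℕ → ℝ => z 0 - linForm c t z :=
    (measurable_pi_apply 0).sub measurable_linForm
  have hlin : MemLp (linForm c t) 2 γ := memLp_linForm
  have hVi : Integrable (fun z : ℕ → ℝ => z 0 - linForm c t z) γ :=
    ((memLp_apply_gaussianLaw 0).sub hlin).integrable one_le_two
  have e : (fun z : ℕ → ℝ => z 0) = (fun z => z 0 - linForm c t z) + linForm c t := by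
    ext z; simp
  have h1 : condExp (Model.sigmaZ t) γ (fun z => z 0 - linForm c t z)
      =ᵐ[γ] fun _ => ∫ z, (z 0 - linForm c t z) ∂γ :=
    condExp_indep_eq (m₁ := MeasurableSpace.comap (fun z : ℕ → ℝ => z 0 - linForm c t z) inferInstance)
      hV.comap_le sigmaZ_le (comap_measurable _).stronglyMeasurable (indepFun_residual hC hc)
  have h2 : condExp (Model.sigmaZ t) γ (linForm c t) = linForm c t :=
    condExp_of_stronglyMeasurable sigmaZ_le measurable_linForm_sigmaZ.stronglyMeasurable
      (hlin.integrable one_le_two)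
  rw [e]
  refine (condExp_add hVi (hlin.integrable one_le_two) _).trans ?_
  filter_upwards [h1] with z hz
  rw [Pi.add_apply, hz, h2, integral_residual, zero_add]

theorem condExp_sigmaZ (hC : (Matrix.of fun i j : Finset.Icc 0 t => C i j).PosSemidef)
    (hc : ∀ s ∈ Finset.Icc 1 t, ∑ r ∈ Finset.Icc 1 t, c r * C r s = C 0 s) {i : ℕ}
    (hi : i ∈ Finset.Icc 0 t) :
    condExp (Model.sigmaZ t) (gaussianLaw (Finset.Icc 0 t) C) (fun z => z i)
      =ᵐ[gaussianLaw (Finset.Icc 0 t) C] fun z => condSeq c t z i := by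
  rcases Nat.eq_zero_or_pos i with rfl | hi0
  · simpa only [condSeq_zero] using condExp_zero_sigmaZ hC hc
  · have hi' : i ∈ Finset.Icc 1 t := by rw [Finset.mem_Icc] at hi ⊢; omega
    rw [condExp_apply_sigmaZ hi']
    exact ae_of_all _ fun z => (condSeq_of_mem hi' z).symm

theorem integral_condVar_sigmaZ (hC : (Matrix.of fun i j : Finset.Icc 0 t => C i j).PosSemidef)
    (hc : ∀ s ∈ Finset.Icc 1 t, ∑ r ∈ Finset.Icc 1 t, c r * C r s = C 0 s) :
    ∫ z, condVar (Model.sigmaZ t) (fun z' : ℕ → ℝ => z' 0) (gaussianLaw (Finset.Icc 0 t) C) z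
      ∂gaussianLaw (Finset.Icc 0 t) C = residualVar c t C := by
  rw [condVar, integral_condExp sigmaZ_le, coe_residualVar]
  refine integral_congr_ae ?_
  filter_upwards [condExp_zero_sigmaZ hC hc] with z hz
  simp [hz]

namespace Model

variable {m n : ℕ} (D : Model m n)

theorem condSd_eq (hC : IsCovTable (Finset.Icc 0 t) D.covZ)
    (hc : ∀ s ∈ Finset.Icc 1 t,
      ∑ r ∈ Finset.Icc 1 t, c r * symTable D.covZ r s = symTable D.covZ 0 s) :
    D.condSd t = √(residualVar c t (symTable D.covZ) : ℝ) := by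
  rw [condSd, gaussZ, lawZ, integral_condVar_sigmaZ hC hc]

theorem condMeanLaw_eq (hC : IsCovTable (Finset.Icc 0 t) D.covZ)
    (hc : ∀ s ∈ Finset.Icc 1 t,
      ∑ r ∈ Finset.Icc 1 t, c r * symTable D.covZ r s = symTable D.covZ 0 s) :
    D.condMeanLaw t = gaussianLaw (Finset.Icc 0 t) (condSeqCov c t (symTable D.covZ)) := by
  refine gaussianLaw_congr fun i hi j hj => ?_
  have hi' := condExp_sigmaZ hC hc hi
  have hj' := condExp_sigmaZ hC hc hj
  rw [condMeanCov, gaussZ, lawZ, covariance_eq_sub ((memLp_condSeq i).ae_eq hi'.symm)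
    ((memLp_condSeq j).ae_eq hj'.symm), integral_congr_ae hi', integral_condSeq, zero_mul, sub_zero]
  exact integral_congr_ae (hi'.mul hj')

end Model

end ConditionalLaw

/-! ### Gaussian integration by parts across the jump of the sign -/

section JumpStein

open scoped NNReal

theorem abs_gaussianPDFReal_le (v : ℝ≥0) (x : ℝ) : |gaussianPDFReal 0 v x| ≤ (√(2 * Real.pi * v))⁻¹ := by
  rw [abs_of_nonneg (gaussianPDFReal_nonneg _ _ _), gaussianPDFReal]
  refine mul_le_of_le_one_right (by positivity) (Real.exp_le_one_iff.2 ?_)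
  exact div_nonpos_of_nonpos_of_nonneg (neg_nonpos.2 (sq_nonneg _)) (by positivity)

/-- Any function of the sign is affine in an indicator, so integrals over the residual reduce to the
probability and the first moment of a half-line. -/
theorem apply_sgn (f : ℝ → ℝ) (x : ℝ) :
    f (sgn x) = f (-1) + (if 0 ≤ x then 1 else 0) * (f 1 - f (-1)) := by
  unfold sgn; split_ifs <;> simp

theorem integral_apply_sgn (v : ℝ≥0) (f : ℝ → ℝ) (a : ℝ) :
    ∫ x, f (sgn (x + a)) ∂gaussianReal 0 v = f (-1) + upperProb v a * (f 1 - f (-1)) := by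
  simp_rw [apply_sgn f]
  rw [integral_add (integrable_const _) ((integrable_ite_nonneg v a).mul_const _),
    integral_mul_const, upperProb]
  simp

theorem integral_id_mul_apply_sgn {v : ℝ≥0} (hv : v ≠ 0) (f : ℝ → ℝ) (a : ℝ) :
    ∫ x, x * f (sgn (x + a)) ∂gaussianReal 0 v = v * gaussianPDFReal 0 v a * (f 1 - f (-1)) := by
  have hid := memLp_id_gaussianReal_two v
  have e : (fun x => x * f (sgn (x + a)))
      = fun x => x * f (-1) + (x * (if 0 ≤ x + a then 1 else 0)) * (f 1 - f (-1)) := by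
    ext x; rw [apply_sgn f]; ring
  have hi : Integrable (fun x : ℝ => x * (if 0 ≤ x + a then (1 : ℝ) else 0)) (gaussianReal 0 v) := by
    refine (hid.integrable one_le_two).mono (Measurable.mul measurable_id (Measurable.ite
      (measurableSet_nonneg_add a) measurable_const measurable_const)).aestronglyMeasurable
      (ae_of_all _ fun x => ?_)
    split_ifs <;> simp
  rw [e, integral_add ((hid.integrable one_le_two).mul_const _) (hi.mul_const _),
    integral_mul_const, integral_mul_const, integral_id_mul_indicator_gaussianReal hv]
  simp

variable {t : ℕ} {C : ℕ → ℕ → ℝ} {c : ℕ → ℝ}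

/-- Gaussian integration by parts for a function of `z^([0:t])` which depends on `z^(0)` through
the sign of `z^(0) + ξ` only. -/
theorem integral_zero_mul_sgn (hC : (Matrix.of fun i j : Finset.Icc 0 t => C i j).PosSemidef)
    (hC0 : ∀ s, C s 0 = C 0 s)
    (hc : ∀ s ∈ Finset.Icc 1 t, ∑ r ∈ Finset.Icc 1 t, c r * C r s = C 0 s)
    (hv : residualVar c t C ≠ 0) (ξ : ℝ)
    {F : ℝ → (ℕ → ℝ) → ℝ} {F' : ℝ → (ℕ → ℝ) → (ℕ → ℝ) → ℝ}
    (hFloc : ∀ y z z', (∀ s ∈ Finset.Icc 1 t, z s = z' s) → F y z = F y z')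
    (hF'loc : ∀ y z z' h, (∀ s ∈ Finset.Icc 1 t, z s = z' s) → F' y z h = F' y z' h)
    (hFm : Measurable fun q : ℝ × (ℕ → ℝ) => F q.1 q.2)
    (hF'm : ∀ h, Measurable fun q : ℝ × (ℕ → ℝ) => F' q.1 q.2 h)
    (hder : ∀ y z h, HasDerivAt (fun r : ℝ => F y (z + r • h)) (F' y z h) 0)
    (hlin : ∀ y z h, F' y z h = ∑ s ∈ Finset.Icc 1 t, h s * F' y z (Pi.single s 1))
    (hbd : ∀ h, ∃ B, ∀ y ∈ Set.Icc (-1 : ℝ) 1, ∀ z, |F' y z h| ≤ B)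
    (hJ : ∃ B, ∀ z, |F 1 z - F (-1) z| ≤ B)
    (hmem : MemLp (F (-1)) 2 (gaussianLaw (Finset.Icc 0 t) C)) :
    ∫ z, z 0 * F (sgn (z 0 + ξ)) z ∂gaussianLaw (Finset.Icc 0 t) C
      = ∑ s ∈ Finset.Icc 1 t, C s 0 *
          ∫ z, F' (sgn (z 0 + ξ)) z (Pi.single s 1) ∂gaussianLaw (Finset.Icc 0 t) C
        + C 0 0 * ∫ z, gaussianPDFReal 0 (residualVar c t C) (ξ + z 0) * (F 1 z - F (-1) z)
          ∂gaussianLaw (Finset.Icc 0 t) (condSeqCov c t C) := by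
  set γ := gaussianLaw (Finset.Icc 0 t) C with hγ
  set κ := gaussianLaw (Finset.Icc 0 t) (condSeqCov c t C) with hκ
  set v := residualVar c t C with hvdef
  obtain ⟨BJ, hBJ⟩ := hJ
  have hcs (z : ℕ → ℝ) : ∀ s ∈ Finset.Icc 1 t, z s = condSeq c t z s :=
    fun s hs => (condSeq_of_mem hs z).symm
  have hlin2 : MemLp (linForm c t) 2 γ := memLp_linForm
  have hV2 : MemLp (fun z : ℕ → ℝ => z 0 - linForm c t z) 2 γ :=
    (memLp_apply_gaussianLaw 0).sub hlin2
  have hFmy (y : ℝ) : Measurable (F y) := hFm.comp measurable_prodMk_left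
  have hF'my (y : ℝ) (h : ℕ → ℝ) : Measurable fun z => F' y z h :=
    (hF'm h).comp measurable_prodMk_left
  have hmap : γ.map (condSeq c t) = κ := map_condSeq
  have hFκ : MemLp (F (-1)) 2 κ := by
    rw [← hmap, memLp_map_measure_iff (hFmy _).aestronglyMeasurable measurable_condSeq.aemeasurable]
    refine hmem.congr_norm ((hFmy _).comp measurable_condSeq).aestronglyMeasurable
      (ae_of_all _ fun z => ?_)
    rw [Function.comp_apply, hFloc _ _ _ (hcs z)]
  have hsg : Measurable fun q : ℝ × (ℕ → ℝ) => sgn (q.1 + (q.2 0 + ξ)) :=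
    measurable_sgn.comp (by fun_prop)
  have hGm : Measurable fun q : ℝ × (ℕ → ℝ) => F (sgn (q.1 + (q.2 0 + ξ))) q.2 :=
    hFm.comp (hsg.prodMk measurable_snd)
  -- The argument of the sign splits as residual plus `condSeq 0 + ξ`, and `F` does not see the
  -- coordinate `0`; the integrand is thus a function of the independent pair (residual, `condSeq`).
  have hG (z : ℕ → ℝ) : F (sgn (z 0 - linForm c t z + (condSeq c t z 0 + ξ))) (condSeq c t z)
      = F (sgn (z 0 + ξ)) z := by
    rw [← hFloc _ _ _ (hcs z), condSeq_zero]
    congr 2; ring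
  have hF2 : MemLp (fun z => F (sgn (z 0 + ξ)) z) 2 γ := by
    have hm : Measurable fun z : ℕ → ℝ => F (sgn (z 0 + ξ)) z :=
      hFm.comp ((measurable_sgn.comp (by fun_prop)).prodMk measurable_id)
    refine (hmem.abs.add (memLp_const BJ)).mono hm.aestronglyMeasurable (ae_of_all _ fun z => ?_)
    refine le_trans ?_ (le_abs_self _)
    rw [apply_sgn (fun y => F y z), Real.norm_eq_abs]
    refine (abs_add_le _ _).trans (add_le_add_right ?_ _)
    refine le_trans ?_ (hBJ z)
    rw [abs_mul]
    exact mul_le_of_le_one_left (abs_nonneg _) (by split_ifs <;> simp)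
  -- the part of `z^(0)` that is independent of `z^([1:t])`
  have h1 : ∫ z, (z 0 - linForm c t z) * F (sgn (z 0 + ξ)) z ∂γ
      = v * ∫ z, gaussianPDFReal 0 v (ξ + z 0) * (F 1 z - F (-1) z) ∂κ := by
    have := integral_residual_condSeq hC hc (f := fun x r => x * F (sgn (x + (r 0 + ξ))) r)
      (measurable_fst.mul hGm) (by
        simp_rw [hG]; exact integrable_mul_of_memLp_two hV2 hF2)
    simp_rw [hG] at this
    rw [this, ← integral_const_mul]
    congr 1; ext r
    rw [integral_id_mul_apply_sgn hv fun y => F y r, add_comm ξ]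
    ring
  -- the part of `z^(0)` that is a function of `z^([1:t])`
  set A : (ℕ → ℝ) → ℝ := fun r => F (-1) r + upperProb v (r 0 + ξ) * (F 1 r - F (-1) r) with hA
  have hupc : Continuous (upperProb v) :=
    continuous_iff_continuousAt.2 fun x => (hasDerivAt_upperProb hv x).continuousAt
  have hupm : Measurable fun r : ℕ → ℝ => upperProb v (r 0 + ξ) :=
    hupc.measurable.comp (by fun_prop)
  have hJm : Measurable fun r : ℕ → ℝ => F 1 r - F (-1) r := (hFmy _).sub (hFmy _)
  have hAm : Measurable A := (hFmy _).add (hupm.mul hJm)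
  have hA2 : MemLp A 2 κ := by
    refine hFκ.add (MemLp.of_bound (hupm.mul hJm).aestronglyMeasurable BJ (ae_of_all _ fun r => ?_))
    rw [norm_mul]
    exact (mul_le_of_le_one_left (norm_nonneg _) (abs_upperProb_le _ _)).trans (hBJ r)
  have h2 : ∫ z, linForm c t z * F (sgn (z 0 + ξ)) z ∂γ = ∫ r, r 0 * A r ∂κ := by
    have := integral_residual_condSeq hC hc (f := fun x r => r 0 * F (sgn (x + (r 0 + ξ))) r)
      (Measurable.mul (by fun_prop) hGm) (by
        simp_rw [hG, condSeq_zero]; exact integrable_mul_of_memLp_two hlin2 hF2)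
    simp_rw [hG, condSeq_zero] at this
    rw [this]
    congr 1; ext r
    rw [integral_const_mul, integral_apply_sgn v fun y => F y r]
  have h3 (s : ℕ) : ∫ z, F' (sgn (z 0 + ξ)) z (Pi.single s 1) ∂γ
      = ∫ r, (F' (-1) r (Pi.single s 1)
        + upperProb v (r 0 + ξ) * (F' 1 r (Pi.single s 1) - F' (-1) r (Pi.single s 1))) ∂κ := by
    obtain ⟨B, hB⟩ := hbd (Pi.single s 1)
    have hG' (z : ℕ → ℝ) : F' (sgn (z 0 - linForm c t z + (condSeq c t z 0 + ξ))) (condSeq c t z)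
        (Pi.single s 1) = F' (sgn (z 0 + ξ)) z (Pi.single s 1) := by
      rw [← hF'loc _ _ _ _ (hcs z), condSeq_zero]
      congr 2; ring
    have := integral_residual_condSeq hC hc
      (f := fun x r => F' (sgn (x + (r 0 + ξ))) r (Pi.single s 1))
      ((hF'm _).comp (hsg.prodMk measurable_snd)) (by
        simp_rw [hG']
        have hm : Measurable fun z : ℕ → ℝ => F' (sgn (z 0 + ξ)) z (Pi.single s 1) :=
          (hF'm _).comp ((measurable_sgn.comp (by fun_prop)).prodMk measurable_id)
        exact Integrable.of_bound hm.aestronglyMeasurable B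
          (ae_of_all _ fun z => hB _ (sgn_mem_Icc _) z))
    simp_rw [hG'] at this
    rw [this]
    congr 1; ext r
    exact integral_apply_sgn v (fun y => F' y r (Pi.single s 1)) _
  -- integration by parts under the law of the conditional means
  set h : ℕ → ℝ := fun i => if i ∈ Finset.Icc 0 t then condSeqCov c t C i 0 else 0 with hh
  -- Replacing `z 0` by its conditional mean keeps its covariances with `z 1, …, z t`, by the normal
  -- equations. Its variance becomes that of the linear form.
  have hhs {s : ℕ} (hs : s ∈ Finset.Icc 1 t) : h s = C s 0 := by
    have hs' : s ∈ Finset.Icc 0 t := Finset.Icc_subset_Icc (Nat.zero_le 1) le_rfl hs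
    simp only [hh, hs', if_true, condSeqCov, condSeq_of_mem hs, condSeq_zero]
    rw [hC0, ← integral_linForm_mul hC hc hs]
    simp_rw [mul_comm]
  have hh0 : h 0 = ∫ z, linForm c t z * linForm c t z ∂γ := by
    simp only [hh, condSeqCov, condSeq_zero]
    rw [if_pos (by simp)]
  -- The derivative of `upperProb` contributes the density times the jump of `F`, with weight `h 0`;
  -- the other terms are derivatives of `F` with the response frozen.
  set A' : (ℕ → ℝ) → ℝ := fun r => F' (-1) r h + (gaussianPDFReal 0 v (ξ + r 0) * h 0
      * (F 1 r - F (-1) r) + upperProb v (r 0 + ξ) * (F' 1 r h - F' (-1) r h)) with hA'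
  have hgm : Measurable fun r : ℕ → ℝ => gaussianPDFReal 0 v (ξ + r 0) :=
    (measurable_gaussianPDFReal 0 v).comp (by fun_prop)
  have hA'm : Measurable A' := (hF'my _ h).add (((hgm.mul_const _).mul hJm).add
    (hupm.mul ((hF'my _ h).sub (hF'my _ h))))
  have hAder (z : ℕ → ℝ) : HasDerivAt (fun r : ℝ => A (z + r • h)) (A' z) 0 := by
    have hu : HasDerivAt (fun r : ℝ => upperProb v ((z + r • h) 0 + ξ))
        (gaussianPDFReal 0 v (ξ + z 0) * h 0) 0 := by
      have h5 : HasDerivAt (fun r : ℝ => (z + r • h) 0 + ξ) (h 0) 0 := by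
        simpa using (((hasDerivAt_id (0 : ℝ)).mul_const (h 0)).const_add (z 0)).add_const ξ
      exact HasDerivAt.comp_of_eq (0 : ℝ) (hasDerivAt_upperProb hv (ξ + z 0)) h5
        (by simp [add_comm])
    have := (hder (-1) z h).add (hu.mul ((hder 1 z h).sub (hder (-1) z h)))
    refine this.congr_deriv ?_
    simp [hA', add_comm ξ]
  obtain ⟨Bh, hBh⟩ := hbd h
  have hm1 : (-1 : ℝ) ∈ Set.Icc (-1 : ℝ) 1 := by simp
  have hp1 : (1 : ℝ) ∈ Set.Icc (-1 : ℝ) 1 := by simp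
  have hstein := integral_apply_mul_gaussianLaw posSemidef_condSeqCov (i₀ := 0) (by simp)
    (A := A) (A' := A') (h := h) (B := Bh + ((√(2 * Real.pi * v))⁻¹ * |h 0| * BJ + 1 * (Bh + Bh)))
    (fun i hi => by simp only [hh, hi, if_true]) (fun i hi => by simp only [hh, hi, if_false])
    hAder hAm hA'm (fun z => by
      have hB0 : 0 ≤ BJ := (abs_nonneg _).trans (hBJ z)
      refine (abs_add_le _ _).trans (add_le_add (hBh _ hm1 z) ((abs_add_le _ _).trans
        (add_le_add ?_ ?_)))
      · rw [abs_mul, abs_mul]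
        exact mul_le_mul (mul_le_mul_of_nonneg_right (abs_gaussianPDFReal_le _ _) (abs_nonneg _))
          (hBJ z) (abs_nonneg _) (by positivity)
      · rw [abs_mul]
        exact mul_le_mul (abs_upperProb_le _ _) ((abs_sub _ _).trans
          (add_le_add (hBh _ hp1 z) (hBh _ hm1 z))) (abs_nonneg _) zero_le_one) hA2
  have hA'eq (r : ℕ → ℝ) : A' r = ∑ s ∈ Finset.Icc 1 t, C s 0 * (F' (-1) r (Pi.single s 1)
        + upperProb v (r 0 + ξ) * (F' 1 r (Pi.single s 1) - F' (-1) r (Pi.single s 1)))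
      + h 0 * (gaussianPDFReal 0 v (ξ + r 0) * (F 1 r - F (-1) r)) := by
    simp only [hA']
    rw [hlin (-1) r h, hlin 1 r h, ← Finset.sum_sub_distrib, Finset.mul_sum]
    have : ∀ s ∈ Finset.Icc 1 t, C s 0 * (F' (-1) r (Pi.single s 1)
        + upperProb v (r 0 + ξ) * (F' 1 r (Pi.single s 1) - F' (-1) r (Pi.single s 1)))
        = h s * F' (-1) r (Pi.single s 1) + upperProb v (r 0 + ξ) *
          (h s * F' 1 r (Pi.single s 1) - h s * F' (-1) r (Pi.single s 1)) := by
      intro s hs; rw [hhs hs]; ring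
    rw [Finset.sum_congr rfl this, Finset.sum_add_distrib]
    ring
  have hi3 (s : ℕ) : Integrable (fun r => F' (-1) r (Pi.single s 1)
        + upperProb v (r 0 + ξ) * (F' 1 r (Pi.single s 1) - F' (-1) r (Pi.single s 1))) κ := by
    obtain ⟨B, hB⟩ := hbd (Pi.single s 1)
    refine Integrable.of_bound ((hF'my _ _).add (hupm.mul
      ((hF'my _ _).sub (hF'my _ _)))).aestronglyMeasurable (B + 1 * (B + B))
      (ae_of_all _ fun z => (norm_add_le _ _).trans (add_le_add (hB _ hm1 z) ?_))
    rw [norm_mul]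
    exact mul_le_mul (abs_upperProb_le _ _) ((abs_sub _ _).trans
      (add_le_add (hB _ hp1 z) (hB _ hm1 z))) (abs_nonneg _) zero_le_one
  have hi4 : Integrable (fun r => gaussianPDFReal 0 v (ξ + r 0) * (F 1 r - F (-1) r)) κ := by
    refine Integrable.of_bound (hgm.mul hJm).aestronglyMeasurable ((√(2 * Real.pi * v))⁻¹ * BJ)
      (ae_of_all _ fun z => ?_)
    rw [norm_mul]
    exact mul_le_mul (abs_gaussianPDFReal_le _ _) (hBJ z) (abs_nonneg _) (by positivity)
  have h4 : ∫ r, A' r ∂κ = ∑ s ∈ Finset.Icc 1 t, C s 0 *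
        ∫ z, F' (sgn (z 0 + ξ)) z (Pi.single s 1) ∂γ
      + h 0 * ∫ r, gaussianPDFReal 0 v (ξ + r 0) * (F 1 r - F (-1) r) ∂κ := by
    simp_rw [hA'eq, h3]
    rw [integral_add (integrable_finsetSum _ fun s _ => (hi3 s).const_mul _) (hi4.const_mul _),
      integral_finsetSum _ fun s _ => (hi3 s).const_mul _, integral_const_mul]
    simp_rw [integral_const_mul]
  have hsplit : ∫ z, z 0 * F (sgn (z 0 + ξ)) z ∂γ
      = ∫ z, (z 0 - linForm c t z) * F (sgn (z 0 + ξ)) z ∂γ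
        + ∫ z, linForm c t z * F (sgn (z 0 + ξ)) z ∂γ := by
    rw [← integral_add (integrable_mul_of_memLp_two hV2 hF2)
      (integrable_mul_of_memLp_two hlin2 hF2)]
    congr 1; ext z; ring
  -- The jump term occurs with weight `v` from the residual and `h 0` from the conditional mean, and
  -- `v + h 0 = C 0 0`.
  rw [hsplit, h1, h2, hstein, h4, var_eq_add hC hc, hh0]
  ring

end JumpStein

/-! ### The uniform variable and the response vector -/

open scoped NNReal

theorem integral_unifLaw (f : ℝ → ℝ) :
    ∫ u, f u ∂unifLaw = 2⁻¹ * ∫ u in (-1 : ℝ)..1, f u := by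
  rw [unifLaw, ProbabilityTheory.cond, integral_smul_measure, Real.volume_Icc,
    intervalIntegral.integral_of_le (by norm_num), integral_Icc_eq_integral_Ioc]
  norm_num

instance isProbabilityMeasure_unifLaw : IsProbabilityMeasure unifLaw :=
  cond_isProbabilityMeasure_of_finite (by norm_num [Real.volume_Icc]) (by norm_num [Real.volume_Icc])

theorem ae_unifLaw_mem : ∀ᵐ u ∂unifLaw, u ∈ Set.Icc (-1 : ℝ) 1 :=
  ae_cond_mem measurableSet_Icc

theorem gaussDensity_sqrt (v : ℝ≥0) (x : ℝ) : gaussDensity (√v) x = gaussianPDFReal 0 v x := by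
  rw [gaussDensity, Real.sq_sqrt v.coe_nonneg, Real.toNNReal_coe]

namespace Model

variable {m n : ℕ} {D : Model m n} {t : ℕ}

/-- Row `i` of the matrix is row `i - 1` of `rho`. The first row is zero by definition; in the
others `i ≤ j` gives `i - 1 < j`, where `rho` vanishes. -/
theorem onsagerMat_eq_zero {i j : Finset.Icc 1 t} (h : i ≤ j) : D.onsagerMat t i j = 0 := by
  have hi := Finset.mem_Icc.1 i.2
  have h' : i.1 ≤ j.1 := h
  rw [onsagerMat, Matrix.of_apply]
  split_ifs with h0
  · rfl
  · push Not at h0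
    exact D.rho_eq_zero (by omega) (by omega)

theorem sum_onsagerMat_mul (x : ℕ → ℝ) (r : Finset.Icc 1 t) :
    ∑ s : Finset.Icc 1 t, D.onsagerMat t r s * x s
      = ∑ s ∈ Finset.Icc 1 (r.1 - 1), D.rho (r.1 - 1) s * x s := by
  have hr := Finset.mem_Icc.1 r.2
  simp only [onsagerMat, Matrix.of_apply]
  rw [Finset.sum_coe_sort (Finset.Icc 1 t)
    fun s => (if r.1 = 1 ∨ s = t then 0 else D.rho (r.1 - 1) s) * x s]
  symm
  refine Finset.sum_subset_zero_on_sdiff (Finset.Icc_subset_Icc le_rfl (by omega))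
    (fun s hs => ?_) fun s hs => ?_
  · rw [Finset.mem_sdiff, Finset.mem_Icc, Finset.mem_Icc] at hs
    split_ifs with h0
    · exact zero_mul _
    · push Not at h0
      rw [D.rho_eq_zero (by omega) (by omega), zero_mul]
  · rw [Finset.mem_Icc] at hs
    rw [if_neg (by omega)]

/-- The vector `(I + η 𝔏₁ 𝔒)⁻¹ 𝔩₂` solves the recursion for the derivative of `∂₁ L (Θ°, u)`
in `u`. -/
theorem response_eq (u : ℝ) (z : ℕ → ℝ) (r : Finset.Icc 1 t) :
    D.response t u z r = D.crossResponse D.rho u z r := by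
  set M : Matrix (Finset.Icc 1 t) (Finset.Icc 1 t) ℝ :=
    1 + D.η • (D.hessDiag t u z * D.onsagerMat t) with hM
  have hent (i j : Finset.Icc 1 t) : M i j = (1 : Matrix (Finset.Icc 1 t) (Finset.Icc 1 t) ℝ) i j
      + D.η * (pd 2 0 D.L (D.theta D.rho u z i) u * D.onsagerMat t i j) := by
    simp [hM, hessDiag, Matrix.diagonal_mul, thetaCirc_eq_theta]
  -- Lower triangular with unit diagonal, so `M` is invertible without any condition on the size of
  -- `η` or of the Onsager coefficients.
  have hdet : M.det = 1 := by
    rw [Matrix.det_of_isLowerTriangular M fun i j hij => ?_]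
    · refine Finset.prod_eq_one fun i _ => ?_
      rw [hent, onsagerMat_eq_zero le_rfl]; simp
    · have hij' : i < j := hij
      rw [hent, onsagerMat_eq_zero hij'.le, Matrix.one_apply_ne hij'.ne]; simp
  -- Row `i` of this system is the recursion of `crossResponse` at time `i`.
  have hsol : M.mulVec (fun s => D.crossResponse D.rho u z s) = D.crossVec t u z := by
    ext i
    simp only [Matrix.mulVec, dotProduct, hent, add_mul, Finset.sum_add_distrib]
    have h1 : ∑ s : Finset.Icc 1 t, D.η * (pd 2 0 D.L (D.theta D.rho u z i) u * D.onsagerMat t i s) *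
        D.crossResponse D.rho u z s = pd 2 0 D.L (D.theta D.rho u z i) u *
          ∑ s ∈ Finset.Icc 1 (i.1 - 1), D.η * D.rho (i.1 - 1) s * D.crossResponse D.rho u z s := by
      simp_rw [mul_assoc D.η]
      rw [← Finset.mul_sum, ← Finset.mul_sum, ← sum_onsagerMat_mul, Finset.mul_sum, Finset.mul_sum,
        Finset.mul_sum]
      exact Finset.sum_congr rfl fun s _ => by ring
    rw [h1]
    simp only [Matrix.one_apply, ite_mul, one_mul, zero_mul, Finset.sum_ite_eq, Finset.mem_univ,
      if_true]
    rw [D.crossResponse_eq, crossVec, thetaCirc_eq_theta]; ring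
  rw [response, ← hM, ← hsol, Matrix.mulVec_mulVec, Matrix.nonsing_inv_mul _ (by simp [hdet]),
    Matrix.one_mulVec]

section

variable {Λ : ℝ} (rho : ℕ → ℕ → ℝ)

/-- Although only the responses `±1` occur in the model, the loss is smooth in between, so the jump
is the integral of the total derivative in the response. The density `1/2` of `U` then accounts for
the factor `2` in the formula for `δ_t`. -/
theorem pd_theta_sub_eq_integral (hL : ContDiff ℝ 3 fun q : ℝ × ℝ => D.L q.1 q.2) (z : ℕ → ℝ) :
    pd 1 0 D.L (D.theta rho 1 z t) 1 - pd 1 0 D.L (D.theta rho (-1) z t) (-1)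
      = ∫ u in (-1 : ℝ)..1, D.crossResponse rho u z t := by
  refine (intervalIntegral.integral_eq_sub_of_hasDerivAt
    (f := fun u => pd 1 0 D.L (D.theta rho u z t) u)
    (fun u _ => hasDerivAt_pd_theta_response rho u z t hL) ?_).symm
  exact ((continuous_crossResponse rho t hL).comp
    (Continuous.prodMk_left z)).intervalIntegrable _ _

theorem integral_crossResponse (hL : ContDiff ℝ 3 fun q : ℝ × ℝ => D.L q.1 q.2) (z : ℕ → ℝ) :
    ∫ u, D.crossResponse rho u z t ∂unifLaw = 2⁻¹ *
      (pd 1 0 D.L (D.theta rho 1 z t) 1 - pd 1 0 D.L (D.theta rho (-1) z t) (-1)) := by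
  rw [integral_unifLaw, pd_theta_sub_eq_integral rho hL]

theorem symTable_comm (C : ℕ → ℕ → ℝ) (i j : ℕ) : symTable C i j = symTable C j i := by
  rw [symTable, symTable, max_comm, min_comm]

/-- The contribution of the jump of the sign to Gaussian integration by parts for `Υ_t`. -/
theorem integral_zero_mul_upsilon (hL : ContDiff ℝ 3 fun q : ℝ × ℝ => D.L q.1 q.2)
    (h20 : ∀ x : ℝ, ∀ y ∈ Set.Icc (-1 : ℝ) 1, |pd 2 0 D.L x y| ≤ Λ)
    (h11 : ∀ x : ℝ, ∀ y ∈ Set.Icc (-1 : ℝ) 1, |pd 1 1 D.L x y| ≤ Λ) (ht : 1 ≤ t)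
    {C : ℕ → ℕ → ℝ} {c : ℕ → ℝ} (hC : IsCovTable (Finset.Icc 0 t) C)
    (hc : ∀ s ∈ Finset.Icc 1 t, ∑ r ∈ Finset.Icc 1 t, c r * symTable C r s = symTable C 0 s)
    (hv : residualVar c t (symTable C) ≠ 0) (k : Fin m) :
    ∫ z, z 0 * D.upsilon rho k z t ∂lawZ C t
      = ∑ s ∈ Finset.Icc 1 t, C s 0 *
          ∫ z, partialAt s (fun z' => D.upsilon rho k z' t) z ∂lawZ C t
        + C 0 0 * (-2 * D.η * ∫ z, gaussianPDFReal 0 (residualVar c t (symTable C)) (D.ξ k + z 0) *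
            ∫ u, D.crossResponse rho u z t ∂unifLaw
              ∂gaussianLaw (Finset.Icc 0 t) (condSeqCov c t (symTable C))) := by
  have hs0 (s : ℕ) : symTable C s 0 = C s 0 := by simp [symTable]
  have hθ {y : ℝ} {z z' : ℕ → ℝ} {r : ℕ} (hr : 1 ≤ r) (hrt : r ≤ t)
      (hz : ∀ s ∈ Finset.Icc 1 t, z s = z' s) : D.theta rho y z r = D.theta rho y z' r :=
    D.theta_congr y hr (fun _ _ _ => rfl) fun s hs => hz s (Finset.Icc_subset_Icc le_rfl hrt hs)
  have hdθ {y : ℝ} {z z' h : ℕ → ℝ} (hz : ∀ s ∈ Finset.Icc 1 t, z s = z' s) :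
      D.dtheta rho y z h t = D.dtheta rho y z' h t := by
    have : ∀ r, 1 ≤ r → r ≤ t → D.dtheta rho y z h r = D.dtheta rho y z' h r := by
      intro r
      induction r using Nat.strong_induction_on with
      | _ r ih =>
        intro hr hrt
        rw [D.dtheta_eq, D.dtheta_eq]
        congr 1
        refine Finset.sum_congr rfl fun s hs => ?_
        rw [Finset.mem_Icc] at hs
        rw [hθ hs.1 (by omega) hz, ih s (by omega) hs.1 (by omega)]
    exact this t ht le_rfl
  obtain ⟨BJ, hBJ⟩ := exists_bound_crossResponse rho t h20 h11
  have key := integral_zero_mul_sgn hC (fun s => symTable_comm C s 0) hc hv (D.ξ k)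
    (F := fun y z => -D.η * pd 1 0 D.L (D.theta rho y z t) y)
    (F' := fun y z h => -D.η * (pd 2 0 D.L (D.theta rho y z t) y * D.dtheta rho y z h t))
    (fun y z z' hz => by simp only [hθ ht le_rfl hz])
    (fun y z z' h hz => by simp only [hθ ht le_rfl hz, hdθ hz])
    ((continuous_pd_theta rho t hL).measurable.const_mul _)
    (fun h => ((continuous_comp_pd_two_zero (continuous_theta rho t hL) continuous_fst hL).mul
      (continuous_dtheta rho h t hL)).measurable.const_mul _)
    (fun y z h => by
      simpa using (hasDerivAt_pd_theta_line rho y z h t hL 0).const_mul (-D.η))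
    (fun y z h => by
      rw [D.dtheta_eq_sum rho y z h t ht le_rfl, Finset.mul_sum, Finset.mul_sum]
      exact Finset.sum_congr rfl fun s _ => by ring)
    (fun h => by
      obtain ⟨B, hB⟩ := exists_bound_dtheta rho h t h20
      refine ⟨|D.η| * (Λ * B), fun y hy z => ?_⟩
      rw [abs_mul, abs_mul, abs_neg]
      have h1 := h20 (D.theta rho y z t) y hy
      exact mul_le_mul_of_nonneg_left (mul_le_mul h1 (hB y hy z) (abs_nonneg _)
        ((abs_nonneg _).trans h1)) (abs_nonneg _))
    -- The jump is the integral of a bounded derivative over `[-1, 1]`, so it is bounded although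
    -- `∂₁L` itself may grow linearly.
    (by
      refine ⟨|D.η| * (BJ * |1 - (-1)|), fun z => ?_⟩
      rw [← mul_sub, pd_theta_sub_eq_integral rho hL, abs_mul, abs_neg]
      refine mul_le_mul_of_nonneg_left ?_ (abs_nonneg _)
      rw [← Real.norm_eq_abs]
      refine intervalIntegral.norm_integral_le_of_norm_le_const fun u hu => hBJ u ?_ z
      rw [Set.uIoc_of_le (by norm_num)] at hu
      exact Set.Ioc_subset_Icc_self hu)
    ((memLp_pd_theta rho t hL h20 (fun s => memLp_apply_gaussianLaw s) measurable_const
      fun _ => by simp).const_mul _)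
  have e1 (z : ℕ → ℝ) : D.upsilon rho k z t = -D.η * pd 1 0 D.L
      (D.theta rho (sgn (z 0 + D.ξ k)) z t) (sgn (z 0 + D.ξ k)) := D.upsilon_eq_theta rho z t k
  have e2 : ∑ s ∈ Finset.Icc 1 t, C s 0 *
        ∫ z, partialAt s (fun z' => D.upsilon rho k z' t) z ∂lawZ C t
      = ∑ s ∈ Finset.Icc 1 t, symTable C s 0 * ∫ z, -D.η * (pd 2 0 D.L
        (D.theta rho (sgn (z 0 + D.ξ k)) z t) (sgn (z 0 + D.ξ k)) *
        D.dtheta rho (sgn (z 0 + D.ξ k)) z (Pi.single s 1) t) ∂lawZ C t := by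
    refine Finset.sum_congr rfl fun s hs => ?_
    simp_rw [hs0, partialAt_upsilon rho k hL (Finset.mem_Icc.1 hs).1]
  rw [e2]
  simp_rw [e1]
  refine key.trans ?_
  rw [hs0]
  congr 2
  -- `F 1 - F (-1)` equals `-2 η` times the mean of `crossResponse` over `U`.
  rw [← integral_const_mul (-2 * D.η)]
  simp_rw [integral_crossResponse rho hL]
  congr 1
  funext z
  ring

end

end Model

/-! ### The formula for `δ_t` -/

open scoped NNReal

theorem avg_const {N : ℕ} (hN : N ≠ 0) (a : ℝ) : avg (fun _ : Fin N => a) = a := by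
  have : (N : ℝ) ≠ 0 := by exact_mod_cast hN
  simp [avg, this]

theorem avg_add {N : ℕ} (f g : Fin N → ℝ) : avg (fun k => f k + g k) = avg f + avg g := by
  rw [avg, Finset.sum_add_distrib, mul_add, avg, avg]

theorem avg_const_mul {N : ℕ} (a : ℝ) (f : Fin N → ℝ) : avg (fun k => a * f k) = a * avg f := by
  rw [avg, ← Finset.mul_sum, avg]; ring

theorem avg_sum {N : ℕ} {ι : Type*} (S : Finset ι) (f : ι → Fin N → ℝ) :
    avg (fun k => ∑ s ∈ S, f s k) = ∑ s ∈ S, avg (f s) := by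
  simp_rw [avg]
  rw [Finset.sum_comm, Finset.mul_sum]

namespace Model

variable {m n : ℕ} {D : Model m n} {t : ℕ} {Λ : ℝ}

section Response

variable {κ : Measure (ℕ → ℝ)} [IsProbabilityMeasure κ] (rho : ℕ → ℕ → ℝ)

theorem integrable_gaussianPDFReal_mul_crossResponse
    (hL : ContDiff ℝ 3 fun q : ℝ × ℝ => D.L q.1 q.2)
    (h20 : ∀ x : ℝ, ∀ y ∈ Set.Icc (-1 : ℝ) 1, |pd 2 0 D.L x y| ≤ Λ)
    (h11 : ∀ x : ℝ, ∀ y ∈ Set.Icc (-1 : ℝ) 1, |pd 1 1 D.L x y| ≤ Λ) (v : ℝ≥0) (ξ : ℝ) :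
    Integrable (fun q : ℝ × (ℕ → ℝ) =>
      gaussianPDFReal 0 v (ξ + q.2 0) * D.crossResponse rho q.1 q.2 t) (unifLaw.prod κ) := by
  obtain ⟨B, hB⟩ := exists_bound_crossResponse rho t h20 h11
  refine Integrable.of_bound (Measurable.mul ((measurable_gaussianPDFReal 0 v).comp (by fun_prop))
    (continuous_crossResponse rho t hL).measurable).aestronglyMeasurable
    ((√(2 * Real.pi * v))⁻¹ * B) ?_
  -- The bound on `crossResponse` is available for `u ∈ [-1, 1]` only, which holds almost surely.
  filter_upwards [Measure.quasiMeasurePreserving_fst.ae ae_unifLaw_mem] with q hq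
  rw [norm_mul]
  exact mul_le_mul (abs_gaussianPDFReal_le _ _) (hB _ hq _) (norm_nonneg _) (by positivity)

theorem integral_prod_gaussianPDFReal_mul_crossResponse
    (hL : ContDiff ℝ 3 fun q : ℝ × ℝ => D.L q.1 q.2)
    (h20 : ∀ x : ℝ, ∀ y ∈ Set.Icc (-1 : ℝ) 1, |pd 2 0 D.L x y| ≤ Λ)
    (h11 : ∀ x : ℝ, ∀ y ∈ Set.Icc (-1 : ℝ) 1, |pd 1 1 D.L x y| ≤ Λ) (v : ℝ≥0) (ξ : ℝ) :
    ∫ q : ℝ × (ℕ → ℝ), gaussianPDFReal 0 v (ξ + q.2 0) * D.crossResponse rho q.1 q.2 t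
        ∂(unifLaw.prod κ)
      = ∫ z, gaussianPDFReal 0 v (ξ + z 0) * ∫ u, D.crossResponse rho u z t ∂unifLaw ∂κ := by
  rw [integral_prod_symm _
    (integrable_gaussianPDFReal_mul_crossResponse rho hL h20 h11 v ξ)]
  simp_rw [integral_const_mul]

end Response

/-- The information parameter, in terms of the conditional law of `Z^(0)` given `Z^([1:t])`. -/
theorem delta_eq_integral (hL : ContDiff ℝ 3 fun q : ℝ × ℝ => D.L q.1 q.2)
    (h20 : ∀ x : ℝ, ∀ y ∈ Set.Icc (-1 : ℝ) 1, |pd 2 0 D.L x y| ≤ Λ)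
    (h11 : ∀ x : ℝ, ∀ y ∈ Set.Icc (-1 : ℝ) 1, |pd 1 1 D.L x y| ≤ Λ) (ht : 1 ≤ t)
    (hφ : D.φ ≠ 0) {c : ℕ → ℝ} (hC : IsCovTable (Finset.Icc 0 t) D.covZ)
    (hc : ∀ s ∈ Finset.Icc 1 t,
      ∑ r ∈ Finset.Icc 1 t, c r * symTable D.covZ r s = symTable D.covZ 0 s)
    (hv : residualVar c t (symTable D.covZ) ≠ 0) :
    D.delta t = -2 * D.φ * D.η * avg fun k : Fin m =>
      ∫ z, gaussianPDFReal 0 (residualVar c t (symTable D.covZ)) (D.ξ k + z 0) *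
        ∫ u, D.crossResponse D.rho u z t ∂unifLaw
          ∂gaussianLaw (Finset.Icc 0 t) (condSeqCov c t (symTable D.covZ)) := by
  have hvar := var_eq_add hC hc
  -- `σ² ≥ 𝔳_t² > 0`, so `μ_* ≠ 0` need not be assumed separately and the division by `σ²` is
  -- legitimate.
  have hσ : D.covZ 0 0 ≠ 0 := by
    have h0 : (0 : ℝ) < residualVar c t (symTable D.covZ) := by positivity
    have h1 : 0 ≤ ∫ z, linForm c t z * linForm c t z
      ∂gaussianLaw (Finset.Icc 0 t) (symTable D.covZ) := integral_nonneg fun _ => mul_self_nonneg _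
    have h2 : symTable D.covZ 0 0 = D.covZ 0 0 := rfl
    rw [← h2, hvar]; positivity
  rw [D.delta_eq ht, deltaEntry, ← D.covZ_zero]
  simp_rw [integral_zero_mul_upsilon D.rho hL h20 h11 ht hC hc hv, D.tau_eq ht, tauEntry]
  rw [avg_add, avg_sum, avg_const_mul, avg_const_mul]
  simp_rw [avg_const_mul]
  -- Averaged over `k`, the smooth terms are exactly the correction `φ⁻¹ ∑ τ_{t,s} Cov (Z^(0),
  -- Z^(s))` in the definition of `δ_t`; only the jump term survives.
  have e : ∀ s ∈ Finset.Icc 1 t, D.φ * (avg fun k : Fin m =>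
        ∫ z, partialAt s (fun z' => D.upsilon D.rho k z' t) z ∂lawZ D.covZ t) * D.covZ s 0
      = D.φ * (D.covZ s 0 * avg fun k : Fin m =>
        ∫ z, partialAt s (fun z' => D.upsilon D.rho k z' t) z ∂lawZ D.covZ t) := fun s _ => by ring
  rw [Finset.sum_congr rfl e, ← Finset.mul_sum, inv_mul_cancel_left₀ hφ, add_sub_cancel_left]
  field_simp

/-! ### The quadratic loss -/

section Quadratic

theorem pd_one_zero_of_quadratic (hq : ∀ x y : ℝ, D.L x y = (x - y) ^ 2 / 2) (x y : ℝ) :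
    pd 1 0 D.L x y = x - y := by
  simp [pd, hq]

theorem pd_two_zero_of_quadratic (hL : ContDiff ℝ 3 fun q : ℝ × ℝ => D.L q.1 q.2)
    (hq : ∀ x y : ℝ, D.L x y = (x - y) ^ 2 / 2) (x y : ℝ) : pd 2 0 D.L x y = 1 := by
  have h := hasDerivAt_pd_one_zero hL (hasDerivAt_id x) (hasDerivAt_const x y)
  simp only [id_eq, mul_one, mul_zero, add_zero, pd_one_zero_of_quadratic hq] at h
  exact h.unique ((hasDerivAt_id x).sub_const y)

variable (rho : ℕ → ℕ → ℝ) (y : ℝ) (z h : ℕ → ℝ)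

/-- Since `∂₁₁L = 1`, the linear recursion has constant coefficients; the base point `(0, 0)` is an
arbitrary choice. -/
theorem dtheta_of_quadratic (hL : ContDiff ℝ 3 fun q : ℝ × ℝ => D.L q.1 q.2)
    (hq : ∀ x y : ℝ, D.L x y = (x - y) ^ 2 / 2) :
    D.dtheta rho y z h t = D.dtheta rho 0 0 h t := by
  induction t using Nat.strong_induction_on with
  | _ t ih =>
    rw [D.dtheta_eq, D.dtheta_eq]
    congr 1
    refine Finset.sum_congr rfl fun s hs => ?_
    rw [Finset.mem_Icc] at hs
    rw [ih s (by omega), pd_two_zero_of_quadratic hL hq, pd_two_zero_of_quadratic hL hq]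

/-- As `∂₁L (x, y) = x - y`, the difference `θ_t - y` solves the same linear recursion as `dtheta`,
with input `z_i - y`. -/
theorem theta_sub_of_quadratic (hL : ContDiff ℝ 3 fun q : ℝ × ℝ => D.L q.1 q.2)
    (hq : ∀ x y : ℝ, D.L x y = (x - y) ^ 2 / 2) :
    D.theta rho y z t - y = D.dtheta rho 0 0 (fun i => z i - y) t := by
  induction t using Nat.strong_induction_on with
  | _ t ih =>
    rw [D.theta_eq, D.dtheta_eq, sub_right_comm]
    congr 1
    refine Finset.sum_congr rfl fun s hs => ?_
    rw [Finset.mem_Icc] at hs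
    rw [pd_one_zero_of_quadratic hq, ih s (by omega), pd_two_zero_of_quadratic hL hq, one_mul]

theorem upsilon_of_quadratic (hL : ContDiff ℝ 3 fun q : ℝ × ℝ => D.L q.1 q.2)
    (hq : ∀ x y : ℝ, D.L x y = (x - y) ^ 2 / 2) (ht : 1 ≤ t) (k : Fin m) :
    D.upsilon rho k z t = -D.η * ∑ s ∈ Finset.Icc 1 t,
      (z s - sgn (z 0 + D.ξ k)) * D.dtheta rho 0 0 (Pi.single s 1) t := by
  rw [upsilon_eq_theta, pd_one_zero_of_quadratic hq, theta_sub_of_quadratic rho _ z hL hq,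
    D.dtheta_eq_sum rho 0 0 _ t ht le_rfl]

theorem integral_zero_mul_sgn_gaussianLaw {C : ℕ → ℕ → ℝ}
    (hC : (Matrix.of fun i j : Finset.Icc 0 t => C i j).PosSemidef) (h0 : 0 < C 0 0) (ξ : ℝ) :
    ∫ z, z 0 * sgn (z 0 + ξ) ∂gaussianLaw (Finset.Icc 0 t) C
      = 2 * C 0 0 * gaussianPDFReal 0 (C 0 0).toNNReal ξ := by
  have hm : Measurable fun x : ℝ => x * sgn (x + ξ) :=
    measurable_id.mul (measurable_sgn.comp (by fun_prop))
  have h1 := integral_map (μ := gaussianLaw (Finset.Icc 0 t) C) (φ := fun z : ℕ → ℝ => z 0)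
    (measurable_pi_apply 0).aemeasurable hm.aestronglyMeasurable
  rw [← h1, map_apply_gaussianLaw hC (by simp),
    integral_id_mul_apply_sgn (by simpa using h0) fun y => y, Real.coe_toNNReal _ h0.le]
  ring

/-- Here `Υ_t = -η ∑ a_s (z_s - sgn (z_0 + ξ_k))` and `τ_{t,s} = -φ η a_s` with deterministic `a_s`.
The covariances `E Z^(0) Z^(s)` cancel against the correction in `δ_t`, and `E Z^(0) sgn (Z^(0) +
ξ_k) = 2 σ² 𝔤_σ (ξ_k)` gives the rest. Nothing is conditioned on, so `σ > 0` replaces `𝔳_t > 0`. -/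
theorem delta_of_quadratic (hL : ContDiff ℝ 3 fun q : ℝ × ℝ => D.L q.1 q.2)
    (hq : ∀ x y : ℝ, D.L x y = (x - y) ^ 2 / 2) (ht : 1 ≤ t) (hφ : D.φ ≠ 0) (hm : m ≠ 0)
    (hσ : 0 < D.sigmaSq) (hC : IsCovTable (Finset.Icc 0 t) D.covZ) :
    D.delta t = -2 * (avg fun k : Fin m => gaussDensity (√D.sigmaSq) (D.ξ k)) *
      ∑ s ∈ Finset.Icc 1 t, D.tau t s := by
  set a : ℕ → ℝ := fun s => D.dtheta D.rho 0 0 (Pi.single s 1) t with ha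
  set g : Fin m → ℝ := fun k => gaussDensity (√D.sigmaSq) (D.ξ k) with hg
  have hprob : IsProbabilityMeasure (lawZ D.covZ t) := isProbabilityMeasure_gaussianLaw _ _
  have hs0 (s : ℕ) : symTable D.covZ s 0 = D.covZ s 0 := by simp [symTable]
  have hτ {s : ℕ} (hs : s ∈ Finset.Icc 1 t) : D.tau t s = -(D.φ * D.η) * a s := by
    rw [D.tau_eq ht, tauEntry]
    simp_rw [partialAt_upsilon D.rho _ hL (Finset.mem_Icc.1 hs).1,
      pd_two_zero_of_quadratic hL hq, dtheta_of_quadratic D.rho _ _ _ hL hq]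
    simp only [integral_const, probReal_univ, smul_eq_mul, one_mul]
    rw [avg_const hm]; ring
  have hsgn (k : Fin m) : ∫ z, z 0 * sgn (z 0 + D.ξ k) ∂lawZ D.covZ t = 2 * D.sigmaSq * g k := by
    have h00 : symTable D.covZ 0 0 = D.sigmaSq := D.covZ_zero
    have h := integral_zero_mul_sgn_gaussianLaw hC (by rw [h00]; exact hσ) (D.ξ k)
    rw [h00] at h
    simp only [hg, gaussDensity, Real.sq_sqrt hσ.le]
    exact h
  have hZ (s : ℕ) : MemLp (fun z : ℕ → ℝ => z s) 2 (lawZ D.covZ t) := memLp_apply_gaussianLaw s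
  have hsg (k : Fin m) : MemLp (fun z : ℕ → ℝ => sgn (z 0 + D.ξ k)) 2 (lawZ D.covZ t) :=
    MemLp.of_bound (measurable_sgn.comp (by fun_prop)).aestronglyMeasurable 1
      (ae_of_all _ fun z => abs_le.2 (sgn_mem_Icc _))
  have hint (k : Fin m) : ∫ z, z 0 * D.upsilon D.rho k z t ∂lawZ D.covZ t
      = ∑ s ∈ Finset.Icc 1 t, -(D.η * a s) * D.covZ s 0
        + (2 * D.sigmaSq * D.η * ∑ s ∈ Finset.Icc 1 t, a s) * g k := by
    have e : (fun z : ℕ → ℝ => z 0 * D.upsilon D.rho k z t) = fun z => ∑ s ∈ Finset.Icc 1 t,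
        -(D.η * a s) * (z s * z 0 - z 0 * sgn (z 0 + D.ξ k)) := by
      ext z
      rw [upsilon_of_quadratic D.rho z hL hq ht k, Finset.mul_sum, Finset.mul_sum]
      exact Finset.sum_congr rfl fun s _ => by simp only [ha]; ring
    have hi (s : ℕ) := integrable_mul_of_memLp_two (hZ s) (hZ 0)
    have hi' := integrable_mul_of_memLp_two (hZ 0) (hsg k)
    have hi2 (s : ℕ) : Integrable (fun z : ℕ → ℝ => z s * z 0 - z 0 * sgn (z 0 + D.ξ k))
        (lawZ D.covZ t) := (hi s).sub hi'
    rw [e, integral_finsetSum _ fun s _ => (hi2 s).const_mul _, Finset.mul_sum,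
      Finset.sum_mul, ← Finset.sum_add_distrib]
    refine Finset.sum_congr rfl fun s hs => ?_
    rw [integral_const_mul, integral_sub (hi s) hi', hsgn, lawZ, integral_mul_gaussianLaw hC
      (Finset.Icc_subset_Icc (Nat.zero_le 1) le_rfl hs) (by simp), hs0]
    ring
  rw [D.delta_eq ht, deltaEntry]
  simp_rw [hint]
  rw [avg_add, avg_const hm, avg_const_mul, Finset.sum_congr rfl fun s hs => hτ hs,
    Finset.sum_congr rfl fun s hs => show D.tau t s * D.covZ s 0
      = D.φ * (-(D.η * a s) * D.covZ s 0) by rw [hτ hs]; ring, ← Finset.mul_sum, ← Finset.mul_sum,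
    inv_mul_cancel_left₀ hφ]
  have hσ' := hσ.ne'
  field_simp
  ring

end Quadratic

end Model

end GenLogistic

theorem lemma5p2 {m n : ℕ} (D : GenLogistic.Model m n) (t : ℕ) (ht : 1 ≤ t)
    (K Λ : ℝ) (hK : 2 ≤ K) (hΛ : 2 ≤ Λ)
    -- the aspect ratio
    (hφ : D.φ ∈ Set.Icc (1 / K) K)
    -- the step size
    (hη : 0 < D.η) (hηΛ : D.η ≤ Λ)
    -- the operators `P_1, …, P_t`
    (hP : ∀ s ∈ Finset.Icc 1 t, ∀ l : Fin n,
      Differentiable ℝ (D.P s l) ∧ |D.P s l 0| ≤ Λ ∧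
      LipschitzWith Λ.toNNReal (D.P s l) ∧ LipschitzWith Λ.toNNReal (deriv (D.P s l)))
    -- the loss function
    (hL : ContDiff ℝ 3 (fun q : ℝ × ℝ => D.L q.1 q.2))
    (hLΛ : ∀ x : ℝ, ∀ y ∈ Set.Icc (-1 : ℝ) 1, ∀ a b : ℕ, (a + b = 2 ∨ a + b = 3) →
      |GenLogistic.pd 1 0 D.L 0 0| + |GenLogistic.pd a b D.L x y| ≤ Λ) :
    (0 < D.condSd t →
      (∀ k : Fin m, MeasureTheory.Integrable
        (fun q : ℝ × (ℕ → ℝ) =>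
          GenLogistic.gaussDensity (D.condSd t) (D.ξ k + q.2 0) *
            D.response t q.1 q.2 ⟨t, Finset.mem_Icc.2 ⟨ht, le_rfl⟩⟩)
        (GenLogistic.unifLaw.prod (D.condMeanLaw t))) ∧
      D.delta t = -2 * D.φ * D.η * GenLogistic.avg fun k : Fin m =>
        ∫ q : ℝ × (ℕ → ℝ),
          GenLogistic.gaussDensity (D.condSd t) (D.ξ k + q.2 0) *
            D.response t q.1 q.2 ⟨t, Finset.mem_Icc.2 ⟨ht, le_rfl⟩⟩
          ∂(GenLogistic.unifLaw.prod (D.condMeanLaw t))) ∧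
    ((∀ x y : ℝ, D.L x y = (x - y) ^ 2 / 2) → D.μstar ≠ 0 →
      D.delta t =
        -2 * (GenLogistic.avg fun k : Fin m =>
            GenLogistic.gaussDensity (Real.sqrt D.sigmaSq) (D.ξ k)) *
          ∑ s ∈ Finset.Icc 1 t, D.tau t s) := by
  have hpd (a b : ℕ) (hab : a + b = 2 ∨ a + b = 3) (x y : ℝ) (hy : y ∈ Set.Icc (-1 : ℝ) 1) :
      |GenLogistic.pd a b D.L x y| ≤ Λ :=
    le_trans (le_add_of_nonneg_left (abs_nonneg _)) (hLΛ x y hy a b hab)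
  have h20 := hpd 2 0 (by norm_num)
  have h11 := hpd 1 1 (by norm_num)
  -- `φ ≥ 1 / K > 0`; since `φ = m / n` is `0` when `m = 0` or `n = 0`, both dimensions are nonzero.
  have hφ0 : D.φ ≠ 0 := ((by positivity : (0 : ℝ) < 1 / K).trans_le hφ.1).ne'
  have hm : m ≠ 0 := by
    rintro rfl
    exact hφ0 (by simp [GenLogistic.Model.φ])
  have hn : n ≠ 0 := by
    rintro rfl
    exact hφ0 (by simp [GenLogistic.Model.φ])
  have hC := GenLogistic.Model.isCovTable_covZ_of_le hL h20 (fun s hs l => (hP s hs l).2.2.1)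
    (le_refl t)
  refine ⟨fun hpos => ?_, fun hq hμ => ?_⟩
  · obtain ⟨c, hc⟩ := GenLogistic.exists_regression hC
    have hsd := D.condSd_eq hC hc
    -- A zero residual variance would make the conditional standard deviation zero.
    have hv : GenLogistic.residualVar c t (GenLogistic.symTable D.covZ) ≠ 0 := by
      intro h0
      rw [h0] at hsd
      simp [hsd] at hpos
    simp_rw [hsd, GenLogistic.gaussDensity_sqrt, GenLogistic.Model.response_eq,
      D.condMeanLaw_eq hC hc]
    refine ⟨fun k => GenLogistic.Model.integrable_gaussianPDFReal_mul_crossResponse D.rho hL h20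
      h11 _ _, ?_⟩
    rw [GenLogistic.Model.delta_eq_integral hL h20 h11 ht hφ0 hC hc hv]
    simp_rw [GenLogistic.Model.integral_prod_gaussianPDFReal_mul_crossResponse D.rho hL h20 h11]
  · refine GenLogistic.Model.delta_of_quadratic hL hq ht hφ0 hm ?_ hC
    obtain ⟨i, hi⟩ := Function.ne_iff.1 hμ
    refine div_pos (Finset.sum_pos' (fun i _ => sq_nonneg _) ⟨i, Finset.mem_univ _, ?_⟩) ?_
    · exact sq_pos_of_ne_zero hi
    · exact_mod_cast Nat.pos_of_ne_zero hn
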